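/- Let $d,k,n\ge 0$ be integers. Let $\mathcal G$ be a compact, second countable, Hausdorff topological group with its Borel $\sigma$-algebra and normalised Haar measure $\lambda$ ($\lambda(\mathcal G)=1$), and let $\phi:\mathcal G\to \mathsf O_d$ and $\psi:\mathcal G\to\mathsf O_k$ be measurable orthogonal representations on $\mathbb R^d$ and $\mathbb R^k$. Write $\chi_\phi(g)=\operatorname{tr}\phi(g)$, $\chi_\psi(g)=\operatorname{tr}\psi(g)$ and $\langle\chi_\psi,\chi_\phi\rangle=\int_{\mathcal G}\chi_\psi(g)\chi_\phi(g)\,d\lambda(g)$. For $W\in\mathbb R^{d\times k}$ let $f_W(x)=W^\top x$ and $$\overline W=\Psi(W)=\int_{\mathcal G}\phi(g)\,W\,\psi(g^{-1})\,d\lambda(g).$$ Let $\sigma_X>0$, $\sigma_\xi\ge 0$, $X\sim\mathcal N(0,\sigma_X^2 I_d)$ and $Y=\Theta^\top X+\xi$, where $\Theta\in\mathbb R^{d\times k}$ is such that $f_\Theta$ is equivariant, i.e. $f_\Theta(\phi(g)x)=\psi(g)f_\Theta(x)$ for all $g,x$, and $\xi$ is a random vector in $\mathbb R^k$, independent of $X$,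 with $\mathbb E[\xi]=0$ and $\mathbb E[\xi\xi^\top]=\sigma_\xi^2 I_k$. Let $(X_1,Y_1),\dots,(X_n,Y_n)$ be i.i.d. copies of $(X,Y)$, independent of $(X,Y)$. Let $W$ be the minimum-norm least squares estimate from this sample, i.e. the solution of least Frobenius norm of $\operatorname{argmin}_{U\in\mathbb R^{d\times k}}\|\mathbf Y-\mathbf X U\|_F^2$, where $\mathbf X\in\mathbb R^{n\times d}$ and $\mathbf Y\in\mathbb R^{n\times k}$ have rows $X_i^\top$ and $Y_i^\top$. For a predictor $f$ let $R[f]=\mathbb E\|f(X)-Y\|_2^2$, the expectation being over $(X,Y)$ only, conditionally on any randomness in $f$; the expectations of $R[f_W]-R[f_{\overline W}]$ below are over the training sample. 1. If $n>d+1$, then $R[f_W]-R[f_{\overline W}]$ is integrable and $$\mathbb E\big[R[f_W]-R[f_{\overline W}]\big]=\sigma_\xi^2\,\frac{dk-\langle\chi_\psi,\chi_\phi\rangle}{n-d-1}.$$ 2. If $d-1\le n\le d+1$, $\sigma_\xi>0$, and it is not the case that $f_W$ is almost surely equivariant, then $R[f_W]-R[f_{\overline W}]\ge 0$ almost surely and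 $\mathbb E\big[R[f_W]-R[f_{\overline W}]\big]=\infty$. 3. If $n<d-1$, then $R[f_W]-R[f_{\overline W}]$ is integrable and $$\mathbb E\big[R[f_W]-R[f_{\overline W}]\big]=\sigma_X^2\,\frac{n(d-n)}{d(d-1)(d+2)}\Big((d+1)\|\Theta\|_F^2-\operatorname{tr}(J_{\mathcal G}\Theta^\top\Theta)\Big)+\sigma_\xi^2\,\frac{n\,(dk-\langle\chi_\psi,\chi_\phi\rangle)}{d(d-n-1)},$$ where both terms are non-negative and $J_{\mathcal G}=\int_{\mathcal G}\big(\chi_\phi(g)\psi(g)+\psi(g^2)\big)\,d\lambda(g)\in\mathbb R^{k\times k}$. Moreover, all of this holds with $\ge$ in place of $=$ (and again with integrability in 1 and 3, almost sure non-negativity and infinite expectation in 2) when $f_{\overline W}$ is replaced by any, possibly random, predictor $f'$ that almost surely lies in $L^2$ of the law of $X$ and satisfies $R[f']\le R[f_{\overline W}]$ almost surely, with $R[f']$ measurable. -/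

import Mathlib

open MeasureTheory ProbabilityTheory

namespace EquivariantRegression

noncomputable section

/-- The squared Frobenius norm `tr(Mᵀ M)`. -/
def frobSq {m n : ℕ} (M : Matrix (Fin m) (Fin n) ℝ) : ℝ :=
  (M.transpose * M).trace

/-- `W` is a minimum-norm solution of the least squares problem `argmin_U ‖B - A U‖_F²`. -/
def IsMinNormLeastSquares {n d k : ℕ} (A : Matrix (Fin n) (Fin d) ℝ)
    (B : Matrix (Fin n) (Fin k) ℝ) (W : Matrix (Fin d) (Fin k) ℝ) : Prop :=
  (∀ U : Matrix (Fin d) (Fin k) ℝ, frobSq (B - A * W) ≤ frobSq (B - A * U)) ∧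
    ∀ U : Matrix (Fin d) (Fin k) ℝ,
      (∀ V : Matrix (Fin d) (Fin k) ℝ, frobSq (B - A * U) ≤ frobSq (B - A * V)) →
        frobSq W ≤ frobSq U

/-- A matrix as a vector of a Euclidean space; its norm is the Frobenius norm. -/
def toVec (m n : ℕ) :
    Matrix (Fin m) (Fin n) ℝ ≃ₗ[ℝ] EuclideanSpace ℝ (Fin m × Fin n) where
  toFun M := WithLp.toLp 2 (fun p => M p.1 p.2)
  invFun v := Matrix.of fun i j => v (i, j)
  map_add' _ _ := rfl
  map_smul' _ _ := rfl
  left_inv _ := rfl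
  right_inv _ := rfl

theorem frobSq_eq_norm_sq {m n : ℕ} (M : Matrix (Fin m) (Fin n) ℝ) :
    frobSq M = ‖toVec m n M‖ ^ 2 := by
  rw [EuclideanSpace.norm_sq_eq, Fintype.sum_prod_type, Finset.sum_comm]
  simp only [frobSq, Matrix.trace, Matrix.diag_apply, Matrix.mul_apply, Matrix.transpose_apply,
    Real.norm_eq_abs, sq_abs]
  exact Finset.sum_congr rfl fun _ _ => Finset.sum_congr rfl fun _ _ => (pow_two _).symm

theorem existsUnique_minNorm {E F : Type*} [NormedAddCommGroup E] [InnerProductSpace ℝ E]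
    [FiniteDimensional ℝ E] [NormedAddCommGroup F] [InnerProductSpace ℝ F]
    [FiniteDimensional ℝ F] (L : E →ₗ[ℝ] F) (b : F) :
    ∃! w : E, (∀ u, ‖b - L w‖ ^ 2 ≤ ‖b - L u‖ ^ 2) ∧
      ∀ u, (∀ v, ‖b - L u‖ ^ 2 ≤ ‖b - L v‖ ^ 2) → ‖w‖ ^ 2 ≤ ‖u‖ ^ 2 := by
  set K := LinearMap.range L
  set p := K.starProjection b with hp
  have hpK : p ∈ K := K.starProjection_apply_mem b
  obtain ⟨w₀, hw₀⟩ := hpK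
  have hpy : ∀ u, ‖b - L u‖ ^ 2 = ‖b - p‖ ^ 2 + ‖p - L u‖ ^ 2 := by
    intro u
    have h1 : inner ℝ (b - p) (p - L u) = 0 :=
      (Submodule.mem_orthogonal' K _).1 (K.sub_starProjection_mem_orthogonal b) _
        (K.sub_mem ⟨w₀, hw₀⟩ ⟨u, rfl⟩)
    have h2 : b - L u = (b - p) + (p - L u) := by abel
    rw [h2, norm_add_sq_real, h1]
    ring
  have hmin : ∀ u, (∀ v, ‖b - L u‖ ^ 2 ≤ ‖b - L v‖ ^ 2) ↔ L u = p := by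
    intro u
    constructor
    · intro h
      have h3 := h w₀
      rw [hpy, hpy w₀, hw₀, sub_self, norm_zero] at h3
      have h4 : ‖p - L u‖ = 0 := by nlinarith [sq_nonneg ‖p - L u‖]
      exact (sub_eq_zero.1 (norm_eq_zero.1 h4)).symm
    · intro h v
      rw [hpy u, hpy v, h, sub_self, norm_zero]
      nlinarith [sq_nonneg ‖p - L v‖]
  set N := LinearMap.ker L
  set w := w₀ - N.starProjection w₀ with hw
  have hLw : L w = p := by
    have h5 : L (N.starProjection w₀) = 0 := N.starProjection_apply_mem w₀
    rw [hw, map_sub, h5, sub_zero, hw₀]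
  have hN : ∀ u, L u = p → ‖u‖ ^ 2 = ‖w‖ ^ 2 + ‖u - w‖ ^ 2 := by
    intro u hu
    have h6 : inner ℝ w (u - w) = 0 :=
      (Submodule.mem_orthogonal' N _).1 (N.sub_starProjection_mem_orthogonal w₀) _
        (by simp [N, LinearMap.mem_ker, hu, hLw])
    have h7 : u = w + (u - w) := by abel
    conv_lhs => rw [h7, norm_add_sq_real, h6]
    ring
  refine ⟨w, ⟨(hmin w).2 hLw, fun u hu => ?_⟩, fun y hy => ?_⟩
  · rw [hN u ((hmin u).1 hu)]
    nlinarith [sq_nonneg ‖u - w‖]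
  · have h8 := hy.2 w ((hmin w).2 hLw)
    rw [hN y ((hmin y).1 hy.1)] at h8
    have h9 : ‖y - w‖ = 0 := by nlinarith [sq_nonneg ‖y - w‖]
    exact sub_eq_zero.1 (norm_eq_zero.1 h9)

theorem existsUnique_isMinNormLeastSquares {n d k : ℕ} (A : Matrix (Fin n) (Fin d) ℝ)
    (B : Matrix (Fin n) (Fin k) ℝ) : ∃! W, IsMinNormLeastSquares A B W := by
  let T : Matrix (Fin d) (Fin k) ℝ →ₗ[ℝ] Matrix (Fin n) (Fin k) ℝ :=
    { toFun := fun U => A * U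
      map_add' := fun _ _ => Matrix.mul_add _ _ _
      map_smul' := fun _ _ => by simp }
  let L := (toVec n k).toLinearMap ∘ₗ T ∘ₗ (toVec d k).symm.toLinearMap
  have hL : ∀ U, frobSq (B - A * U) = ‖toVec n k B - L (toVec d k U)‖ ^ 2 := by
    intro U
    rw [frobSq_eq_norm_sq, map_sub]
    simp [L, T]
  have key : ∀ W, IsMinNormLeastSquares A B W ↔
      ((∀ u, ‖toVec n k B - L (toVec d k W)‖ ^ 2 ≤ ‖toVec n k B - L u‖ ^ 2) ∧
      ∀ u, (∀ v, ‖toVec n k B - L u‖ ^ 2 ≤ ‖toVec n k B - L v‖ ^ 2) →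
        ‖toVec d k W‖ ^ 2 ≤ ‖u‖ ^ 2) := by
    intro W
    simp only [IsMinNormLeastSquares, hL, frobSq_eq_norm_sq, (toVec d k).surjective.forall]
  obtain ⟨w, hw, hu⟩ := existsUnique_minNorm L (toVec n k B)
  refine ⟨(toVec d k).symm w, (key _).2 (by simpa using hw), fun W hW => ?_⟩
  exact (LinearEquiv.eq_symm_apply _).2 (hu _ ((key W).1 hW))

/-- The minimum-norm least squares estimate from inputs (rows of `A`) and outputs (rows of `B`). -/
def leastSquares {n d k : ℕ} (A : Matrix (Fin n) (Fin d) ℝ) (B : Matrix (Fin n) (Fin k) ℝ) :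
    Matrix (Fin d) (Fin k) ℝ :=
  (existsUnique_isMinNormLeastSquares A B).choose

theorem leastSquares_spec {n d k : ℕ} (A : Matrix (Fin n) (Fin d) ℝ)
    (B : Matrix (Fin n) (Fin k) ℝ) : IsMinNormLeastSquares A B (leastSquares A B) :=
  (existsUnique_isMinNormLeastSquares A B).choose_spec.1

/-- The `n × m` matrix whose rows are the given `n` vectors. -/
def rowStack {n m : ℕ} (x : Fin n → EuclideanSpace ℝ (Fin m)) : Matrix (Fin n) (Fin m) ℝ :=
  Matrix.of fun i j => x i j

/-- The linear predictor `f_W(x) = Wᵀ x`. -/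
def linPred {d k : ℕ} (W : Matrix (Fin d) (Fin k) ℝ) (x : EuclideanSpace ℝ (Fin d)) :
    EuclideanSpace ℝ (Fin k) :=
  Matrix.toEuclideanLin W.transpose x

/-- The risk `R[f] = E‖f(X) - Y‖²` of a fixed predictor `f`. -/
def risk {Ω : Type*} [MeasurableSpace Ω] (P : Measure Ω) {d k : ℕ}
    (X : Ω → EuclideanSpace ℝ (Fin d)) (Y : Ω → EuclideanSpace ℝ (Fin k))
    (f : EuclideanSpace ℝ (Fin d) → EuclideanSpace ℝ (Fin k)) : ℝ :=
  ∫ ω, ‖f (X ω) - Y ω‖ ^ 2 ∂P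

/-- `f'` is a (random, e.g. trained) square-integrable predictor whose risk is almost surely at
most that of the (random) predictor `f`. -/
def IsNoWorse {Ω : Type*} [MeasurableSpace Ω] (P : Measure Ω) {d k : ℕ}
    (X : Ω → EuclideanSpace ℝ (Fin d)) (Y : Ω → EuclideanSpace ℝ (Fin k))
    (f' f : Ω → EuclideanSpace ℝ (Fin d) → EuclideanSpace ℝ (Fin k)) : Prop :=
  (∀ᵐ ω ∂P, MemLp (f' ω) 2 (P.map X)) ∧
    AEMeasurable (fun ω => risk P X Y (f' ω)) P ∧
    ∀ᵐ ω ∂P, risk P X Y (f' ω) ≤ risk P X Y (f ω)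

/-- The generalisation gap `R[f] - R[f']` of two random predictors, as a random variable. -/
def genGap {Ω : Type*} [MeasurableSpace Ω] (P : Measure Ω) {d k : ℕ}
    (X : Ω → EuclideanSpace ℝ (Fin d)) (Y : Ω → EuclideanSpace ℝ (Fin k))
    (f f' : Ω → EuclideanSpace ℝ (Fin d) → EuclideanSpace ℝ (Fin k)) (ω : Ω) : ℝ :=
  risk P X Y (f ω) - risk P X Y (f' ω)

section Group

variable {G : Type*} [Group G]

/-- The orthogonal representation `φ` is measurable: the action map `G × ℝᵐ → ℝᵐ` is. -/
def IsMeasurableRep [MeasurableSpace G] {m : ℕ} (φ : G →* Matrix.orthogonalGroup (Fin m) ℝ) :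
    Prop :=
  Measurable fun p : G × EuclideanSpace ℝ (Fin m) =>
    Matrix.toEuclideanLin (φ p.1 : Matrix (Fin m) (Fin m) ℝ) p.2

/-- `f (φ(g) x) = ψ(g) f(x)` for all `g` and `x`. -/
def IsEquivariant {d k : ℕ} (φ : G →* Matrix.orthogonalGroup (Fin d) ℝ)
    (ψ : G →* Matrix.orthogonalGroup (Fin k) ℝ)
    (f : EuclideanSpace ℝ (Fin d) → EuclideanSpace ℝ (Fin k)) : Prop :=
  ∀ (g : G) (x : EuclideanSpace ℝ (Fin d)),
    f (Matrix.toEuclideanLin (φ g : Matrix (Fin d) (Fin d) ℝ) x) =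
      Matrix.toEuclideanLin (ψ g : Matrix (Fin k) (Fin k) ℝ) (f x)

/-- The character `χ_φ(g) = tr φ(g)`. -/
def character {m : ℕ} (φ : G →* Matrix.orthogonalGroup (Fin m) ℝ) (g : G) : ℝ :=
  (φ g : Matrix (Fin m) (Fin m) ℝ).trace

/-- The inner product of two real class functions with respect to `lam`. -/
def charInner [MeasurableSpace G] (lam : Measure G) (χ₁ χ₂ : G → ℝ) : ℝ :=
  ∫ g, χ₁ g * χ₂ g ∂lam

/-- The intertwining average `Ψ(W) = ∫ φ(g) W ψ(g⁻¹) dλ(g)`, integrated entry by entry. -/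
def intertwine [MeasurableSpace G] (lam : Measure G) {d k : ℕ}
    (φ : G →* Matrix.orthogonalGroup (Fin d) ℝ) (ψ : G →* Matrix.orthogonalGroup (Fin k) ℝ)
    (W : Matrix (Fin d) (Fin k) ℝ) : Matrix (Fin d) (Fin k) ℝ :=
  Matrix.of fun a b =>
    ∫ g, ((φ g : Matrix (Fin d) (Fin d) ℝ) * W * (ψ g⁻¹ : Matrix (Fin k) (Fin k) ℝ)) a b ∂lam

/-- `J_G = ∫ (χ_φ(g) ψ(g) + ψ(g²)) dλ(g)`, integrated entry by entry. -/
def JMatrix [MeasurableSpace G] (lam : Measure G) {d k : ℕ}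
    (φ : G →* Matrix.orthogonalGroup (Fin d) ℝ) (ψ : G →* Matrix.orthogonalGroup (Fin k) ℝ) :
    Matrix (Fin k) (Fin k) ℝ :=
  Matrix.of fun a b =>
    ∫ g, (character φ g * (ψ g : Matrix (Fin k) (Fin k) ℝ) a b +
      (ψ (g ^ 2) : Matrix (Fin k) (Fin k) ℝ) a b) ∂lam

/-- `dk - ⟨χ_ψ, χ_φ⟩`. -/
def codim [MeasurableSpace G] (lam : Measure G) {d k : ℕ}
    (φ : G →* Matrix.orthogonalGroup (Fin d) ℝ) (ψ : G →* Matrix.orthogonalGroup (Fin k) ℝ) : ℝ :=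
  (d : ℝ) * k - charInner lam (character ψ) (character φ)

/-- `σ_X² · n(d-n) / (d(d-1)(d+2)) · ((d+1)‖Θ‖_F² - tr(J_G Θᵀ Θ))`. -/
def biasTerm [MeasurableSpace G] (lam : Measure G) {d k : ℕ}
    (φ : G →* Matrix.orthogonalGroup (Fin d) ℝ) (ψ : G →* Matrix.orthogonalGroup (Fin k) ℝ)
    (Θ : Matrix (Fin d) (Fin k) ℝ) (σX : ℝ) (n : ℕ) : ℝ :=
  σX ^ 2 * (((n : ℝ) * ((d : ℝ) - n)) / ((d : ℝ) * ((d : ℝ) - 1) * ((d : ℝ) + 2))) *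
    (((d : ℝ) + 1) * frobSq Θ - (JMatrix lam φ ψ * (Θ.transpose * Θ)).trace)

/-- `σ_ξ² · n(dk - ⟨χ_ψ, χ_φ⟩) / (d(d-n-1))`. -/
def noiseTerm [MeasurableSpace G] (lam : Measure G) {d k : ℕ}
    (φ : G →* Matrix.orthogonalGroup (Fin d) ℝ) (ψ : G →* Matrix.orthogonalGroup (Fin k) ℝ)
    (σξ : ℝ) (n : ℕ) : ℝ :=
  σξ ^ 2 * (((n : ℝ) * codim lam φ ψ) / ((d : ℝ) * ((d : ℝ) - n - 1)))

end Group

end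

end EquivariantRegression

open EquivariantRegression

/-!
The risk of a linear predictor `f_U` is `σ_X² ‖U - Θ‖² + k σ_ξ²` (`risk_linPred`). The average `Ψ`
over the group is the orthogonal projection of matrices onto those with equivariant predictor, and
`Θ` is one of them; so the generalisation gap is `σ_X² (‖W‖² - ‖Ψ(W)‖²)`, a nonnegative quadratic
form in `W` that vanishes at `Θ` (`frobSq_sub_sub_frobSq_intertwine_sub`,
`tensorForm_repTensor_nonneg`). It remains to compute the mean of a quadratic form at the least
squares estimate.

Almost surely the design `A` has full rank and `W = A⁺ A Θ + A⁺ N`, where `N` is the noise matrix.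
Given the design, the mean of the form is its value at `A⁺ A Θ` plus a linear functional of
`A⁺ A⁺ᵀ` (`lintegral_tensorForm_estimate`). All terms are nonnegative, so the computation is carried
out with lower Lebesgue integrals, finite or not.

*Variance.* The law of the design is invariant under right multiplication by orthogonal matrices.
Sign changes and permutations of the basis show that only the mean of `tr (A⁺ A⁺ᵀ)` matters
(`lintegral_linear_pinvGram`), with the trace of the form, `dk - ⟨χ_ψ, χ_φ⟩`, as coefficient.
And `tr (A⁺ A⁺ᵀ)` is the trace of the inverse of the smaller Gram matrix of `A`. A diagonal entry of an
inverse Gram matrix is the reciprocal squared distance of one vector from the span of the others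
(`inv_gram_apply_self`), here a reciprocal chi-square variable, whose mean is finite exactly above
two degrees of freedom (`lintegral_inv_gram_apply_self`). This is the source of the threshold
`|n - d| ≤ 1`. When the trace of the form vanishes, the form is zero and every linear predictor is
equivariant (`repAct_eq_self_of_codim_eq_zero`).

*Bias.* If `d ≤ n` then `A⁺ A = 1` and there is none. Otherwise `A⁺ A` is the projection onto a
random subspace of dimension `n`, whose moments `E[P a b P c e]` are an isotropic tensor with two
unknown coefficients (`exists_rowProjMoment_eq`); `tr P = tr P² = n` determines them. Contracted
with the form, they give the term with `tr (J Θᵀ Θ)` (`integral_tensorForm_rowProj`,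
`trace_JMatrix_mul`).

A predictor that is no worse than `f_{Ψ(W)}` has a gap between that of `f_{Ψ(W)}` and the risk of
`f_W`, which is integrable away from the threshold by the same computation for the form `‖W‖²`.
-/

namespace EquivariantRegression

/-! ### Least squares through the pseudo-inverse -/

section PseudoInverse

open Matrix

variable {n d k : ℕ}

theorem frobSq_eq_sum (M : Matrix (Fin n) (Fin d) ℝ) : frobSq M = ∑ i, ∑ j, M i j ^ 2 := by
  rw [Finset.sum_comm]
  simp [frobSq, trace, mul_apply, sq]

theorem frobSq_nonneg (M : Matrix (Fin n) (Fin d) ℝ) : 0 ≤ frobSq M := by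
  rw [frobSq_eq_sum]; positivity

theorem eq_zero_of_frobSq_nonpos {M : Matrix (Fin n) (Fin d) ℝ} (h : frobSq M ≤ 0) : M = 0 := by
  have h1 : frobSq M = 0 := le_antisymm h (frobSq_nonneg M)
  rw [frobSq_eq_norm_sq, sq_eq_zero_iff, norm_eq_zero] at h1
  exact (LinearEquiv.map_eq_zero_iff _).1 h1

theorem frobSq_add (M N : Matrix (Fin n) (Fin d) ℝ) :
    frobSq (M + N) = frobSq M + frobSq N + 2 * (Mᵀ * N).trace := by
  have h : (Nᵀ * M).trace = (Mᵀ * N).trace := by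
    rw [← trace_transpose, transpose_mul, transpose_transpose]
  simp only [frobSq, transpose_add, Matrix.add_mul, Matrix.mul_add, trace_add, h]
  ring

/-- A solution of the normal equations whose columns lie in the row space of the design matrix is
the minimum-norm least squares estimate. -/
theorem leastSquares_eq_of_normal {A : Matrix (Fin n) (Fin d) ℝ} {B : Matrix (Fin n) (Fin k) ℝ}
    {W : Matrix (Fin d) (Fin k) ℝ} (Z : Matrix (Fin n) (Fin k) ℝ)
    (h1 : Aᵀ * (A * W) = Aᵀ * B) (h2 : W = Aᵀ * Z) : leastSquares A B = W := by
  have hmin : ∀ U, frobSq (B - A * U) = frobSq (B - A * W) + frobSq (A * (W - U)) := by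
    intro U
    have h3 : (B - A * W)ᵀ * (A * (W - U)) = 0 := by
      rw [← Matrix.mul_assoc, ← transpose_transpose A, ← transpose_mul, transpose_transpose,
        Matrix.mul_sub Aᵀ, h1, sub_self, transpose_zero, Matrix.zero_mul]
    rw [show B - A * U = (B - A * W) + A * (W - U) by rw [Matrix.mul_sub]; abel, frobSq_add, h3]
    simp
  refine (existsUnique_isMinNormLeastSquares A B).unique (leastSquares_spec A B)
    ⟨fun U => ?_, fun U hU => ?_⟩
  · rw [hmin U]
    linarith [frobSq_nonneg (A * (W - U))]
  · have h4 := hU W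
    rw [hmin U] at h4
    have h5 : A * (W - U) = 0 := eq_zero_of_frobSq_nonpos (by linarith)
    have h6 : Wᵀ * (U - W) = 0 := by
      rw [h2, transpose_mul, transpose_transpose, ← h2, Matrix.mul_assoc,
        show A * (U - W) = -(A * (W - U)) by rw [← Matrix.mul_neg, neg_sub], h5]
      simp
    have h7 := frobSq_add W (U - W)
    rw [h6, add_sub_cancel] at h7
    rw [h7]
    simp [frobSq_nonneg]

theorem leastSquares_eq_zero_of_isEmpty (A : Matrix (Fin 0) (Fin d) ℝ)
    (B : Matrix (Fin 0) (Fin k) ℝ) : leastSquares A B = 0 :=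
  leastSquares_eq_of_normal 0 (by ext; simp [mul_apply]) (by simp)

/-- The pseudo-inverse of a matrix of full rank. The nonsingular inverse makes this formula
polynomial in the entries up to division by a determinant, hence measurable; it is only meaningful
under `FullRank`. -/
noncomputable def pinv (A : Matrix (Fin n) (Fin d) ℝ) : Matrix (Fin d) (Fin n) ℝ :=
  if d ≤ n then (Aᵀ * A)⁻¹ * Aᵀ else Aᵀ * (A * Aᵀ)⁻¹

/-- The matrix has full rank, expressed through the smaller of its two Gram matrices. -/
def FullRank (A : Matrix (Fin n) (Fin d) ℝ) : Prop :=
  if d ≤ n then IsUnit (Aᵀ * A).det else IsUnit (A * Aᵀ).det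

/-- For a design of full rank the estimate is the pseudo-inverse applied to the outputs; the scale
of the design is kept apart because the Gaussian design will be normalised. -/
theorem leastSquares_smul {A : Matrix (Fin n) (Fin d) ℝ} (hA : FullRank A) {c : ℝ} (hc : c ≠ 0)
    (B : Matrix (Fin n) (Fin k) ℝ) : leastSquares (c • A) B = c⁻¹ • (pinv A * B) := by
  unfold FullRank at hA
  unfold pinv
  split_ifs at hA ⊢ with h
  · refine leastSquares_eq_of_normal
      ((c⁻¹ * c⁻¹) • (A * ((Aᵀ * A)⁻¹ * ((Aᵀ * A)⁻¹ * (Aᵀ * B))))) ?_ ?_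
    · simp only [transpose_smul, Matrix.smul_mul, Matrix.mul_smul, smul_smul]
      rw [show Aᵀ * (A * ((Aᵀ * A)⁻¹ * Aᵀ * B)) = (Aᵀ * A) * (Aᵀ * A)⁻¹ * (Aᵀ * B) by
        simp only [Matrix.mul_assoc], mul_nonsing_inv _ hA, Matrix.one_mul]
      congr 1
      field_simp
    · simp only [transpose_smul, Matrix.smul_mul, Matrix.mul_smul, smul_smul]
      rw [show Aᵀ * (A * ((Aᵀ * A)⁻¹ * ((Aᵀ * A)⁻¹ * (Aᵀ * B)))) =
        (Aᵀ * A) * (Aᵀ * A)⁻¹ * ((Aᵀ * A)⁻¹ * (Aᵀ * B)) by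
          simp only [Matrix.mul_assoc], mul_nonsing_inv _ hA, Matrix.one_mul, Matrix.mul_assoc]
      congr 1
      field_simp
  · refine leastSquares_eq_of_normal ((c⁻¹ * c⁻¹) • ((A * Aᵀ)⁻¹ * B)) ?_ ?_
    · simp only [transpose_smul, Matrix.smul_mul, Matrix.mul_smul, smul_smul]
      rw [show Aᵀ * (A * (Aᵀ * (A * Aᵀ)⁻¹ * B)) = Aᵀ * ((A * Aᵀ) * (A * Aᵀ)⁻¹ * B) by
        simp only [Matrix.mul_assoc], mul_nonsing_inv _ hA, Matrix.one_mul]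
      congr 1
      field_simp
    · simp only [transpose_smul, Matrix.smul_mul, Matrix.mul_smul, smul_smul, Matrix.mul_assoc]
      congr 1
      field_simp

theorem pinv_mul_orthogonal (A : Matrix (Fin n) (Fin d) ℝ) {U : Matrix (Fin d) (Fin d) ℝ}
    (hU : U * Uᵀ = 1) : pinv (A * U) = Uᵀ * pinv A := by
  have hU' : Uᵀ * U = 1 := mul_eq_one_comm.1 hU
  have h1 : U⁻¹ = Uᵀ := inv_eq_right_inv hU
  have h2 : Uᵀ⁻¹ = U := inv_eq_right_inv hU'
  unfold pinv
  split_ifs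
  · rw [transpose_mul, show Uᵀ * Aᵀ * (A * U) = Uᵀ * (Aᵀ * A * U) by
      simp only [Matrix.mul_assoc], Matrix.mul_inv_rev, Matrix.mul_inv_rev, h1, h2,
      Matrix.mul_assoc, Matrix.mul_assoc, ← Matrix.mul_assoc U, hU, Matrix.one_mul]
  · rw [transpose_mul, Matrix.mul_assoc A U, ← Matrix.mul_assoc U, hU, Matrix.one_mul,
      Matrix.mul_assoc]

/-- The matrix `A⁺ A`, the orthogonal projection onto the row space of a matrix of full rank. -/
noncomputable def rowProj (A : Matrix (Fin n) (Fin d) ℝ) : Matrix (Fin d) (Fin d) ℝ :=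
  pinv A * A

/-- The matrix `A⁺ A⁺ᵀ`, the covariance of the least squares estimate for unit noise. -/
noncomputable def pinvGram (A : Matrix (Fin n) (Fin d) ℝ) : Matrix (Fin d) (Fin d) ℝ :=
  pinv A * (pinv A)ᵀ

theorem rowProj_mul_orthogonal (A : Matrix (Fin n) (Fin d) ℝ) {U : Matrix (Fin d) (Fin d) ℝ}
    (hU : U * Uᵀ = 1) : rowProj (A * U) = Uᵀ * rowProj A * U := by
  simp only [rowProj, pinv_mul_orthogonal A hU, Matrix.mul_assoc]

theorem pinvGram_mul_orthogonal (A : Matrix (Fin n) (Fin d) ℝ) {U : Matrix (Fin d) (Fin d) ℝ}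
    (hU : U * Uᵀ = 1) : pinvGram (A * U) = Uᵀ * pinvGram A * U := by
  simp only [pinvGram, pinv_mul_orthogonal A hU, Matrix.mul_assoc, transpose_mul,
    transpose_transpose]

theorem rowProj_eq_one {A : Matrix (Fin n) (Fin d) ℝ} (hA : FullRank A) (h : d ≤ n) :
    rowProj A = 1 := by
  rw [FullRank, if_pos h] at hA
  rw [rowProj, pinv, if_pos h, Matrix.mul_assoc, nonsing_inv_mul _ hA]

theorem transpose_rowProj {A : Matrix (Fin n) (Fin d) ℝ} (hA : FullRank A) :
    (rowProj A)ᵀ = rowProj A := by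
  by_cases h : d ≤ n
  · rw [rowProj_eq_one hA h, transpose_one]
  · simp only [rowProj, pinv, if_neg h, transpose_mul, transpose_nonsing_inv,
      transpose_transpose, Matrix.mul_assoc]

theorem rowProj_mul_self {A : Matrix (Fin n) (Fin d) ℝ} (hA : FullRank A) :
    rowProj A * rowProj A = rowProj A := by
  by_cases h : d ≤ n
  · rw [rowProj_eq_one hA h, Matrix.one_mul]
  · rw [FullRank, if_neg h] at hA
    rw [rowProj, pinv, if_neg h, show Aᵀ * (A * Aᵀ)⁻¹ * A * (Aᵀ * (A * Aᵀ)⁻¹ * A) =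
      Aᵀ * (A * Aᵀ)⁻¹ * ((A * Aᵀ) * (A * Aᵀ)⁻¹ * A) by simp only [Matrix.mul_assoc],
      mul_nonsing_inv _ hA, Matrix.one_mul]

theorem trace_rowProj {A : Matrix (Fin n) (Fin d) ℝ} (hA : FullRank A) (h : n < d) :
    (rowProj A).trace = n := by
  rw [FullRank, if_neg h.not_ge] at hA
  rw [rowProj, pinv, if_neg h.not_ge, Matrix.mul_assoc, trace_mul_comm, Matrix.mul_assoc,
    nonsing_inv_mul _ hA, trace_one, Fintype.card_fin]

theorem abs_rowProj_le_one {A : Matrix (Fin n) (Fin d) ℝ} (hA : FullRank A) (a b : Fin d) :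
    |rowProj A a b| ≤ 1 := by
  have h1 : rowProj A a a = ∑ c, rowProj A a c ^ 2 := by
    conv_lhs => rw [← rowProj_mul_self hA, mul_apply]
    refine Finset.sum_congr rfl fun c _ => ?_
    rw [sq, show rowProj A c a = rowProj A a c from congrFun₂ (transpose_rowProj hA) a c]
  have h2 : ∀ c, rowProj A a c ^ 2 ≤ rowProj A a a := fun c => by
    rw [h1]
    exact Finset.single_le_sum (f := fun c => rowProj A a c ^ 2)
      (fun _ _ => sq_nonneg _) (Finset.mem_univ c)
  have h3 := h2 a
  have h4 := h2 b
  rw [← sq_le_one_iff_abs_le_one]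
  nlinarith

theorem trace_pinvGram_of_le {A : Matrix (Fin n) (Fin d) ℝ} (hA : FullRank A) (h : d ≤ n) :
    (pinvGram A).trace = ((Aᵀ * A)⁻¹).trace := by
  rw [FullRank, if_pos h] at hA
  rw [pinvGram, pinv, if_pos h, transpose_mul, transpose_transpose, transpose_nonsing_inv,
    transpose_mul, transpose_transpose, Matrix.mul_assoc, ← Matrix.mul_assoc Aᵀ,
    mul_nonsing_inv _ hA, Matrix.mul_one]

theorem trace_pinvGram_of_lt {A : Matrix (Fin n) (Fin d) ℝ} (hA : FullRank A) (h : n < d) :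
    (pinvGram A).trace = ((A * Aᵀ)⁻¹).trace := by
  rw [FullRank, if_neg h.not_ge] at hA
  rw [pinvGram, pinv, if_neg h.not_ge, trace_mul_comm, transpose_mul, transpose_transpose,
    transpose_nonsing_inv, transpose_mul, transpose_transpose, Matrix.mul_assoc,
    ← Matrix.mul_assoc A, mul_nonsing_inv _ hA, Matrix.mul_one]

end PseudoInverse

/-! ### The reciprocal squared norm of a Gaussian vector -/

section GaussianNorm

open Module Real Set
open scoped RealInnerProductSpace ENNReal

variable {E : Type*} [NormedAddCommGroup E] [InnerProductSpace ℝ E] [FiniteDimensional ℝ E]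
  [MeasurableSpace E] [BorelSpace E]

theorem stdGaussian_map_orthogonalProjection (S : Submodule ℝ E) :
    (stdGaussian E).map S.orthogonalProjectionOnto = stdGaussian S := by
  apply Measure.ext_of_charFun
  ext t
  rw [charFun_apply, integral_map (by fun_prop)
    (Measurable.aestronglyMeasurable (by fun_prop))]
  have h : ∀ x : E, ⟪S.orthogonalProjectionOnto x, t⟫ = ⟪x, (t : E)⟫ := fun x => by
    rw [Submodule.inner_orthogonalProjectionOnto_eq_of_mem_right]
  simp_rw [h]
  rw [← charFun_apply, charFun_stdGaussian, charFun_stdGaussian]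
  simp

theorem integral_exp_neg_mul_sq_gaussianReal {t : ℝ} (ht : 0 ≤ t) :
    ∫ x, Real.exp (-(t * x ^ 2)) ∂gaussianReal 0 1 = (1 + 2 * t) ^ (-(1 / 2) : ℝ) := by
  rw [integral_gaussianReal_eq_integral_smul (by simp)]
  have h : ∀ x : ℝ, gaussianPDFReal 0 1 x • Real.exp (-(t * x ^ 2)) =
      (√(2 * π))⁻¹ * Real.exp (-(t + 1 / 2) * x ^ 2) := fun x => by
    rw [gaussianPDFReal, smul_eq_mul, mul_assoc, ← Real.exp_add]
    congr 2
    · simp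
    · simp; ring
  simp_rw [h]
  rw [integral_const_mul, integral_gaussian, ← Real.sqrt_inv, ← Real.sqrt_mul (by positivity),
    Real.rpow_neg (by positivity), ← Real.sqrt_eq_rpow, ← Real.sqrt_inv]
  congr 1
  field_simp
  ring

theorem lintegral_exp_neg_mul_norm_sq_stdGaussian {t : ℝ} (ht : 0 ≤ t) :
    ∫⁻ w, ENNReal.ofReal (Real.exp (-(t * ‖w‖ ^ 2))) ∂stdGaussian E =
      ENNReal.ofReal ((1 + 2 * t) ^ (-(finrank ℝ E / 2) : ℝ)) := by
  have hint : Integrable (fun w : E => Real.exp (-(t * ‖w‖ ^ 2))) (stdGaussian E) := by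
    refine Integrable.of_bound (Measurable.aestronglyMeasurable (by fun_prop)) 1 (ae_of_all _ ?_)
    intro w
    rw [Real.norm_eq_abs, Real.abs_exp, Real.exp_le_one_iff]
    have := mul_nonneg ht (sq_nonneg ‖w‖)
    linarith
  rw [← ofReal_integral_eq_lintegral_ofReal hint (ae_of_all _ fun _ => (Real.exp_pos _).le)]
  congr 1
  rw [stdGaussian, integral_map (Measurable.aemeasurable (by fun_prop))
    (Measurable.aestronglyMeasurable (by fun_prop))]
  have h : ∀ x : Fin (finrank ℝ E) → ℝ,
      Real.exp (-(t * ‖∑ i, x i • stdOrthonormalBasis ℝ E i‖ ^ 2)) =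
        ∏ i, Real.exp (-(t * x i ^ 2)) := fun x => by
    rw [← Real.exp_sum, ← (stdOrthonormalBasis ℝ E).sum_sq_norm_inner_right]
    congr 1
    rw [Finset.mul_sum, ← Finset.sum_neg_distrib]
    refine Finset.sum_congr rfl fun i _ => ?_
    rw [(stdOrthonormalBasis ℝ E).orthonormal.inner_right_fintype]
    simp
  simp_rw [h]
  rw [integral_fintype_prod_eq_prod (f := fun _ x => Real.exp (-(t * x ^ 2)))]
  simp_rw [integral_exp_neg_mul_sq_gaussianReal ht]
  rw [Finset.prod_const, Finset.card_univ, Fintype.card_fin, ← Real.rpow_natCast,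
    ← Real.rpow_mul (by positivity)]
  congr 1
  ring

/-- The reciprocal as a mixture of exponentials, valid with value `⊤` at `s = 0`. -/
theorem lintegral_half_exp_eq_inv {s : ℝ} (hs : 0 ≤ s) :
    ∫⁻ u in Ioi (1 : ℝ), ENNReal.ofReal (1 / 2 * Real.exp (-((u - 1) / 2 * s))) =
      (ENNReal.ofReal s)⁻¹ := by
  rcases hs.eq_or_lt with rfl | hs
  · simp
  · have hd : ∀ u ∈ Ici (1 : ℝ), HasDerivAt (fun u => -(1 / s) * Real.exp (-((u - 1) / 2 * s)))
        (1 / 2 * Real.exp (-((u - 1) / 2 * s))) u := by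
      intro u _
      have h1 : HasDerivAt (fun u : ℝ => -((u - 1) / 2 * s)) (-(1 / 2 * s)) u :=
        ((((hasDerivAt_id u).sub_const 1).div_const 2).mul_const s).neg
      refine (h1.exp.const_mul (-(1 / s))).congr_deriv ?_
      rw [show -(1 / s) * (Real.exp (-((u - 1) / 2 * s)) * -(1 / 2 * s)) =
        1 / 2 * Real.exp (-((u - 1) / 2 * s)) * (s / s) by ring, div_self hs.ne', mul_one]
    have hlim : Filter.Tendsto (fun u => -(1 / s) * Real.exp (-((u - 1) / 2 * s)))
        Filter.atTop (nhds 0) := by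
      rw [← mul_zero (-(1 / s))]
      refine Filter.Tendsto.const_mul _ (Real.tendsto_exp_neg_atTop_nhds_zero.comp ?_)
      refine Filter.Tendsto.atTop_mul_const hs (Filter.Tendsto.atTop_div_const (by norm_num) ?_)
      exact Filter.tendsto_atTop_add_const_right _ _ Filter.tendsto_id
    have hpos : ∀ u ∈ Ioi (1 : ℝ), 0 ≤ 1 / 2 * Real.exp (-((u - 1) / 2 * s)) :=
      fun u _ => by positivity
    rw [← ofReal_integral_eq_lintegral_ofReal
      (integrableOn_Ioi_deriv_of_nonneg' hd hpos hlim) (ae_of_all _ fun u => by positivity),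
      integral_Ioi_of_hasDerivAt_of_nonneg' hd hpos hlim]
    rw [← ENNReal.ofReal_inv_of_pos hs]
    congr 1
    simp

/-- The mean reciprocal of a chi-square variable: writing the reciprocal as a mixture of
exponentials reduces it to Laplace transforms, and to an integral of a power of `u`. -/
theorem lintegral_inv_norm_sq_stdGaussian :
    ∫⁻ w, (ENNReal.ofReal (‖w‖ ^ 2))⁻¹ ∂stdGaussian E =
      ∫⁻ u in Ioi (1 : ℝ), ENNReal.ofReal (1 / 2 * u ^ (-(finrank ℝ E / 2) : ℝ)) := by
  simp_rw [← fun w : E => lintegral_half_exp_eq_inv (sq_nonneg ‖w‖)]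
  rw [lintegral_lintegral_swap (Measurable.aemeasurable (by fun_prop))]
  refine setLIntegral_congr_fun measurableSet_Ioi fun u hu => ?_
  have hu : 1 < u := hu
  simp_rw [ENNReal.ofReal_mul (show (0 : ℝ) ≤ 1 / 2 by norm_num)]
  rw [lintegral_const_mul _ (by fun_prop),
    lintegral_exp_neg_mul_norm_sq_stdGaussian (by linarith)]
  congr 4
  ring

theorem lintegral_inv_norm_sq_stdGaussian_of_two_lt (h : 2 < finrank ℝ E) :
    ∫⁻ w, (ENNReal.ofReal (‖w‖ ^ 2))⁻¹ ∂stdGaussian E =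
      ENNReal.ofReal (1 / ((finrank ℝ E : ℝ) - 2)) := by
  have h' : (2 : ℝ) < finrank ℝ E := by exact_mod_cast h
  have ha : -((finrank ℝ E : ℝ) / 2) < -1 := by linarith
  rw [lintegral_inv_norm_sq_stdGaussian, ← ofReal_integral_eq_lintegral_ofReal
    ((integrableOn_Ioi_rpow_of_lt ha one_pos).const_mul _), integral_const_mul,
    integral_Ioi_rpow_of_lt ha one_pos]
  · congr 1
    rw [one_rpow]
    have h2 : (finrank ℝ E : ℝ) - 2 ≠ 0 := by linarith
    rw [show -((finrank ℝ E : ℝ) / 2) + 1 = -((finrank ℝ E - 2) / 2) by ring]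
    field_simp
  · refine (ae_restrict_iff' measurableSet_Ioi).2 (ae_of_all _ fun u hu => ?_)
    have : (0 : ℝ) < u := one_pos.trans hu
    positivity

theorem lintegral_inv_norm_sq_stdGaussian_of_le_two (h : finrank ℝ E ≤ 2) :
    ∫⁻ w, (ENNReal.ofReal (‖w‖ ^ 2))⁻¹ ∂stdGaussian E = ⊤ := by
  have h' : (finrank ℝ E : ℝ) ≤ 2 := by exact_mod_cast h
  rw [lintegral_inv_norm_sq_stdGaussian]
  by_contra hne
  have hI : IntegrableOn (fun u : ℝ => 1 / 2 * u ^ (-((finrank ℝ E : ℝ) / 2))) (Ioi 1) := by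
    refine (lintegral_ofReal_ne_top_iff_integrable
      (Measurable.aestronglyMeasurable (by fun_prop)) ?_).1 hne
    refine (ae_restrict_iff' measurableSet_Ioi).2 (ae_of_all _ fun u hu => ?_)
    have : (0 : ℝ) < u := one_pos.trans hu
    positivity
  have hI' := hI.const_mul 2
  simp only [← mul_assoc] at hI'
  norm_num at hI'
  have := (integrableOn_Ioi_rpow_iff (s := -((finrank ℝ E : ℝ) / 2)) one_pos).1 hI'
  linarith

/-- A proper subspace is a null set of the standard Gaussian measure. -/
theorem stdGaussian_submodule_eq_zero {S : Submodule ℝ E} (hS : S ≠ ⊤) :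
    stdGaussian E (S : Set E) = 0 := by
  obtain ⟨v, hv, hv0⟩ := Submodule.exists_mem_ne_zero_of_ne_bot
    (mt Submodule.orthogonal_eq_bot_iff.1 hS)
  have h1 : (S : Set E) ⊆ innerSL ℝ v ⁻¹' {0} := fun x hx => by
    simpa using Submodule.inner_left_of_mem_orthogonal hx hv
  refine measure_mono_null h1 ?_
  rw [← Measure.map_apply (by fun_prop) (measurableSet_singleton _),
    IsGaussian.map_eq_gaussianReal, variance_dual_stdGaussian]
  have h2 : (‖innerSL ℝ v‖ ^ 2).toNNReal ≠ 0 := by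
    rw [innerSL_apply_norm]
    have := norm_pos_iff.2 hv0
    simp only [ne_eq, Real.toNNReal_eq_zero, not_le]
    positivity
  have := nullSingletonClass_gaussianReal (μ := (stdGaussian E)[innerSL ℝ v]) h2
  exact this.measure_singleton _

end GaussianNorm

/-! ### Inverse Gram matrices of Gaussian vectors -/

section GaussianGram

open Module Set Matrix
open scoped RealInnerProductSpace ENNReal

variable {E : Type*} [NormedAddCommGroup E] [InnerProductSpace ℝ E]

theorem linearIndependent_iff_succAbove {p : ℕ} (i : Fin (p + 1)) (y : Fin (p + 1) → E) :
    LinearIndependent ℝ y ↔ LinearIndependent ℝ (fun j => y (i.succAbove j)) ∧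
      y i ∉ Submodule.span ℝ (range fun j => y (i.succAbove j)) := by
  rw [← linearIndependent_equiv (finSuccEquiv' i).symm, linearIndependent_option]
  simp [Function.comp_def]

variable [FiniteDimensional ℝ E]

/-- A diagonal entry of an inverse Gram matrix is the reciprocal of the squared distance of the
vector from the span of the others. -/
theorem inv_gram_apply_self {p : ℕ} (i : Fin (p + 1)) {y : Fin (p + 1) → E}
    (hy : LinearIndependent ℝ y) :
    (gram ℝ y)⁻¹ i i = (‖(Submodule.span ℝ
      (range fun j => y (i.succAbove j)))ᗮ.orthogonalProjectionOnto (y i)‖ ^ 2)⁻¹ := by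
  set V := Submodule.span ℝ (range fun j => y (i.succAbove j))
  set r : E := Vᗮ.starProjection (y i) with hr
  have hrV : r ∈ Vᗮ := Vᗮ.starProjection_apply_mem _
  have hyr : y i - r ∈ V := by
    rw [hr, Submodule.starProjection_orthogonal_val, sub_sub_cancel]
    exact V.starProjection_apply_mem _
  obtain ⟨c, hc⟩ := (Submodule.mem_span_range_iff_exists_fun ℝ).1 hyr
  have hsum : ∑ j, (i.insertNth 1 (-c) : Fin (p + 1) → ℝ) j • y j = r := by
    rw [Fin.sum_univ_succAbove _ i]
    simp [hc]
  have hrr : ⟪y i, r⟫ = ‖r‖ ^ 2 := by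
    rw [← real_inner_self_eq_norm_sq, ← sub_eq_zero, ← inner_sub_left]
    exact Submodule.inner_right_of_mem_orthogonal hyr hrV
  have hmul : gram ℝ y *ᵥ (i.insertNth 1 (-c) : Fin (p + 1) → ℝ) = Pi.single i (‖r‖ ^ 2) := by
    ext j
    have h1 : (gram ℝ y *ᵥ (i.insertNth 1 (-c) : Fin (p + 1) → ℝ)) j = ⟪y j, r⟫ := by
      rw [← hsum, inner_sum]
      simp_rw [inner_smul_right, mulVec, dotProduct, gram_apply]
      exact Finset.sum_congr rfl fun _ _ => mul_comm _ _
    rw [h1]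
    rcases eq_or_ne j i with rfl | hj
    · rw [hrr, Pi.single_eq_same]
    · obtain ⟨l, rfl⟩ := Fin.exists_succAbove_eq hj
      rw [Pi.single_eq_of_ne hj]
      exact Submodule.inner_right_of_mem_orthogonal
        (Submodule.subset_span (mem_range_self l)) hrV
  have hdet : IsUnit (gram ℝ y).det := (det_gram_ne_zero_iff_linearIndependent.2 hy).isUnit
  have h2 : (gram ℝ y)⁻¹ i i * ‖r‖ ^ 2 = 1 := by
    have h3 := congrArg (fun z => ((gram ℝ y)⁻¹ *ᵥ z) i) hmul
    simp only [mulVec_mulVec, nonsing_inv_mul _ hdet, one_mulVec, Fin.insertNth_apply_same,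
      mulVec_single, Pi.smul_apply, col_apply] at h3
    simpa [mul_comm] using h3.symm
  exact eq_inv_of_mul_eq_one_left h2

/-- `inv_gram_apply_self` with the distinguished vector and the remaining ones named separately. -/
theorem inv_gram_apply_self_of_eq {p : ℕ} (i : Fin (p + 1)) {x : E} {y : Fin p → E}
    {z : Fin (p + 1) → E} (hz : LinearIndependent ℝ z) (hx : z i = x)
    (hy : (fun j => z (i.succAbove j)) = y) :
    (gram ℝ z)⁻¹ i i =
      (‖(Submodule.span ℝ (range y))ᗮ.orthogonalProjectionOnto x‖ ^ 2)⁻¹ := by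
  subst hx hy
  exact inv_gram_apply_self i hz

theorem norm_orthogonalProjectionOnto_orthogonal_pos {V : Submodule ℝ E} {x : E} (hx : x ∉ V) :
    0 < ‖Vᗮ.orthogonalProjectionOnto x‖ := by
  rw [norm_pos_iff]
  intro h
  rw [Submodule.orthogonalProjectionOnto_eq_zero_iff, Submodule.orthogonal_orthogonal] at h
  exact hx h

variable [MeasurableSpace E] [BorelSpace E]

theorem measurable_matrix_det {α n : Type*} [MeasurableSpace α] [Fintype n] [DecidableEq n]
    {f : α → Matrix n n ℝ} (hf : ∀ i j, Measurable fun a => f a i j) :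
    Measurable fun a => (f a).det := by
  simp_rw [det_apply]
  exact Finset.measurable_sum _ fun σ _ =>
    (Finset.measurable_prod _ fun i _ => hf _ _).const_smul _

theorem measurable_matrix_inv_apply {α n : Type*} [MeasurableSpace α] [Fintype n] [DecidableEq n]
    {f : α → Matrix n n ℝ} (hf : ∀ i j, Measurable fun a => f a i j) (i j : n) :
    Measurable fun a => (f a)⁻¹ i j := by
  simp_rw [inv_def, Matrix.smul_apply, Ring.inverse_eq_inv', adjugate_apply, smul_eq_mul]
  refine (measurable_matrix_det hf).inv.mul (measurable_matrix_det fun k l => ?_)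
  simp only [updateRow_apply]
  split_ifs
  · exact measurable_const
  · exact hf k l

theorem measurable_gram_apply {p : ℕ} (i j : Fin p) :
    Measurable fun y : Fin p → E => gram ℝ y i j :=
  (measurable_pi_apply i).inner (measurable_pi_apply j)

theorem measurableSet_linearIndependent (p : ℕ) :
    MeasurableSet {y : Fin p → E | LinearIndependent ℝ y} := by
  simp_rw [← det_gram_ne_zero_iff_linearIndependent]
  exact (measurable_matrix_det fun i j => measurable_gram_apply i j)
    (measurableSet_singleton _).compl

theorem stdGaussian_ae_notMem {p : ℕ} (hp : p < finrank ℝ E) (y : Fin p → E) :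
    ∀ᵐ x ∂stdGaussian E, x ∉ Submodule.span ℝ (range y) := by
  have h1 : Submodule.span ℝ (range y) ≠ ⊤ := fun h => by
    have h2 := finrank_range_le_card (R := ℝ) y
    rw [Set.finrank, h, finrank_top, Fintype.card_fin] at h2
    omega
  simpa [ae_iff] using stdGaussian_submodule_eq_zero h1

variable (E) in
theorem ae_linearIndependent_stdGaussian {p : ℕ} (hp : p ≤ finrank ℝ E) :
    ∀ᵐ y ∂Measure.pi (fun _ : Fin p => stdGaussian E), LinearIndependent ℝ y := by
  induction p with
  | zero => exact ae_of_all _ fun y => linearIndependent_empty_type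
  | succ p ih =>
    have hmp := measurePreserving_piFinSuccAbove (fun _ : Fin (p + 1) => stdGaussian E) 0
    have h1 : ∀ᵐ z : E × (Fin p → E) ∂(stdGaussian E).prod
        (Measure.pi fun _ : Fin p => stdGaussian E),
        LinearIndependent ℝ ((MeasurableEquiv.piFinSuccAbove (fun _ => E) 0).symm z) := by
      have hset : MeasurableSet {z : E × (Fin p → E) |
          LinearIndependent ℝ ((MeasurableEquiv.piFinSuccAbove (fun _ => E) 0).symm z)} :=
        (MeasurableEquiv.measurable _) (measurableSet_linearIndependent _)
      rw [Measure.ae_prod_iff_ae_ae hset, Measure.ae_ae_comm hset]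
      filter_upwards [ih (by omega)] with y hy
      filter_upwards [stdGaussian_ae_notMem (by omega) y] with x hx
      rw [linearIndependent_iff_succAbove 0]
      simpa [MeasurableEquiv.piFinSuccAbove_symm_apply] using ⟨hy, hx⟩
    filter_upwards [hmp.quasiMeasurePreserving.ae h1] with y hy
    rwa [MeasurableEquiv.symm_apply_apply] at hy

variable (E) in
/-- Given the other `p` vectors, the squared distance of a Gaussian vector from their span is a
chi-square variable with `dim E - p` degrees of freedom. -/
theorem lintegral_inv_gram_apply_self {p : ℕ} (hp : p < finrank ℝ E) (i : Fin (p + 1)) :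
    ∫⁻ y, ENNReal.ofReal ((gram ℝ y)⁻¹ i i) ∂Measure.pi (fun _ : Fin (p + 1) => stdGaussian E) =
      if p + 2 < finrank ℝ E then ENNReal.ofReal (1 / ((finrank ℝ E : ℝ) - p - 2)) else ⊤ := by
  have hmp := (measurePreserving_piFinSuccAbove (fun _ : Fin (p + 1) => stdGaussian E) i).symm
  have hmeas : Measurable fun y : Fin (p + 1) → E => ENNReal.ofReal ((gram ℝ y)⁻¹ i i) :=
    (measurable_matrix_inv_apply (fun i j => measurable_gram_apply i j) i i).ennreal_ofReal
  rw [← hmp.lintegral_comp hmeas]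
  refine (lintegral_prod_symm _ (hmeas.comp (MeasurableEquiv.measurable _)).aemeasurable).trans ?_
  have key : ∀ᵐ y ∂Measure.pi (fun _ : Fin p => stdGaussian E),
      ∫⁻ x, ENNReal.ofReal ((gram ℝ
        ((MeasurableEquiv.piFinSuccAbove (fun _ => E) i).symm (x, y)))⁻¹ i i) ∂stdGaussian E =
      if p + 2 < finrank ℝ E then ENNReal.ofReal (1 / ((finrank ℝ E : ℝ) - p - 2)) else ⊤ := by
    filter_upwards [ae_linearIndependent_stdGaussian E hp.le] with y hy
    set V := Submodule.span ℝ (range y) with hV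
    have hdim : finrank ℝ Vᗮ + p = finrank ℝ E := by
      rw [← V.finrank_add_finrank_orthogonal, finrank_span_eq_card hy, Fintype.card_fin, add_comm]
    have h1 : ∀ᵐ x ∂stdGaussian E, ENNReal.ofReal ((gram ℝ
        ((MeasurableEquiv.piFinSuccAbove (fun _ => E) i).symm (x, y)))⁻¹ i i) =
        (ENNReal.ofReal (‖Vᗮ.orthogonalProjectionOnto x‖ ^ 2))⁻¹ := by
      filter_upwards [stdGaussian_ae_notMem hp y] with x hx
      have hli : LinearIndependent ℝ
          ((MeasurableEquiv.piFinSuccAbove (fun _ => E) i).symm (x, y)) := by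
        rw [linearIndependent_iff_succAbove i]
        simpa [MeasurableEquiv.piFinSuccAbove_symm_apply] using ⟨hy, hx⟩
      have hpos := norm_orthogonalProjectionOnto_orthogonal_pos hx
      rw [inv_gram_apply_self_of_eq (x := x) (y := y) i hli
        (by simp [MeasurableEquiv.piFinSuccAbove_symm_apply])
        (by simp [MeasurableEquiv.piFinSuccAbove_symm_apply]),
        ← ENNReal.ofReal_inv_of_pos (by positivity)]
    rw [lintegral_congr_ae h1, ← lintegral_map (f := fun w : Vᗮ => (ENNReal.ofReal (‖w‖ ^ 2))⁻¹)
      (by fun_prop) (by fun_prop), stdGaussian_map_orthogonalProjection]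
    split_ifs with h
    · rw [lintegral_inv_norm_sq_stdGaussian_of_two_lt (by omega), ← hdim]
      congr 2
      push_cast
      ring
    · exact lintegral_inv_norm_sq_stdGaussian_of_le_two (by omega)
  refine (lintegral_congr_ae key).trans ?_
  simp

/-- The transpose of a matrix with independent standard Gaussian rows has independent standard
Gaussian rows. -/
theorem measurePreserving_transpose_stdGaussian (n d : ℕ) :
    MeasurePreserving (fun (x : Fin n → EuclideanSpace ℝ (Fin d)) (j : Fin d) =>
        WithLp.toLp 2 fun i : Fin n => x i j)
      (Measure.pi fun _ => stdGaussian (EuclideanSpace ℝ (Fin d)))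
      (Measure.pi fun _ => stdGaussian (EuclideanSpace ℝ (Fin n))) := by
  have hcurry : ∀ m l : ℕ, MeasurePreserving (fun (z : Fin m × Fin l → ℝ) (i : Fin m) =>
      (WithLp.toLp 2 fun j : Fin l => z (i, j) : EuclideanSpace ℝ (Fin l)))
      (Measure.pi fun _ => gaussianReal 0 1)
      (Measure.pi fun _ => stdGaussian (EuclideanSpace ℝ (Fin l))) := by
    intro m l
    have h1 : MeasurePreserving (MeasurableEquiv.curry (Fin m) (Fin l) ℝ)
        (Measure.pi fun _ => gaussianReal 0 1)
        (Measure.pi fun _ => Measure.pi fun _ => gaussianReal 0 1) := by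
      refine ⟨MeasurableEquiv.measurable _, ?_⟩
      have h2 := Measure.infinitePi_map_curry (fun (_ : Fin m) (_ : Fin l) => gaussianReal 0 1)
      simpa only [Measure.infinitePi_eq_pi] using h2
    have h3 : MeasurePreserving (WithLp.toLp 2 : (Fin l → ℝ) → EuclideanSpace ℝ (Fin l))
        (Measure.pi fun _ => gaussianReal 0 1) (stdGaussian (EuclideanSpace ℝ (Fin l))) :=
      ⟨by fun_prop, map_pi_eq_stdGaussian⟩
    exact (measurePreserving_pi _ _ fun _ : Fin m => h3).comp h1
  have hswap : MeasurePreserving (fun (z : Fin n × Fin d → ℝ) (p : Fin d × Fin n) => z p.swap)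
      (Measure.pi fun _ => gaussianReal 0 1) (Measure.pi fun _ => gaussianReal 0 1) := by
    have := measurePreserving_piCongrLeft (fun _ : Fin d × Fin n => gaussianReal 0 1)
      (Equiv.prodComm (Fin n) (Fin d))
    convert this using 1
    ext z p
    simp [MeasurableEquiv.piCongrLeft, Equiv.piCongrLeft, Equiv.piCongrLeft']
  have hA := hcurry n d
  have hB := (hcurry d n).comp hswap
  refine ⟨by fun_prop, ?_⟩
  rw [← hA.map_eq, Measure.map_map (by fun_prop) hA.measurable, ← hB.map_eq]
  rfl

end GaussianGram

/-! ### Gaussian designs and isotropy -/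

section GaussianDesign

open Module Matrix
open scoped RealInnerProductSpace ENNReal

/-- The law of `n` independent standard Gaussian vectors of `ℝᵈ`. -/
noncomputable def gaussianDesign (n d : ℕ) : Measure (Fin n → EuclideanSpace ℝ (Fin d)) :=
  Measure.pi fun _ => stdGaussian (EuclideanSpace ℝ (Fin d))

instance (n d : ℕ) : IsProbabilityMeasure (gaussianDesign n d) := by
  unfold gaussianDesign; infer_instance

variable {n d : ℕ}

theorem rowStack_mul_transpose (x : Fin n → EuclideanSpace ℝ (Fin d)) :
    rowStack x * (rowStack x)ᵀ = gram ℝ x := by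
  ext i j
  simp [rowStack, mul_apply, gram_apply, PiLp.inner_apply, mul_comm]

theorem rowStack_transpose_mul (x : Fin n → EuclideanSpace ℝ (Fin d)) :
    (rowStack x)ᵀ * rowStack x = gram ℝ fun j : Fin d => WithLp.toLp 2 fun i : Fin n => x i j := by
  ext i j
  simp [rowStack, mul_apply, gram_apply, PiLp.inner_apply, mul_comm]

theorem ae_fullRank_gaussianDesign (n d : ℕ) :
    ∀ᵐ x ∂gaussianDesign n d, FullRank (rowStack x) := by
  by_cases h : d ≤ n
  · have h1 := (measurePreserving_transpose_stdGaussian n d).quasiMeasurePreserving.ae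
      (ae_linearIndependent_stdGaussian (EuclideanSpace ℝ (Fin n)) (p := d) (by simpa using h))
    filter_upwards [h1] with x hx
    rw [FullRank, if_pos h, rowStack_transpose_mul, isUnit_iff_ne_zero]
    exact det_gram_ne_zero_iff_linearIndependent.2 hx
  · have h1 := ae_linearIndependent_stdGaussian (EuclideanSpace ℝ (Fin d)) (p := n)
      (by simpa using (not_le.1 h).le)
    filter_upwards [h1] with x hx
    rw [FullRank, if_neg h, rowStack_mul_transpose, isUnit_iff_ne_zero]
    exact det_gram_ne_zero_iff_linearIndependent.2 hx

theorem measurable_matrix_mul_apply {α l m o : Type*} [MeasurableSpace α] [Fintype m]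
    {f : α → Matrix l m ℝ} {g : α → Matrix m o ℝ} (hf : ∀ i j, Measurable fun a => f a i j)
    (hg : ∀ i j, Measurable fun a => g a i j) (i : l) (j : o) :
    Measurable fun a => (f a * g a) i j := by
  simp_rw [mul_apply]
  exact Finset.measurable_sum _ fun _ _ => (hf _ _).mul (hg _ _)

theorem measurable_rowStack_apply (i : Fin n) (j : Fin d) :
    Measurable fun x : Fin n → EuclideanSpace ℝ (Fin d) => rowStack x i j := by
  simp only [rowStack, of_apply]
  fun_prop

theorem measurable_pinv_apply (a : Fin d) (i : Fin n) :
    Measurable fun x : Fin n → EuclideanSpace ℝ (Fin d) => pinv (rowStack x) a i := by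
  unfold pinv
  split_ifs
  · exact measurable_matrix_mul_apply (measurable_matrix_inv_apply
      (measurable_matrix_mul_apply (fun i j => measurable_rowStack_apply j i)
        measurable_rowStack_apply)) (fun i j => measurable_rowStack_apply j i) a i
  · exact measurable_matrix_mul_apply (fun i j => measurable_rowStack_apply j i)
      (measurable_matrix_inv_apply (measurable_matrix_mul_apply measurable_rowStack_apply
        (fun i j => measurable_rowStack_apply j i))) a i

theorem measurable_rowProj_apply (a b : Fin d) :
    Measurable fun x : Fin n → EuclideanSpace ℝ (Fin d) => rowProj (rowStack x) a b :=
  measurable_matrix_mul_apply measurable_pinv_apply measurable_rowStack_apply a b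

theorem measurable_pinvGram_apply (a b : Fin d) :
    Measurable fun x : Fin n → EuclideanSpace ℝ (Fin d) => pinvGram (rowStack x) a b :=
  measurable_matrix_mul_apply measurable_pinv_apply (fun i j => measurable_pinv_apply j i) a b

theorem inv_gram_apply_self_nonneg {E : Type*} [NormedAddCommGroup E] [InnerProductSpace ℝ E]
    {p : ℕ} (y : Fin p → E) (i : Fin p) : 0 ≤ (gram ℝ y)⁻¹ i i := by
  simpa using (posSemidef_gram ℝ y).inv.diag_nonneg (i := i)

/-- For `p = 0` both sides vanish, with `0 * ⊤ = 0` on the right. -/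
theorem lintegral_trace_inv_gram (E : Type*) [NormedAddCommGroup E] [InnerProductSpace ℝ E]
    [FiniteDimensional ℝ E] [MeasurableSpace E] [BorelSpace E] {p : ℕ} (hp : p ≤ finrank ℝ E) :
    ∫⁻ y, ENNReal.ofReal ((gram ℝ y)⁻¹).trace ∂Measure.pi (fun _ : Fin p => stdGaussian E) =
      p * if p + 1 < finrank ℝ E then ENNReal.ofReal (1 / ((finrank ℝ E : ℝ) - p - 1)) else ⊤ := by
  cases p with
  | zero => simp [trace]
  | succ p =>
    simp_rw [trace, diag_apply]
    simp_rw [ENNReal.ofReal_sum_of_nonneg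
      fun i (_ : i ∈ Finset.univ) => inv_gram_apply_self_nonneg _ i]
    rw [lintegral_finsetSum _ fun i _ => (measurable_matrix_inv_apply
      (fun i j => measurable_gram_apply i j) i i).ennreal_ofReal]
    simp_rw [lintegral_inv_gram_apply_self E (Nat.lt_of_succ_le hp)]
    rw [Finset.sum_const, Finset.card_univ, Fintype.card_fin, nsmul_eq_mul]
    congr 3
    push_cast
    ring_nf

theorem lintegral_trace_pinvGram_of_le (h : d ≤ n) :
    ∫⁻ x, ENNReal.ofReal (pinvGram (rowStack x)).trace ∂gaussianDesign n d =
      d * if d + 1 < n then ENNReal.ofReal (1 / ((n : ℝ) - d - 1)) else ⊤ := by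
  -- the Gram matrix `Aᵀ A` is that of the columns, which are also independent Gaussian vectors
  have h1 := lintegral_trace_inv_gram (EuclideanSpace ℝ (Fin n)) (p := d) (by simpa using h)
  rw [finrank_euclideanSpace_fin] at h1
  rw [← h1, ← (measurePreserving_transpose_stdGaussian n d).lintegral_comp]
  · refine lintegral_congr_ae ?_
    filter_upwards [ae_fullRank_gaussianDesign n d] with x hx
    rw [trace_pinvGram_of_le hx h, rowStack_transpose_mul]
  · refine Measurable.ennreal_ofReal (Finset.measurable_sum _ fun i _ =>
      measurable_matrix_inv_apply (fun i j => measurable_gram_apply i j) i i)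

theorem lintegral_trace_pinvGram_of_lt (h : n < d) :
    ∫⁻ x, ENNReal.ofReal (pinvGram (rowStack x)).trace ∂gaussianDesign n d =
      n * if n + 1 < d then ENNReal.ofReal (1 / ((d : ℝ) - n - 1)) else ⊤ := by
  have h1 := lintegral_trace_inv_gram (EuclideanSpace ℝ (Fin d)) (p := n) (by simpa using h.le)
  rw [finrank_euclideanSpace_fin] at h1
  rw [← h1]
  refine lintegral_congr_ae ?_
  filter_upwards [ae_fullRank_gaussianDesign n d] with x hx
  rw [trace_pinvGram_of_lt hx h, rowStack_mul_transpose]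

theorem norm_toEuclideanLin_of_orthogonal {m : ℕ} {U : Matrix (Fin m) (Fin m) ℝ}
    (hU : Uᵀ * U = 1) (x : EuclideanSpace ℝ (Fin m)) : ‖toEuclideanLin U x‖ = ‖x‖ := by
  have h1 : ‖toEuclideanLin U x‖ ^ 2 = ‖x‖ ^ 2 := by
    simp only [EuclideanSpace.real_norm_sq_eq, toLpLin_apply]
    have h2 : ∀ v : Fin m → ℝ, ∑ i, v i ^ 2 = v ⬝ᵥ v := fun v => by simp [dotProduct, sq]
    rw [h2, h2, dotProduct_mulVec, vecMul_mulVec, hU, vecMul_one]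
  exact (sq_eq_sq₀ (norm_nonneg _) (norm_nonneg _)).1 h1

theorem measurePreserving_orthogonal_stdGaussian {m : ℕ} {U : Matrix (Fin m) (Fin m) ℝ}
    (hU : Uᵀ * U = 1) : MeasurePreserving (toEuclideanLin U)
      (stdGaussian (EuclideanSpace ℝ (Fin m))) (stdGaussian (EuclideanSpace ℝ (Fin m))) := by
  let f : EuclideanSpace ℝ (Fin m) →ₗᵢ[ℝ] EuclideanSpace ℝ (Fin m) :=
    ⟨toEuclideanLin U, norm_toEuclideanLin_of_orthogonal hU⟩
  have h := stdGaussian_map (f.toLinearIsometryEquiv rfl)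
  exact ⟨f.continuous.measurable, h⟩

/-- The law of a Gaussian design is invariant under right multiplication by orthogonal matrices. -/
theorem exists_measurePreserving_rowStack_mul {U : Matrix (Fin d) (Fin d) ℝ} (hU : U * Uᵀ = 1) :
    ∃ r : (Fin n → EuclideanSpace ℝ (Fin d)) → Fin n → EuclideanSpace ℝ (Fin d),
      MeasurePreserving r (gaussianDesign n d) (gaussianDesign n d) ∧
        ∀ x, rowStack (r x) = rowStack x * U := by
  refine ⟨fun x i => toEuclideanLin Uᵀ (x i), measurePreserving_pi _ _ fun _ =>
    measurePreserving_orthogonal_stdGaussian (by rwa [transpose_transpose]), fun x => ?_⟩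
  ext i j
  simp [rowStack, mul_apply, toLpLin_apply, mulVec, dotProduct, mul_comm]

theorem lintegral_pinvGram_conj {U : Matrix (Fin d) (Fin d) ℝ} (hU : U * Uᵀ = 1)
    {f : Matrix (Fin d) (Fin d) ℝ → ℝ≥0∞}
    (hf : Measurable fun x : Fin n → EuclideanSpace ℝ (Fin d) => f (pinvGram (rowStack x))) :
    ∫⁻ x, f (Uᵀ * pinvGram (rowStack x) * U) ∂gaussianDesign n d =
      ∫⁻ x, f (pinvGram (rowStack x)) ∂gaussianDesign n d := by
  obtain ⟨r, hr, hr'⟩ := exists_measurePreserving_rowStack_mul (n := n) hU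
  rw [← hr.lintegral_comp hf]
  simp_rw [hr', pinvGram_mul_orthogonal _ hU]

theorem integral_rowProj_conj {U : Matrix (Fin d) (Fin d) ℝ} (hU : U * Uᵀ = 1)
    {f : Matrix (Fin d) (Fin d) ℝ → ℝ}
    (hf : Measurable fun x : Fin n → EuclideanSpace ℝ (Fin d) => f (rowProj (rowStack x))) :
    ∫ x, f (Uᵀ * rowProj (rowStack x) * U) ∂gaussianDesign n d =
      ∫ x, f (rowProj (rowStack x)) ∂gaussianDesign n d := by
  obtain ⟨r, hr, hr'⟩ := exists_measurePreserving_rowStack_mul (n := n) hU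
  conv_rhs => rw [← hr.map_eq, integral_map hr.measurable.aemeasurable hf.aestronglyMeasurable]
  simp_rw [hr', rowProj_mul_orthogonal _ hU]

theorem permutation_orthogonal (π : Equiv.Perm (Fin d)) :
    ((1 : Matrix (Fin d) (Fin d) ℝ).submatrix id π) *
      ((1 : Matrix (Fin d) (Fin d) ℝ).submatrix id π)ᵀ = 1 := by
  rw [transpose_submatrix, transpose_one, submatrix_mul_equiv, Matrix.mul_one, submatrix_id_id]

theorem permutation_conj (π : Equiv.Perm (Fin d)) (K : Matrix (Fin d) (Fin d) ℝ) :
    ((1 : Matrix (Fin d) (Fin d) ℝ).submatrix id π)ᵀ * K *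
      ((1 : Matrix (Fin d) (Fin d) ℝ).submatrix id π) = K.submatrix π π := by
  ext i j
  simp [mul_apply, one_apply]

theorem sign_orthogonal (s : Fin d → ℤˣ) :
    diagonal (fun i => ((s i : ℤ) : ℝ)) * (diagonal fun i => ((s i : ℤ) : ℝ))ᵀ = 1 := by
  rw [diagonal_transpose, diagonal_mul_diagonal, ← diagonal_one]
  congr 1
  ext i
  rcases Int.units_eq_one_or (s i) with h | h <;> simp [h]

theorem sign_conj_apply (s : Fin d → ℤˣ) (K : Matrix (Fin d) (Fin d) ℝ) (a b : Fin d) :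
    ((diagonal fun i => ((s i : ℤ) : ℝ))ᵀ * K * diagonal fun i => ((s i : ℤ) : ℝ)) a b =
      ((s a : ℤ) : ℝ) * ((s b : ℤ) : ℝ) * K a b := by
  rw [diagonal_transpose, mul_diagonal, diagonal_mul]
  ring

theorem sum_sign_mul_sign (a b : Fin d) :
    ∑ s : Fin d → ℤˣ, ((s a : ℤ) : ℝ) * ((s b : ℤ) : ℝ) = if a = b then 2 ^ d else 0 := by
  split_ifs with h
  · subst h
    have : ∀ s : Fin d → ℤˣ, ((s a : ℤ) : ℝ) * ((s a : ℤ) : ℝ) = 1 := fun s => by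
      rcases Int.units_eq_one_or (s a) with h | h <;> simp [h]
    simp [this]
  · -- flipping the sign at `a` maps the sum to its negative
    have h1 := Equiv.sum_comp (Equiv.mulLeft (Pi.mulSingle a (-1) : Fin d → ℤˣ))
      fun s : Fin d → ℤˣ => ((s a : ℤ) : ℝ) * ((s b : ℤ) : ℝ)
    have h2 : ∀ s : Fin d → ℤˣ, (((Pi.mulSingle a (-1) * s : Fin d → ℤˣ) a : ℤ) : ℝ) *
        (((Pi.mulSingle a (-1) * s : Fin d → ℤˣ) b : ℤ) : ℝ) =
        -(((s a : ℤ) : ℝ) * ((s b : ℤ) : ℝ)) := fun s => by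
      simp [Pi.mulSingle_eq_of_ne (Ne.symm h)]
    simp only [Equiv.coe_mulLeft, h2, Finset.sum_neg_distrib] at h1
    linarith

theorem pinvGram_apply_self_nonneg (A : Matrix (Fin n) (Fin d) ℝ) (i : Fin d) :
    0 ≤ pinvGram A i i := by
  simp only [pinvGram, mul_apply, transpose_apply]
  exact Finset.sum_nonneg fun _ _ => mul_self_nonneg _

theorem lintegral_pinvGram_apply_self (i : Fin d) :
    ∫⁻ x, ENNReal.ofReal (pinvGram (rowStack x) i i) ∂gaussianDesign n d =
      (∫⁻ x, ENNReal.ofReal (pinvGram (rowStack x)).trace ∂gaussianDesign n d) / d := by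
  have h1 : ∀ j, ∫⁻ x, ENNReal.ofReal (pinvGram (rowStack x) j j) ∂gaussianDesign n d =
      ∫⁻ x, ENNReal.ofReal (pinvGram (rowStack x) i i) ∂gaussianDesign n d := fun j => by
    rw [← lintegral_pinvGram_conj (permutation_orthogonal (Equiv.swap i j))
      (f := fun K => ENNReal.ofReal (K i i)) (measurable_pinvGram_apply i i).ennreal_ofReal]
    simp_rw [permutation_conj]
    simp
  have hd : (d : ℝ≥0∞) ≠ 0 := by
    have := i.pos
    simp; omega
  rw [ENNReal.eq_div_iff hd (by simp)]
  simp_rw [trace, diag_apply]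
  simp_rw [ENNReal.ofReal_sum_of_nonneg
    fun i (_ : i ∈ Finset.univ) => pinvGram_apply_self_nonneg _ i]
  rw [lintegral_finsetSum _ fun i _ => (measurable_pinvGram_apply i i).ennreal_ofReal]
  simp [h1]

/-- Isotropy of the noise covariance: a nonnegative linear functional of `A⁺ A⁺ᵀ` has the mean that
it would have if that matrix were its trace times `1 / d`. The sign changes remove the off-diagonal
entries before integration, so that the means may be infinite. -/
theorem lintegral_linear_pinvGram (M : Matrix (Fin d) (Fin d) ℝ) (hM : ∀ i, 0 ≤ M i i)
    (hpos : ∀ A : Matrix (Fin n) (Fin d) ℝ, 0 ≤ ∑ a, ∑ c, M a c * pinvGram A a c) :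
    ∫⁻ x, ENNReal.ofReal (∑ a, ∑ c, M a c * pinvGram (rowStack x) a c) ∂gaussianDesign n d =
      ENNReal.ofReal M.trace *
        ((∫⁻ x, ENNReal.ofReal (pinvGram (rowStack x)).trace ∂gaussianDesign n d) / d) := by
  have hmeas : Measurable fun x : Fin n → EuclideanSpace ℝ (Fin d) =>
      ENNReal.ofReal (∑ a, ∑ c, M a c * pinvGram (rowStack x) a c) :=
    (Finset.measurable_sum _ fun a _ => Finset.measurable_sum _ fun c _ =>
      (measurable_pinvGram_apply a c).const_mul _).ennreal_ofReal
  have hdiag : ∫⁻ x, ENNReal.ofReal (∑ a, M a a * pinvGram (rowStack x) a a)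
      ∂gaussianDesign n d = ENNReal.ofReal M.trace *
        ((∫⁻ x, ENNReal.ofReal (pinvGram (rowStack x)).trace ∂gaussianDesign n d) / d) := by
    simp_rw [ENNReal.ofReal_sum_of_nonneg fun a (_ : a ∈ Finset.univ) =>
      mul_nonneg (hM a) (pinvGram_apply_self_nonneg _ a), ENNReal.ofReal_mul (hM _)]
    rw [lintegral_finsetSum _ fun a _ =>
      (measurable_pinvGram_apply a a).ennreal_ofReal.const_mul _]
    simp_rw [lintegral_const_mul _ (measurable_pinvGram_apply _ _).ennreal_ofReal,
      lintegral_pinvGram_apply_self]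
    simp_rw [trace, diag_apply]
    rw [← Finset.sum_mul, ENNReal.ofReal_sum_of_nonneg fun a _ => hM a]
  rw [← hdiag]
  -- average over all changes of signs of the basis; each term stays nonnegative
  have hconj : ∀ s : Fin d → ℤˣ,
      ∫⁻ x, ENNReal.ofReal (∑ a, ∑ c, M a c * (((s a : ℤ) : ℝ) * ((s c : ℤ) : ℝ) *
        pinvGram (rowStack x) a c)) ∂gaussianDesign n d =
      ∫⁻ x, ENNReal.ofReal (∑ a, ∑ c, M a c * pinvGram (rowStack x) a c)
        ∂gaussianDesign n d := fun s => by
    rw [← lintegral_pinvGram_conj (sign_orthogonal s)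
      (f := fun K => ENNReal.ofReal (∑ a, ∑ c, M a c * K a c)) hmeas]
    simp_rw [sign_conj_apply]
  have hposs : ∀ (s : Fin d → ℤˣ) (x : Fin n → EuclideanSpace ℝ (Fin d)),
      0 ≤ ∑ a, ∑ c, M a c * (((s a : ℤ) : ℝ) * ((s c : ℤ) : ℝ) *
        pinvGram (rowStack x) a c) := fun s x => by
    have := hpos (rowStack x * diagonal fun i => ((s i : ℤ) : ℝ))
    simpa only [pinvGram_mul_orthogonal _ (sign_orthogonal s), sign_conj_apply] using this
  have hsum : ∀ x : Fin n → EuclideanSpace ℝ (Fin d),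
      ∑ s : Fin d → ℤˣ, ∑ a, ∑ c, M a c * (((s a : ℤ) : ℝ) * ((s c : ℤ) : ℝ) *
        pinvGram (rowStack x) a c) = 2 ^ d * ∑ a, M a a * pinvGram (rowStack x) a a := fun x => by
    rw [Finset.sum_comm, Finset.mul_sum]
    refine Finset.sum_congr rfl fun a _ => ?_
    rw [Finset.sum_comm]
    have h1 : ∀ c, ∑ s : Fin d → ℤˣ, M a c * (((s a : ℤ) : ℝ) * ((s c : ℤ) : ℝ) *
        pinvGram (rowStack x) a c) =
        (if a = c then 2 ^ d else 0) * (M a c * pinvGram (rowStack x) a c) := fun c => by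
      rw [← sum_sign_mul_sign, Finset.sum_mul]
      exact Finset.sum_congr rfl fun s _ => by ring
    simp [h1]
  have hfin : (2 : ℝ≥0∞) ^ d *
      ∫⁻ x, ENNReal.ofReal (∑ a, ∑ c, M a c * pinvGram (rowStack x) a c) ∂gaussianDesign n d =
      2 ^ d * ∫⁻ x, ENNReal.ofReal (∑ a, M a a * pinvGram (rowStack x) a a)
        ∂gaussianDesign n d := by
    have h2 := Finset.sum_congr (rfl : (Finset.univ : Finset (Fin d → ℤˣ)) = _)
      fun s _ => hconj s
    rw [Finset.sum_const, Finset.card_univ, Fintype.card_fun, Fintype.card_units_int,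
      Fintype.card_fin, nsmul_eq_mul, ← lintegral_finsetSum _ fun s _ => ?_] at h2
    · simp_rw [← ENNReal.ofReal_sum_of_nonneg fun s (_ : s ∈ Finset.univ) => hposs s _, hsum,
        ENNReal.ofReal_mul (show (0 : ℝ) ≤ 2 ^ d by positivity)] at h2
      rw [lintegral_const_mul _ (Finset.measurable_sum _ fun a _ =>
        (measurable_pinvGram_apply a a).const_mul _).ennreal_ofReal] at h2
      simpa using h2.symm
    · exact (Finset.measurable_sum _ fun a _ => Finset.measurable_sum _ fun c _ =>
        ((measurable_pinvGram_apply a c).const_mul _).const_mul _).ennreal_ofReal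
  exact (ENNReal.mul_right_inj (by positivity) (by simp)).1 hfin

end GaussianDesign

/-! ### Moments of the projection onto a random row space -/

section RowSpaceMoments

open Module Matrix

variable {n d k : ℕ}

theorem integrable_rowProj_mul (a b c e : Fin d) :
    Integrable (fun x : Fin n → EuclideanSpace ℝ (Fin d) =>
      rowProj (rowStack x) a b * rowProj (rowStack x) c e) (gaussianDesign n d) := by
  refine Integrable.of_bound ((measurable_rowProj_apply a b).mul
    (measurable_rowProj_apply c e)).aestronglyMeasurable 1 ?_
  filter_upwards [ae_fullRank_gaussianDesign n d] with x hx
  rw [Real.norm_eq_abs, abs_mul]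
  exact mul_le_one₀ (abs_rowProj_le_one hx a b) (abs_nonneg _) (abs_rowProj_le_one hx c e)

/-- The fourth-order moment tensor `E[P a b P c e]` of the projection `P` onto the row space of an
`n × d` Gaussian design. -/
noncomputable def rowProjMoment (n : ℕ) {d : ℕ} (a b c e : Fin d) : ℝ :=
  ∫ x, rowProj (rowStack x) a b * rowProj (rowStack x) c e ∂gaussianDesign n d

theorem rowProjMoment_conj {U : Matrix (Fin d) (Fin d) ℝ} (hU : U * Uᵀ = 1) (a b c e : Fin d) :
    ∫ x, (Uᵀ * rowProj (rowStack x) * U) a b * (Uᵀ * rowProj (rowStack x) * U) c e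
      ∂gaussianDesign n d = rowProjMoment n a b c e :=
  integral_rowProj_conj hU (f := fun R => R a b * R c e)
    ((measurable_rowProj_apply a b).mul (measurable_rowProj_apply c e))

/-- A moment that is odd under some change of signs of the basis vanishes. -/
theorem rowProjMoment_eq_zero {a b c e : Fin d} (s : Fin d → ℤˣ)
    (hs : s a * s b * (s c * s e) = -1) : rowProjMoment n a b c e = 0 := by
  have h1 := rowProjMoment_conj (n := n) (sign_orthogonal s) a b c e
  simp_rw [sign_conj_apply] at h1
  have h2 : ((s a : ℤ) : ℝ) * ((s b : ℤ) : ℝ) * (((s c : ℤ) : ℝ) * ((s e : ℤ) : ℝ)) = -1 := by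
    simpa using congrArg (fun u : ℤˣ => ((u : ℤ) : ℝ)) hs
  have h3 : ∀ x : Fin n → EuclideanSpace ℝ (Fin d),
      ((s a : ℤ) : ℝ) * ((s b : ℤ) : ℝ) * rowProj (rowStack x) a b *
        (((s c : ℤ) : ℝ) * ((s e : ℤ) : ℝ) * rowProj (rowStack x) c e) =
      (-1) * (rowProj (rowStack x) a b * rowProj (rowStack x) c e) := fun x => by
    rw [← h2]; ring
  simp_rw [h3] at h1
  rw [integral_const_mul] at h1
  unfold rowProjMoment at h1 ⊢
  linarith

theorem rowProjMoment_perm (π : Equiv.Perm (Fin d)) (a b c e : Fin d) :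
    rowProjMoment n (π a) (π b) (π c) (π e) = rowProjMoment n a b c e := by
  rw [← rowProjMoment_conj (permutation_orthogonal π) a b c e]
  simp_rw [permutation_conj]
  rfl

theorem rowProjMoment_comm_right (a b c e : Fin d) :
    rowProjMoment n a b c e = rowProjMoment n a b e c := by
  refine integral_congr_ae ?_
  filter_upwards [ae_fullRank_gaussianDesign n d] with x hx
  rw [show rowProj (rowStack x) c e = rowProj (rowStack x) e c from
    congrFun₂ (transpose_rowProj hx) e c]

/-- Invariance under the reflection that sends a basis vector to `(3/5, 4/5)` in a coordinate plane
ties the diagonal moments to the off-diagonal ones. -/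
theorem rowProjMoment_diag {a c : Fin d} (hac : a ≠ c) :
    rowProjMoment n a a a a = rowProjMoment n a a c c + 2 * rowProjMoment n a c a c := by
  -- `w` has squared norm `5`, so the reflection along `w` has rational entries
  set w : Fin d → ℝ := Pi.single a 1 - (2 : ℝ) • Pi.single c 1 with hw
  have hwa : w a = 1 := by simp [hw, hac]
  have hwc : w c = -2 := by simp [hw, hac.symm]
  have hww : w ⬝ᵥ w = 5 := by
    have h1 : w ⬝ᵥ w = w a * 1 - w c * 2 := by
      conv_lhs => rw [hw, dotProduct_sub, dotProduct_smul, ← hw]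
      simp [mul_comm]
    rw [h1, hwa, hwc]; norm_num
  set U : Matrix (Fin d) (Fin d) ℝ := 1 - (2 / 5 : ℝ) • vecMulVec w w with hUdef
  have hUt : Uᵀ = U := by
    rw [hUdef, transpose_sub, transpose_one, transpose_smul, transpose_vecMulVec]
  have hU : U * Uᵀ = 1 := by
    rw [hUt, hUdef, Matrix.sub_mul, Matrix.mul_sub, Matrix.mul_sub, Matrix.one_mul,
      Matrix.mul_one, Matrix.one_mul, Matrix.smul_mul, Matrix.mul_smul,
      vecMulVec_mul_vecMulVec, hww]
    ext i j
    simp [vecMulVec_apply]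
    ring
  have hcol : ∀ i, U i a = 3 / 5 * (Pi.single a 1 : Fin d → ℝ) i +
      4 / 5 * (Pi.single c 1 : Fin d → ℝ) i := fun i => by
    have h1 : (1 : Matrix (Fin d) (Fin d) ℝ) i a = (Pi.single a 1 : Fin d → ℝ) i := by
      simp [one_apply, Pi.single_apply]
    rw [hUdef, Matrix.sub_apply, h1, Matrix.smul_apply, vecMulVec_apply, hwa, hw]
    simp
    ring
  have hent : ∀ R : Matrix (Fin d) (Fin d) ℝ, (Uᵀ * R * U) a a =
      9 / 25 * R a a + 12 / 25 * R a c + 12 / 25 * R c a + 16 / 25 * R c c := fun R => by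
    simp only [mul_apply, transpose_apply, hcol, mul_add, add_mul, Finset.sum_add_distrib]
    simp [Pi.single_apply]
    ring
  -- of the moments in the expansion, those of odd degree in an index vanish
  have h := rowProjMoment_conj (n := n) hU a a a a
  have hz1 : rowProjMoment n a a a c = 0 :=
    rowProjMoment_eq_zero (Pi.mulSingle c (-1)) (by simp [hac])
  have hz2 : rowProjMoment n a c c c = 0 :=
    rowProjMoment_eq_zero (Pi.mulSingle a (-1)) (by simp [hac.symm])
  have hcc : rowProjMoment n c c c c = rowProjMoment n a a a a := by
    simpa using (rowProjMoment_perm (n := n) (Equiv.swap a c) a a a a)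
  have hexp : ∫ x, (Uᵀ * rowProj (rowStack x) * U) a a * (Uᵀ * rowProj (rowStack x) * U) a a
      ∂gaussianDesign n d = 81 / 625 * rowProjMoment n a a a a +
        256 / 625 * rowProjMoment n c c c c + 576 / 625 * rowProjMoment n a c a c +
        288 / 625 * rowProjMoment n a a c c + 432 / 625 * rowProjMoment n a a a c +
        768 / 625 * rowProjMoment n a c c c := by
    have hae : ∀ᵐ x ∂gaussianDesign n d,
        (Uᵀ * rowProj (rowStack x) * U) a a * (Uᵀ * rowProj (rowStack x) * U) a a =
        81 / 625 * (rowProj (rowStack x) a a * rowProj (rowStack x) a a) +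
        256 / 625 * (rowProj (rowStack x) c c * rowProj (rowStack x) c c) +
        576 / 625 * (rowProj (rowStack x) a c * rowProj (rowStack x) a c) +
        288 / 625 * (rowProj (rowStack x) a a * rowProj (rowStack x) c c) +
        432 / 625 * (rowProj (rowStack x) a a * rowProj (rowStack x) a c) +
        768 / 625 * (rowProj (rowStack x) a c * rowProj (rowStack x) c c) := by
      filter_upwards [ae_fullRank_gaussianDesign n d] with x hx
      rw [hent, show rowProj (rowStack x) c a = rowProj (rowStack x) a c from
        congrFun₂ (transpose_rowProj hx) a c]
      ring
    have hi := fun a b c e : Fin d => integrable_rowProj_mul (n := n) a b c e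
    rw [integral_congr_ae hae, integral_add, integral_add, integral_add, integral_add,
      integral_add]
    · simp only [integral_const_mul, rowProjMoment]
    all_goals
      repeat' apply Integrable.add
      all_goals exact (hi _ _ _ _).const_mul _
  rw [hexp, hz1, hz2, hcc] at h
  linarith

/-- The only fourth-order tensors invariant under the orthogonal group, and symmetric as the moments
of a symmetric matrix are, are combinations of two products of Kronecker deltas. -/
theorem exists_rowProjMoment_eq (n : ℕ) (hd : 2 ≤ d) :
    ∃ α β : ℝ, ∀ a b c e : Fin d, rowProjMoment n a b c e =
      α * ((if a = b then 1 else 0) * if c = e then 1 else 0) +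
        β * ((if a = c then 1 else 0) * (if b = e then 1 else 0) +
          (if a = e then 1 else 0) * if b = c then 1 else 0) := by
  obtain ⟨i₀, i₁, h01⟩ : ∃ i₀ i₁ : Fin d, i₀ ≠ i₁ :=
    ⟨⟨0, by omega⟩, ⟨1, by omega⟩, by simp⟩
  -- permutations of the basis act transitively on pairs of distinct indices
  have hα : ∀ {a c : Fin d}, a ≠ c →
      rowProjMoment n a a c c = rowProjMoment n i₀ i₀ i₁ i₁ := fun {a c} hac => by
    obtain ⟨π, h1, h2⟩ := (MulAction.is_two_pretransitive_iff.1
      (Equiv.Perm.isMultiplyPretransitive (Fin d) 2)) h01 hac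
    rw [← h1, ← h2]
    exact rowProjMoment_perm π _ _ _ _
  have hβ : ∀ {a c : Fin d}, a ≠ c →
      rowProjMoment n a c a c = rowProjMoment n i₀ i₁ i₀ i₁ := fun {a c} hac => by
    obtain ⟨π, h1, h2⟩ := (MulAction.is_two_pretransitive_iff.1
      (Equiv.Perm.isMultiplyPretransitive (Fin d) 2)) h01 hac
    rw [← h1, ← h2]
    exact rowProjMoment_perm π _ _ _ _
  have hγ : ∀ a : Fin d, rowProjMoment n a a a a =
      rowProjMoment n i₀ i₀ i₁ i₁ + 2 * rowProjMoment n i₀ i₁ i₀ i₁ := fun a => by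
    obtain ⟨c, hc⟩ : ∃ c, a ≠ c := by
      by_cases h : a = i₀
      · exact ⟨i₁, h ▸ h01⟩
      · exact ⟨i₀, h⟩
    rw [rowProjMoment_diag hc, hα hc, hβ hc]
  refine ⟨rowProjMoment n i₀ i₀ i₁ i₁, rowProjMoment n i₀ i₁ i₀ i₁, fun a b c e => ?_⟩
  -- unless the indices agree in pairs, one of them occurs an odd number of times: change its sign
  by_cases hab : a = b
  · subst hab
    by_cases hce : c = e
    · subst hce
      by_cases hac : a = c
      · subst hac
        rw [hγ]; simp; ring
      · rw [hα hac]; simp [hac]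
    · rw [rowProjMoment_eq_zero (if a = c then Pi.mulSingle e (-1) else Pi.mulSingle c (-1))]
      · by_cases hac : a = c
        · subst hac; simp [hce]
        · simp [hce, hac]
      · by_cases hac : a = c
        · subst hac; simp [hce]
        · have hca := Ne.symm hac
          have hec := Ne.symm hce
          simp [hac, hec]
  · have hba := Ne.symm hab
    by_cases hac : a = c
    · subst hac
      by_cases hbe : b = e
      · subst hbe
        rw [hβ hab]; simp [hab, hba]
      · rw [rowProjMoment_eq_zero (Pi.mulSingle b (-1))]
        · simp [hab, hba, hbe]
        · simp [hab, Ne.symm hbe]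
    · by_cases hae : a = e
      · subst hae
        by_cases hbc : b = c
        · subst hbc
          rw [rowProjMoment_comm_right, hβ hab]; simp [hab, hba]
        · rw [rowProjMoment_eq_zero (Pi.mulSingle b (-1))]
          · simp [hab, hbc, hac]
          · simp [hab, Ne.symm hbc]
      · rw [rowProjMoment_eq_zero (Pi.mulSingle a (-1))]
        · simp [hab, hac, hae]
        · simp [hba, Ne.symm hac, Ne.symm hae]

theorem sum_rowProjMoment_trace (h : n < d) :
    ∑ a : Fin d, ∑ c : Fin d, rowProjMoment n a a c c = (n : ℝ) ^ 2 := by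
  unfold rowProjMoment
  simp_rw [← integral_finsetSum _ fun c _ => integrable_rowProj_mul _ _ c c]
  rw [← integral_finsetSum _ fun a _ => integrable_finsetSum _ fun c _ =>
    integrable_rowProj_mul a a c c]
  have h1 : ∀ᵐ x ∂gaussianDesign n d, ∑ a, ∑ c, rowProj (rowStack x) a a *
      rowProj (rowStack x) c c = (n : ℝ) ^ 2 := by
    filter_upwards [ae_fullRank_gaussianDesign n d] with x hx
    rw [← Finset.sum_mul_sum, ← trace_rowProj hx h, sq]
    rfl
  rw [integral_congr_ae h1]
  simp

theorem sum_rowProjMoment_frob (h : n < d) :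
    ∑ a : Fin d, ∑ c : Fin d, rowProjMoment n a c a c = n := by
  unfold rowProjMoment
  simp_rw [← integral_finsetSum _ fun c _ => integrable_rowProj_mul _ c _ c]
  rw [← integral_finsetSum _ fun a _ => integrable_finsetSum _ fun c _ =>
    integrable_rowProj_mul a c a c]
  have h1 : ∀ᵐ x ∂gaussianDesign n d, ∑ a, ∑ c, rowProj (rowStack x) a c *
      rowProj (rowStack x) a c = (n : ℝ) := by
    filter_upwards [ae_fullRank_gaussianDesign n d] with x hx
    rw [← trace_rowProj hx h, ← rowProj_mul_self hx, trace]
    refine Finset.sum_congr rfl fun a _ => ?_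
    rw [diag_apply, rowProj_mul_self hx, ← rowProj_mul_self hx, mul_apply, rowProj_mul_self hx]
    refine Finset.sum_congr rfl fun c _ => ?_
    congr 1
    exact congrFun₂ (transpose_rowProj hx) c a
  rw [integral_congr_ae h1]
  simp

/-- The quadratic form `‖W‖² - ∑ T a c b e W a b W c e` on matrices. With the tensor of the
intertwining average `Ψ` it is `‖W‖² - ‖Ψ(W)‖²`; with the zero tensor it is `‖W‖²`. -/
def tensorForm (T : Fin d → Fin d → Fin k → Fin k → ℝ) (W : Matrix (Fin d) (Fin k) ℝ) : ℝ :=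
  frobSq W - ∑ a, ∑ c, ∑ b, ∑ e, T a c b e * (W a b * W c e)

theorem integral_sum_sum {α ι κ : Type*} [Fintype ι] [Fintype κ] [MeasurableSpace α]
    {μ : Measure α} {f : ι → κ → α → ℝ} (hf : ∀ i j, Integrable (f i j) μ) :
    ∫ x, ∑ i, ∑ j, f i j x ∂μ = ∑ i, ∑ j, ∫ x, f i j x ∂μ := by
  rw [integral_finsetSum _ fun i _ => integrable_finsetSum _ fun j _ => hf i j]
  exact Finset.sum_congr rfl fun i _ => integral_finsetSum _ fun j _ => hf i j

theorem integrable_tensorForm {α : Type*} [MeasurableSpace α] {μ : Measure α}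
    {w : α → Matrix (Fin d) (Fin k) ℝ}
    (hw : ∀ a c b e, Integrable (fun x => w x a b * w x c e) μ)
    (T : Fin d → Fin d → Fin k → Fin k → ℝ) : Integrable (fun x => tensorForm T (w x)) μ := by
  unfold tensorForm
  simp_rw [frobSq_eq_sum, sq]
  exact (integrable_finsetSum _ fun a _ => integrable_finsetSum _ fun b _ => hw a a b b).sub
    (integrable_finsetSum _ fun a _ => integrable_finsetSum _ fun c _ =>
      integrable_finsetSum _ fun b _ => integrable_finsetSum _ fun e _ => (hw a c b e).const_mul _)

theorem integral_tensorForm {α : Type*} [MeasurableSpace α] {μ : Measure α}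
    {w : α → Matrix (Fin d) (Fin k) ℝ}
    (hw : ∀ a c b e, Integrable (fun x => w x a b * w x c e) μ)
    (T : Fin d → Fin d → Fin k → Fin k → ℝ) :
    ∫ x, tensorForm T (w x) ∂μ = ∑ a, ∑ b, ∫ x, w x a b * w x a b ∂μ -
      ∑ a, ∑ c, ∑ b, ∑ e, T a c b e * ∫ x, w x a b * w x c e ∂μ := by
  unfold tensorForm
  simp_rw [frobSq_eq_sum, sq]
  rw [integral_sub (integrable_finsetSum _ fun a _ => integrable_finsetSum _ fun b _ => hw a a b b)
    (integrable_finsetSum _ fun a _ => integrable_finsetSum _ fun c _ =>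
      integrable_finsetSum _ fun b _ => integrable_finsetSum _ fun e _ => (hw a c b e).const_mul _),
    integral_sum_sum fun a b => hw a a b b, integral_sum_sum fun a c =>
    integrable_finsetSum _ fun b _ => integrable_finsetSum _ fun e _ =>
      (hw a c b e).const_mul (T a c b e)]
  simp_rw [fun a c => integral_sum_sum (μ := μ) fun b e => (hw a c b e).const_mul (T a c b e),
    integral_const_mul]

theorem integrable_rowProj_mul_mul (Θ : Matrix (Fin d) (Fin k) ℝ) (a c : Fin d) (b e : Fin k) :
    Integrable (fun x : Fin n → EuclideanSpace ℝ (Fin d) =>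
      (rowProj (rowStack x) * Θ) a b * (rowProj (rowStack x) * Θ) c e) (gaussianDesign n d) := by
  simp_rw [mul_apply, Finset.sum_mul_sum]
  refine integrable_finsetSum _ fun i _ => integrable_finsetSum _ fun j _ => ?_
  refine ((integrable_rowProj_mul a i c j).mul_const (Θ i b * Θ j e)).congr
    (ae_of_all _ fun x => ?_)
  ring

/-- The second moments of the projected target, for a moment tensor of isotropic form. -/
theorem integral_rowProj_mul_mul {α β : ℝ}
    (hm : ∀ a b c e : Fin d, rowProjMoment n a b c e =
      α * ((if a = b then 1 else 0) * if c = e then 1 else 0) +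
        β * ((if a = c then 1 else 0) * (if b = e then 1 else 0) +
          (if a = e then 1 else 0) * if b = c then 1 else 0))
    (Θ : Matrix (Fin d) (Fin k) ℝ) (a c : Fin d) (b e : Fin k) :
    ∫ x, (rowProj (rowStack x) * Θ) a b * (rowProj (rowStack x) * Θ) c e ∂gaussianDesign n d =
      α * (Θ a b * Θ c e) + β * ((if a = c then (Θᵀ * Θ) b e else 0) + Θ c b * Θ a e) := by
  simp_rw [mul_apply, Finset.sum_mul_sum]
  have hterm : ∀ (x : Fin n → EuclideanSpace ℝ (Fin d)) (i j : Fin d),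
      rowProj (rowStack x) a i * Θ i b * (rowProj (rowStack x) c j * Θ j e) =
      rowProj (rowStack x) a i * rowProj (rowStack x) c j * (Θ i b * Θ j e) := fun x i j => by ring
  simp_rw [hterm]
  rw [integral_finsetSum _ fun i _ => integrable_finsetSum _ fun j _ =>
    (integrable_rowProj_mul a i c j).mul_const _]
  simp_rw [fun i => integral_finsetSum (μ := gaussianDesign n d) Finset.univ fun j _ =>
    (integrable_rowProj_mul (n := n) a i c j).mul_const (Θ i b * Θ j e), integral_mul_const]
  have hm' : ∀ i j, ∫ x, rowProj (rowStack x) a i * rowProj (rowStack x) c j ∂gaussianDesign n d =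
      rowProjMoment n a i c j := fun i j => rfl
  simp_rw [hm', hm, add_mul, mul_add, add_mul, Finset.sum_add_distrib,
    mul_assoc, ← Finset.mul_sum]
  congr 1
  · simp
  · congr 1
    · split_ifs with hac <;> simp
    · simp

/-- The mean of the form on the projection of an invariant target onto the random row space. -/
theorem integral_tensorForm_rowProj (hnd : n + 1 < d) (T : Fin d → Fin d → Fin k → Fin k → ℝ)
    (Θ : Matrix (Fin d) (Fin k) ℝ) (hΘ : tensorForm T Θ = 0) :
    ∫ x, tensorForm T (rowProj (rowStack x) * Θ) ∂gaussianDesign n d =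
      ((n : ℝ) * ((d : ℝ) - n)) / ((d : ℝ) * ((d : ℝ) - 1) * ((d : ℝ) + 2)) *
        (((d : ℝ) + 1) * frobSq Θ - (∑ a, ∑ b, ∑ e, T a a b e * (Θᵀ * Θ) b e +
          ∑ a, ∑ c, ∑ b, ∑ e, T a c b e * (Θ c b * Θ a e))) := by
  obtain ⟨α, β, hm⟩ := exists_rowProjMoment_eq (d := d) n (by omega)
  have hd : (1 : ℝ) < d := by exact_mod_cast (by omega : 1 < d)
  -- the two contractions of the moment tensor determine its coefficients; only `β` survives, since
  -- `α` multiplies the value of the form at `Θ`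
  have h1 : α * d ^ 2 + 2 * β * d = (n : ℝ) ^ 2 := by
    rw [← sum_rowProjMoment_trace (by omega : n < d)]
    simp_rw [hm]
    simp [Finset.sum_add_distrib, ← Finset.mul_sum]
    ring
  have h2 : α * d + β * (d ^ 2 + d) = n := by
    rw [← sum_rowProjMoment_frob (by omega : n < d)]
    simp_rw [hm]
    simp [Finset.sum_add_distrib, ← Finset.mul_sum]
    ring
  have hβ : β = ((n : ℝ) * ((d : ℝ) - n)) / ((d : ℝ) * ((d : ℝ) - 1) * ((d : ℝ) + 2)) := by
    rw [eq_div_iff (by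
      have : (0 : ℝ) < d * (d - 1) * (d + 2) := by
        have : (0 : ℝ) < d - 1 := by linarith
        positivity
      exact this.ne')]
    linear_combination (d : ℝ) * h2 - h1
  have hsum : ∑ a, ∑ b, ((Θᵀ * Θ) b b + Θ a b * Θ a b) =
      ((d : ℝ) + 1) * frobSq Θ := by
    simp_rw [Finset.sum_add_distrib]
    rw [frobSq_eq_sum]
    simp_rw [← sq]
    rw [Finset.sum_const, ← frobSq_eq_sum, Finset.card_univ, Fintype.card_fin, nsmul_eq_mul,
      frobSq, trace]
    simp only [diag_apply]
    ring
  have hT : ∑ a, ∑ c, ∑ b, ∑ e, T a c b e * ((if a = c then (Θᵀ * Θ) b e else 0) +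
      Θ c b * Θ a e) = ∑ a, ∑ b, ∑ e, T a a b e * (Θᵀ * Θ) b e +
          ∑ a, ∑ c, ∑ b, ∑ e, T a c b e * (Θ c b * Θ a e) := by
    simp_rw [mul_add, Finset.sum_add_distrib]
    congr 1
    refine Finset.sum_congr rfl fun a _ => ?_
    rw [Finset.sum_eq_single a]
    · simp
    · intro c _ hc
      simp [Ne.symm hc]
    · simp
  have hΘ' : ∑ a, ∑ c, ∑ b, ∑ e, T a c b e * (Θ a b * Θ c e) = frobSq Θ := by
    unfold tensorForm at hΘ; linarith
  rw [integral_tensorForm fun a c b e => integrable_rowProj_mul_mul Θ a c b e]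
  simp_rw [integral_rowProj_mul_mul hm, if_true]
  have e1 : ∑ a, ∑ b, (α * (Θ a b * Θ a b) +
      β * ((Θᵀ * Θ) b b + Θ a b * Θ a b)) =
      α * frobSq Θ + β * (((d : ℝ) + 1) * frobSq Θ) := by
    rw [← hsum, frobSq_eq_sum]
    simp_rw [sq, Finset.sum_add_distrib, mul_add, Finset.mul_sum, Finset.sum_add_distrib]
  have e2 : ∑ a, ∑ c, ∑ b, ∑ e, T a c b e * (α * (Θ a b * Θ c e) +
      β * ((if a = c then (Θᵀ * Θ) b e else 0) + Θ c b * Θ a e)) =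
      α * frobSq Θ + β * (∑ a, ∑ b, ∑ e, T a a b e * (Θᵀ * Θ) b e +
          ∑ a, ∑ c, ∑ b, ∑ e, T a c b e * (Θ c b * Θ a e)) := by
    rw [← hT, ← hΘ']
    simp_rw [Finset.mul_sum, ← Finset.sum_add_distrib]
    refine Finset.sum_congr rfl fun a _ => Finset.sum_congr rfl fun c _ =>
      Finset.sum_congr rfl fun b _ => Finset.sum_congr rfl fun e _ => ?_
    ring
  rw [e1, e2, ← hβ]
  ring

end RowSpaceMoments

/-! ### The intertwining average as a quadratic form -/

section Intertwining

open Matrix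

variable {G : Type*} [Group G] {d k : ℕ}

/-- The action `W ↦ φ(g) W ψ(g⁻¹)` on matrices; its fixed points are the matrices `W` with
equivariant `f_W`. -/
def repAct (φ : G →* orthogonalGroup (Fin d) ℝ) (ψ : G →* orthogonalGroup (Fin k) ℝ) (g : G)
    (W : Matrix (Fin d) (Fin k) ℝ) : Matrix (Fin d) (Fin k) ℝ :=
  (φ g : Matrix (Fin d) (Fin d) ℝ) * W * (ψ g⁻¹ : Matrix (Fin k) (Fin k) ℝ)

/-- The tensor `∫ φ(g) a c · ψ(g) b e dλ(g)`, the matrix of the intertwining average. -/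
noncomputable def repTensor [MeasurableSpace G] (lam : Measure G)
    (φ : G →* orthogonalGroup (Fin d) ℝ) (ψ : G →* orthogonalGroup (Fin k) ℝ)
    (a c : Fin d) (b e : Fin k) : ℝ :=
  ∫ g, (φ g : Matrix (Fin d) (Fin d) ℝ) a c * (ψ g : Matrix (Fin k) (Fin k) ℝ) b e ∂lam

theorem coe_inv_eq_transpose {m : ℕ} (φ : G →* orthogonalGroup (Fin m) ℝ) (g : G) :
    (φ g⁻¹ : Matrix (Fin m) (Fin m) ℝ) = (φ g : Matrix (Fin m) (Fin m) ℝ)ᵀ := by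
  rw [map_inv, UnitaryGroup.inv_val]
  rfl

theorem transpose_mul_self_rep {m : ℕ} (φ : G →* orthogonalGroup (Fin m) ℝ) (g : G) :
    (φ g : Matrix (Fin m) (Fin m) ℝ)ᵀ * (φ g : Matrix (Fin m) (Fin m) ℝ) = 1 :=
  UnitaryGroup.star_mul_self (φ g)

theorem mul_transpose_self_rep {m : ℕ} (φ : G →* orthogonalGroup (Fin m) ℝ) (g : G) :
    (φ g : Matrix (Fin m) (Fin m) ℝ) * (φ g : Matrix (Fin m) (Fin m) ℝ)ᵀ = 1 :=
  mul_eq_one_comm.1 (transpose_mul_self_rep φ g)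

variable (φ : G →* orthogonalGroup (Fin d) ℝ) (ψ : G →* orthogonalGroup (Fin k) ℝ)

theorem repAct_apply (g : G) (W : Matrix (Fin d) (Fin k) ℝ) (a : Fin d) (b : Fin k) :
    repAct φ ψ g W a b = ∑ c, ∑ e, (φ g : Matrix (Fin d) (Fin d) ℝ) a c *
      (ψ g : Matrix (Fin k) (Fin k) ℝ) b e * W c e := by
  rw [repAct, coe_inv_eq_transpose, mul_apply]
  simp_rw [mul_apply, Finset.sum_mul]
  rw [Finset.sum_comm]
  refine Finset.sum_congr rfl fun c _ => Finset.sum_congr rfl fun e _ => ?_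
  rw [transpose_apply]
  ring

theorem repAct_mul (g h : G) (W : Matrix (Fin d) (Fin k) ℝ) :
    repAct φ ψ (g * h) W = repAct φ ψ g (repAct φ ψ h W) := by
  simp [repAct, Matrix.mul_assoc]

theorem trace_repAct_repAct (g : G) (V W : Matrix (Fin d) (Fin k) ℝ) :
    ((repAct φ ψ g V)ᵀ * repAct φ ψ g W).trace = (Vᵀ * W).trace := by
  rw [repAct, repAct, coe_inv_eq_transpose, transpose_mul, transpose_mul, transpose_transpose,
    show (ψ g : Matrix (Fin k) (Fin k) ℝ) * (Vᵀ * (φ g : Matrix (Fin d) (Fin d) ℝ)ᵀ) *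
      ((φ g : Matrix (Fin d) (Fin d) ℝ) * W * (ψ g : Matrix (Fin k) (Fin k) ℝ)ᵀ) =
      (ψ g : Matrix (Fin k) (Fin k) ℝ) * (Vᵀ * ((φ g : Matrix (Fin d) (Fin d) ℝ)ᵀ *
        (φ g : Matrix (Fin d) (Fin d) ℝ)) * W * (ψ g : Matrix (Fin k) (Fin k) ℝ)ᵀ) by
      simp only [Matrix.mul_assoc], transpose_mul_self_rep, trace_mul_comm, Matrix.mul_assoc,
    transpose_mul_self_rep]
  simp

theorem trace_repAct_inv (g h : G) (V W : Matrix (Fin d) (Fin k) ℝ) :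
    ((repAct φ ψ h V)ᵀ * repAct φ ψ g W).trace = (Vᵀ * repAct φ ψ (h⁻¹ * g) W).trace := by
  rw [← trace_repAct_repAct φ ψ h V, ← repAct_mul, mul_inv_cancel_left]

/-- Equivariance of `f_W` is invariance of `W` under the action on matrices. -/
theorem isEquivariant_linPred_iff (W : Matrix (Fin d) (Fin k) ℝ) :
    IsEquivariant φ ψ (linPred W) ↔ ∀ g, repAct φ ψ g W = W := by
  have h1 : IsEquivariant φ ψ (linPred W) ↔ ∀ g, Wᵀ * (φ g : Matrix (Fin d) (Fin d) ℝ) =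
      (ψ g : Matrix (Fin k) (Fin k) ℝ) * Wᵀ := by
    refine forall_congr' fun g => ?_
    rw [← (toEuclideanLin (𝕜 := ℝ) (m := Fin k) (n := Fin d)).injective.eq_iff, LinearMap.ext_iff]
    refine forall_congr' fun x => ?_
    simp [linPred, toLpLin_apply, mulVec_mulVec]
  rw [h1]
  refine forall_congr' fun g => ?_
  rw [repAct, coe_inv_eq_transpose]
  constructor
  · intro h
    have h2 := congrArg transpose h
    rw [transpose_mul, transpose_mul, transpose_transpose] at h2
    have h3 : (φ g : Matrix (Fin d) (Fin d) ℝ) * W = W * (ψ g : Matrix (Fin k) (Fin k) ℝ) := by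
      calc (φ g : Matrix (Fin d) (Fin d) ℝ) * W
          = (φ g : Matrix (Fin d) (Fin d) ℝ) * (W * (ψ g : Matrix (Fin k) (Fin k) ℝ)ᵀ) *
            (ψ g : Matrix (Fin k) (Fin k) ℝ) := by
            rw [Matrix.mul_assoc, Matrix.mul_assoc, transpose_mul_self_rep, Matrix.mul_one]
        _ = W * (ψ g : Matrix (Fin k) (Fin k) ℝ) := by
            rw [← h2, ← Matrix.mul_assoc, mul_transpose_self_rep, Matrix.one_mul]
    rw [h3, Matrix.mul_assoc, mul_transpose_self_rep, Matrix.mul_one]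
  · intro h
    have h2 := congrArg transpose h
    rw [transpose_mul, transpose_mul, transpose_transpose] at h2
    conv_lhs => rw [← h2]
    rw [Matrix.mul_assoc, Matrix.mul_assoc, transpose_mul_self_rep, Matrix.mul_one]

theorem repAct_eq_self_mul {Θ : Matrix (Fin d) (Fin k) ℝ} {g : G} (h : repAct φ ψ g Θ = Θ) :
    (φ g : Matrix (Fin d) (Fin d) ℝ) * Θ = Θ * (ψ g : Matrix (Fin k) (Fin k) ℝ) := by
  conv_rhs => rw [← h, repAct, coe_inv_eq_transpose, Matrix.mul_assoc, transpose_mul_self_rep,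
    Matrix.mul_one]

theorem abs_rep_apply_le_one {m : ℕ} (φ : G →* orthogonalGroup (Fin m) ℝ) (g : G) (a b : Fin m) :
    |(φ g : Matrix (Fin m) (Fin m) ℝ) a b| ≤ 1 := by
  simpa using entry_norm_bound_of_unitary (𝕜 := ℝ) (φ g).2 a b

theorem frobSq_sub_repAct (g : G) (W : Matrix (Fin d) (Fin k) ℝ) :
    frobSq (W - repAct φ ψ g W) = 2 * (frobSq W - (Wᵀ * repAct φ ψ g W).trace) := by
  have h1 : frobSq (-repAct φ ψ g W) = frobSq W := by
    rw [frobSq, frobSq, transpose_neg, Matrix.neg_mul, Matrix.mul_neg, neg_neg, trace_repAct_repAct]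
  rw [sub_eq_add_neg, frobSq_add, h1, Matrix.mul_neg, trace_neg]
  ring

theorem trace_transpose_mul (V W : Matrix (Fin d) (Fin k) ℝ) :
    (Vᵀ * W).trace = ∑ a, ∑ b, V a b * W a b := by
  rw [Finset.sum_comm]
  simp [trace, mul_apply]

variable [MeasurableSpace G] {lam : Measure G}

theorem measurable_rep_apply {m : ℕ} {φ : G →* orthogonalGroup (Fin m) ℝ}
    (hφ : IsMeasurableRep φ) (a b : Fin m) :
    Measurable fun g => (φ g : Matrix (Fin m) (Fin m) ℝ) a b := by
  unfold IsMeasurableRep at hφ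
  have h0 := hφ.comp (measurable_prodMk_right (y := EuclideanSpace.single b (1 : ℝ)))
  simp only [Function.comp_def] at h0
  have h1 := (measurable_pi_apply a).comp ((WithLp.measurable_ofLp 2 (Fin m → ℝ)).comp h0)
  simp only [Function.comp_def] at h1
  simpa [toLpLin_apply] using h1

variable {φ ψ} [IsProbabilityMeasure lam]

theorem integrable_rep_mul (hφ : IsMeasurableRep φ) (hψ : IsMeasurableRep ψ) (a c : Fin d)
    (b e : Fin k) : Integrable (fun g => (φ g : Matrix (Fin d) (Fin d) ℝ) a c *
      (ψ g : Matrix (Fin k) (Fin k) ℝ) b e) lam := by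
  refine Integrable.of_bound ((measurable_rep_apply hφ a c).mul
    (measurable_rep_apply hψ b e)).aestronglyMeasurable 1 (ae_of_all _ fun g => ?_)
  rw [Real.norm_eq_abs, abs_mul]
  exact mul_le_one₀ (abs_rep_apply_le_one φ g a c) (abs_nonneg _) (abs_rep_apply_le_one ψ g b e)

theorem integrable_repAct_apply (hφ : IsMeasurableRep φ) (hψ : IsMeasurableRep ψ)
    (W : Matrix (Fin d) (Fin k) ℝ) (a : Fin d) (b : Fin k) :
    Integrable (fun g => repAct φ ψ g W a b) lam := by
  simp_rw [repAct_apply]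
  exact integrable_finsetSum _ fun c _ => integrable_finsetSum _ fun e _ =>
    (integrable_rep_mul hφ hψ a c b e).mul_const _

theorem integrable_trace_mul_repAct (hφ : IsMeasurableRep φ) (hψ : IsMeasurableRep ψ)
    (V W : Matrix (Fin d) (Fin k) ℝ) :
    Integrable (fun g => (Vᵀ * repAct φ ψ g W).trace) lam := by
  simp_rw [trace_transpose_mul]
  exact integrable_finsetSum _ fun a _ => integrable_finsetSum _ fun b _ =>
    (integrable_repAct_apply hφ hψ W a b).const_mul _

theorem trace_mul_intertwine (hφ : IsMeasurableRep φ) (hψ : IsMeasurableRep ψ)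
    (V W : Matrix (Fin d) (Fin k) ℝ) :
    (Vᵀ * intertwine lam φ ψ W).trace = ∫ g, (Vᵀ * repAct φ ψ g W).trace ∂lam := by
  simp_rw [trace_transpose_mul]
  rw [integral_sum_sum fun a b => (integrable_repAct_apply hφ hψ W a b).const_mul (V a b)]
  simp_rw [integral_const_mul]
  rfl

theorem tensorForm_repTensor (hφ : IsMeasurableRep φ) (hψ : IsMeasurableRep ψ)
    (W : Matrix (Fin d) (Fin k) ℝ) : tensorForm (repTensor lam φ ψ) W =
      frobSq W - ∫ g, (Wᵀ * repAct φ ψ g W).trace ∂lam := by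
  rw [tensorForm, ← trace_mul_intertwine hφ hψ, trace_transpose_mul]
  congr 1
  have h : ∀ a b, intertwine lam φ ψ W a b = ∑ c, ∑ e, repTensor lam φ ψ a c b e * W c e :=
      fun a b => by
    have h1 : intertwine lam φ ψ W a b = ∫ g, repAct φ ψ g W a b ∂lam := rfl
    rw [h1]
    simp_rw [repAct_apply]
    rw [integral_sum_sum fun c e => (integrable_rep_mul hφ hψ a c b e).mul_const (W c e)]
    simp_rw [integral_mul_const]
    rfl
  simp_rw [h, Finset.mul_sum]
  refine Finset.sum_congr rfl fun a _ => ?_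
  rw [Finset.sum_comm]
  refine Finset.sum_congr rfl fun c _ => Finset.sum_congr rfl fun b _ =>
    Finset.sum_congr rfl fun e _ => ?_
  ring

/-- The form measures the mean squared displacement of `W` under the group; this makes its
nonnegativity and its zeros visible. -/
theorem tensorForm_repTensor_eq_integral (hφ : IsMeasurableRep φ) (hψ : IsMeasurableRep ψ)
    (W : Matrix (Fin d) (Fin k) ℝ) : tensorForm (repTensor lam φ ψ) W =
      (1 / 2) * ∫ g, frobSq (W - repAct φ ψ g W) ∂lam := by
  simp_rw [frobSq_sub_repAct]
  rw [integral_const_mul, integral_sub (integrable_const _)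
    (integrable_trace_mul_repAct hφ hψ W W), tensorForm_repTensor hφ hψ]
  simp

theorem tensorForm_repTensor_nonneg (hφ : IsMeasurableRep φ) (hψ : IsMeasurableRep ψ)
    (W : Matrix (Fin d) (Fin k) ℝ) : 0 ≤ tensorForm (repTensor lam φ ψ) W := by
  rw [tensorForm_repTensor_eq_integral hφ hψ]
  have : 0 ≤ ∫ g, frobSq (W - repAct φ ψ g W) ∂lam := integral_nonneg fun g => frobSq_nonneg _
  positivity

theorem tensorForm_eq_zero_of_fixed (hφ : IsMeasurableRep φ) (hψ : IsMeasurableRep ψ)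
    {W : Matrix (Fin d) (Fin k) ℝ} (hW : ∀ g, repAct φ ψ g W = W) :
    tensorForm (repTensor lam φ ψ) W = 0 := by
  rw [tensorForm_repTensor_eq_integral hφ hψ]
  simp [hW, frobSq]

/-- The average is idempotent and self-adjoint, by invariance of the measure. -/
theorem frobSq_intertwine [MeasurableMul G] [lam.IsMulLeftInvariant] (hφ : IsMeasurableRep φ)
    (hψ : IsMeasurableRep ψ) (W : Matrix (Fin d) (Fin k) ℝ) :
    frobSq (intertwine lam φ ψ W) = ∫ g, (Wᵀ * repAct φ ψ g W).trace ∂lam := by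
  rw [frobSq, trace_mul_intertwine hφ hψ]
  have h : ∀ g, ((intertwine lam φ ψ W)ᵀ * repAct φ ψ g W).trace =
      ∫ h, (Wᵀ * repAct φ ψ h W).trace ∂lam := fun g => by
    rw [← trace_transpose, transpose_mul, transpose_transpose, trace_mul_intertwine hφ hψ]
    simp_rw [trace_repAct_inv]
    exact integral_mul_left_eq_self (fun h => (Wᵀ * repAct φ ψ h W).trace) g⁻¹
  simp [h]

/-- Averaging over the group lowers the squared distance to a fixed point by the value of the
quadratic form, since the average is the orthogonal projection onto the fixed points. -/
theorem frobSq_sub_sub_frobSq_intertwine_sub [MeasurableMul G] [lam.IsMulLeftInvariant]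
    (hφ : IsMeasurableRep φ) (hψ : IsMeasurableRep ψ) {Θ : Matrix (Fin d) (Fin k) ℝ}
    (hΘ : ∀ g, repAct φ ψ g Θ = Θ) (W : Matrix (Fin d) (Fin k) ℝ) :
    frobSq (W - Θ) - frobSq (intertwine lam φ ψ W - Θ) = tensorForm (repTensor lam φ ψ) W := by
  have h1 : (Θᵀ * intertwine lam φ ψ W).trace = (Θᵀ * W).trace := by
    rw [trace_mul_intertwine hφ hψ]
    have h2 : ∀ g, (Θᵀ * repAct φ ψ g W).trace = (Θᵀ * W).trace := fun g => by
      conv_lhs => rw [← hΘ g]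
      exact trace_repAct_repAct φ ψ g Θ W
    simp [h2]
  have h3 : ∀ V : Matrix (Fin d) (Fin k) ℝ,
      frobSq (V - Θ) = frobSq V + frobSq Θ - 2 * (Θᵀ * V).trace := fun V => by
    rw [show V - Θ = -Θ + V by abel, frobSq_add, transpose_neg, Matrix.neg_mul, trace_neg,
      show frobSq (-Θ) = frobSq Θ by simp [frobSq]]
    ring
  rw [h3, h3, h1, frobSq_intertwine hφ hψ, tensorForm_repTensor hφ hψ]
  ring

theorem codim_eq_sum (hφ : IsMeasurableRep φ) (hψ : IsMeasurableRep ψ) :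
    codim lam φ ψ = (d : ℝ) * k - ∑ a, ∑ b, repTensor lam φ ψ a a b b := by
  rw [codim, charInner]
  congr 1
  have h : ∀ g, character ψ g * character φ g = ∑ a, ∑ b,
      (φ g : Matrix (Fin d) (Fin d) ℝ) a a * (ψ g : Matrix (Fin k) (Fin k) ℝ) b b := fun g => by
    rw [mul_comm, ← Finset.sum_mul_sum]
    rfl
  simp_rw [h]
  rw [integral_sum_sum fun a b => integrable_rep_mul hφ hψ a a b b]
  rfl

/-- Contracting the tensor with an invariant target produces the matrix `J`. -/
theorem trace_JMatrix_mul (hφ : IsMeasurableRep φ) (hψ : IsMeasurableRep ψ)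
    {Θ : Matrix (Fin d) (Fin k) ℝ} (hΘ : ∀ g, repAct φ ψ g Θ = Θ) :
    (JMatrix lam φ ψ * (Θᵀ * Θ)).trace =
      ∑ a, ∑ b, ∑ e, repTensor lam φ ψ a a b e * (Θᵀ * Θ) b e +
        ∑ a, ∑ c, ∑ b, ∑ e, repTensor lam φ ψ a c b e * (Θ c b * Θ a e) := by
  have hi := fun (a c : Fin d) (b e : Fin k) => integrable_rep_mul (lam := lam) hφ hψ a c b e
  have hψ2 : ∀ (a b : Fin k), Integrable
      (fun g => (ψ (g ^ 2) : Matrix (Fin k) (Fin k) ℝ) a b) lam := fun a b => by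
    have h1 : ∀ g, (ψ (g ^ 2) : Matrix (Fin k) (Fin k) ℝ) a b =
        ∑ c, (ψ g : Matrix (Fin k) (Fin k) ℝ) a c * (ψ g : Matrix (Fin k) (Fin k) ℝ) c b :=
      fun g => by
        rw [sq, map_mul, UnitaryGroup.mul_val, mul_apply]
    simp_rw [h1]
    exact integrable_finsetSum _ fun c _ => integrable_rep_mul hψ hψ a c c b
  have hχψ : ∀ (a b : Fin k), Integrable
      (fun g => character φ g * (ψ g : Matrix (Fin k) (Fin k) ℝ) a b) lam := fun a b => by
    simp_rw [character, trace, Finset.sum_mul]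
    exact integrable_finsetSum _ fun c _ => hi c c a b
  have hJ : (JMatrix lam φ ψ * (Θᵀ * Θ)).trace =
      ∫ g, ∑ b, ∑ e, (character φ g * (ψ g : Matrix (Fin k) (Fin k) ℝ) b e +
        (ψ (g ^ 2) : Matrix (Fin k) (Fin k) ℝ) b e) * (Θᵀ * Θ) e b ∂lam := by
    rw [integral_sum_sum fun b e => ((hχψ b e).fun_add (hψ2 b e)).mul_const ((Θᵀ * Θ) e b)]
    simp_rw [integral_mul_const]
    simp only [trace, diag_apply, mul_apply (N := Θᵀ * Θ)]
    rfl
  have h1 : ∑ a, ∑ b, ∑ e, repTensor lam φ ψ a a b e * (Θᵀ * Θ) b e =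
      ∫ g, ∑ a, ∑ b, ∑ e, (φ g : Matrix (Fin d) (Fin d) ℝ) a a *
        (ψ g : Matrix (Fin k) (Fin k) ℝ) b e * (Θᵀ * Θ) b e ∂lam := by
    rw [integral_finsetSum _ fun a _ => integrable_finsetSum _ fun b _ =>
      integrable_finsetSum _ fun e _ => (hi a a b e).mul_const ((Θᵀ * Θ) b e)]
    refine Finset.sum_congr rfl fun a _ => ?_
    rw [integral_sum_sum fun b e => (hi a a b e).mul_const ((Θᵀ * Θ) b e)]
    simp_rw [integral_mul_const]
    rfl
  have h2 : ∑ a, ∑ c, ∑ b, ∑ e, repTensor lam φ ψ a c b e * (Θ c b * Θ a e) =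
      ∫ g, ∑ a, ∑ c, ∑ b, ∑ e, (φ g : Matrix (Fin d) (Fin d) ℝ) a c *
        (ψ g : Matrix (Fin k) (Fin k) ℝ) b e * (Θ c b * Θ a e) ∂lam := by
    rw [integral_sum_sum fun a c => integrable_finsetSum _ fun b _ =>
      integrable_finsetSum _ fun e _ => (hi a c b e).mul_const (Θ c b * Θ a e)]
    refine Finset.sum_congr rfl fun a _ => Finset.sum_congr rfl fun c _ => ?_
    rw [integral_sum_sum fun b e => (hi a c b e).mul_const (Θ c b * Θ a e)]
    simp_rw [integral_mul_const]
    rfl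
  rw [hJ, h1, h2, ← integral_add]
  · refine integral_congr_ae (ae_of_all _ fun g => ?_)
    have hsymm : ∀ b e, (Θᵀ * Θ) e b = (Θᵀ * Θ) b e := fun b e => by
      simp [mul_apply, mul_comm]
    simp only [add_mul, Finset.sum_add_distrib]
    congr 1
    · simp_rw [character, trace, diag_apply, Finset.sum_mul, hsymm]
      symm
      rw [Finset.sum_comm]
      exact Finset.sum_congr rfl fun b _ => Finset.sum_comm
    · have h3 : ∑ b, ∑ e, (ψ (g ^ 2) : Matrix (Fin k) (Fin k) ℝ) b e * (Θᵀ * Θ) e b =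
          (Θᵀ * (Θ * (ψ g : Matrix (Fin k) (Fin k) ℝ) *
            (ψ g : Matrix (Fin k) (Fin k) ℝ))).trace := by
        rw [Matrix.mul_assoc, ← Matrix.mul_assoc, trace_mul_comm, sq, map_mul,
          UnitaryGroup.mul_val]
        simp only [trace, diag_apply, mul_apply (N := Θᵀ * Θ)]
      rw [h3, ← repAct_eq_self_mul φ ψ (hΘ g), trace_transpose_mul]
      simp only [mul_apply, Finset.sum_mul, Finset.mul_sum]
      refine Finset.sum_congr rfl fun a _ => ?_
      rw [Finset.sum_comm]
      symm
      rw [Finset.sum_comm]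
      refine Finset.sum_congr rfl fun b _ => ?_
      rw [Finset.sum_comm]
      refine Finset.sum_congr rfl fun e _ => Finset.sum_congr rfl fun c _ => ?_
      ring
  · exact integrable_finsetSum _ fun a _ => integrable_finsetSum _ fun b _ =>
      integrable_finsetSum _ fun e _ => (hi a a b e).mul_const _
  · exact integrable_finsetSum _ fun a _ => integrable_finsetSum _ fun c _ =>
      integrable_finsetSum _ fun b _ => integrable_finsetSum _ fun e _ => (hi a c b e).mul_const _

/-- A matrix fixed by almost every group element is fixed by all, because the stabiliser is a
subgroup of full measure. -/
theorem repAct_eq_self_of_ae [MeasurableMul G] [lam.IsMulLeftInvariant]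
    {W : Matrix (Fin d) (Fin k) ℝ} (h : ∀ᵐ g ∂lam, repAct φ ψ g W = W) (g : G) :
    repAct φ ψ g W = W := by
  have h1 := (measurePreserving_mul_left lam g).quasiMeasurePreserving.ae h
  obtain ⟨x, hx, hx'⟩ := (h.and h1).exists
  rwa [repAct_mul, hx] at hx'

theorem repAct_eq_self_of_tensorForm_eq_zero [MeasurableMul G] [lam.IsMulLeftInvariant]
    (hφ : IsMeasurableRep φ) (hψ : IsMeasurableRep ψ) {W : Matrix (Fin d) (Fin k) ℝ}
    (h : tensorForm (repTensor lam φ ψ) W = 0) (g : G) : repAct φ ψ g W = W := by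
  refine repAct_eq_self_of_ae (lam := lam) ?_ g
  rw [tensorForm_repTensor_eq_integral hφ hψ] at h
  have hint : Integrable (fun g => frobSq (W - repAct φ ψ g W)) lam := by
    simp_rw [frobSq_sub_repAct]
    exact ((integrable_const _).sub (integrable_trace_mul_repAct hφ hψ W W)).const_mul 2
  have h1 := (integral_eq_zero_iff_of_nonneg (fun g => frobSq_nonneg _) hint).1 (by linarith)
  filter_upwards [h1] with g hg
  exact (sub_eq_zero.1 (eq_zero_of_frobSq_nonpos (le_of_eq hg))).symm

theorem tensorForm_single (T : Fin d → Fin d → Fin k → Fin k → ℝ) (a : Fin d) (b : Fin k) :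
    tensorForm T (Matrix.single a b 1) = 1 - T a a b b := by
  have h1 : ∀ i j, Matrix.single a b (1 : ℝ) i j = if a = i then (if b = j then 1 else 0) else 0 :=
    fun i j => by simp [Matrix.single_apply, ite_and]
  rw [tensorForm, frobSq_eq_sum]
  simp [h1]

/-- The defect is the trace of the quadratic form. -/
theorem codim_eq_sum_tensorForm (hφ : IsMeasurableRep φ) (hψ : IsMeasurableRep ψ) :
    codim lam φ ψ = ∑ a, ∑ b, tensorForm (repTensor lam φ ψ) (Matrix.single a b 1) := by
  simp [codim_eq_sum hφ hψ, tensorForm_single]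

/-- If the defect `dk - ⟨χ_ψ, χ_φ⟩` vanishes then the group acts trivially on matrices. -/
theorem repAct_eq_self_of_codim_eq_zero [MeasurableMul G] [lam.IsMulLeftInvariant]
    (hφ : IsMeasurableRep φ) (hψ : IsMeasurableRep ψ) (h : codim lam φ ψ = 0) (g : G)
    (W : Matrix (Fin d) (Fin k) ℝ) : repAct φ ψ g W = W := by
  rw [codim_eq_sum_tensorForm hφ hψ] at h
  have h1 : ∀ c e, repAct φ ψ g (Matrix.single c e 1) = Matrix.single c e 1 := fun c e => by
    refine repAct_eq_self_of_tensorForm_eq_zero (lam := lam) hφ hψ ?_ g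
    have h2 := (Finset.sum_eq_zero_iff_of_nonneg fun a _ => Finset.sum_nonneg fun b _ =>
      tensorForm_repTensor_nonneg hφ hψ _).1 h c (Finset.mem_univ c)
    exact (Finset.sum_eq_zero_iff_of_nonneg fun b _ =>
      tensorForm_repTensor_nonneg hφ hψ _).1 h2 e (Finset.mem_univ e)
  conv_lhs => rw [matrix_eq_sum_single W]
  conv_rhs => rw [matrix_eq_sum_single W]
  simp only [repAct, Matrix.mul_sum, Matrix.sum_mul]
  refine Finset.sum_congr rfl fun a _ => Finset.sum_congr rfl fun b _ => ?_
  have h3 := h1 a b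
  rw [show Matrix.single a b (W a b) = W a b • Matrix.single a b 1 by simp,
    Matrix.mul_smul, Matrix.smul_mul]
  rw [repAct] at h3
  rw [h3]

end Intertwining

/-! ### Quadratic forms of noise matrices -/

section Noise

open Matrix
open scoped ENNReal

variable {n d k : ℕ}

/-- The matrix `M` such that the form with tensor `T` has mean `σ² ∑ M a c (C Cᵀ) a c` at `C N`,
for a noise matrix `N` with uncorrelated centred entries of variance `σ²`. -/
def noiseMatrix (T : Fin d → Fin d → Fin k → Fin k → ℝ) : Matrix (Fin d) (Fin d) ℝ :=
  of fun a c => (if a = c then (k : ℝ) else 0) - ∑ b, T a c b b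

theorem trace_noiseMatrix (T : Fin d → Fin d → Fin k → Fin k → ℝ) :
    (noiseMatrix T).trace = (d : ℝ) * k - ∑ a, ∑ b, T a a b b := by
  simp [noiseMatrix, trace]

theorem noiseMatrix_apply_self (T : Fin d → Fin d → Fin k → Fin k → ℝ) (a : Fin d) :
    noiseMatrix T a a = ∑ b, tensorForm T (Matrix.single a b 1) := by
  simp [noiseMatrix, tensorForm_single]

theorem sum_noiseMatrix_mul (T : Fin d → Fin d → Fin k → Fin k → ℝ)
    (K : Matrix (Fin d) (Fin d) ℝ) : ∑ a, ∑ c, noiseMatrix T a c * K a c =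
      k * K.trace - ∑ a, ∑ c, ∑ b, T a c b b * K a c := by
  simp [noiseMatrix, sub_mul, Finset.sum_mul, trace, Finset.mul_sum]

/-- The sum is that of the values of the form at the products of a column of `C` with a basis
vector. -/
theorem sum_noiseMatrix_mul_nonneg {T : Fin d → Fin d → Fin k → Fin k → ℝ}
    (hT : ∀ W, 0 ≤ tensorForm T W) (C : Matrix (Fin d) (Fin n) ℝ) :
    0 ≤ ∑ a, ∑ c, noiseMatrix T a c * (C * Cᵀ) a c := by
  have h1 : ∀ (j : Fin n) (b : Fin k),
      tensorForm T (vecMulVec (fun a => C a j) (Pi.single b 1)) =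
        ∑ a, C a j * C a j - ∑ a, ∑ c, T a c b b * (C a j * C c j) := fun j b => by
    rw [tensorForm, frobSq_eq_sum]
    simp [vecMulVec_apply, Pi.single_apply, sq]
  have h2 : ∑ a, ∑ c, noiseMatrix T a c * (C * Cᵀ) a c =
      ∑ j, ∑ b, tensorForm T (vecMulVec (fun a => C a j) (Pi.single b 1)) := by
    simp_rw [h1, Finset.sum_sub_distrib]
    rw [sum_noiseMatrix_mul]
    congr 1
    · simp only [trace, diag_apply, mul_apply, transpose_apply, Finset.sum_const,
        Finset.card_univ, Fintype.card_fin, nsmul_eq_mul, ← Finset.mul_sum]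
      rw [Finset.sum_comm]
    · simp only [mul_apply, transpose_apply, Finset.mul_sum]
      have h3 : ∀ (a c : Fin d), ∑ b, ∑ j, T a c b b * (C a j * C c j) =
          ∑ j, ∑ b, T a c b b * (C a j * C c j) := fun a c => Finset.sum_comm
      simp_rw [h3]
      rw [Finset.sum_congr rfl fun a _ => Finset.sum_comm, Finset.sum_comm]
      refine Finset.sum_congr rfl fun j _ => ?_
      rw [Finset.sum_congr rfl fun a _ => Finset.sum_comm, Finset.sum_comm]
  rw [h2]
  exact Finset.sum_nonneg fun j _ => Finset.sum_nonneg fun b _ => hT _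

variable {Γ : Type*} [MeasurableSpace Γ] {ν : Measure Γ} [IsProbabilityMeasure ν]

theorem add_smul_mul_apply (V : Matrix (Fin d) (Fin k) ℝ) (C : Matrix (Fin d) (Fin n) ℝ)
    (N : Matrix (Fin n) (Fin k) ℝ) (s : ℝ) (a : Fin d) (b : Fin k) :
    (V + s • (C * N)) a b = V a b + ∑ i, s * C a i * N i b := by
  simp [mul_apply, Finset.mul_sum, mul_assoc]

theorem memLp_add_smul_mul_apply {N : Γ → Matrix (Fin n) (Fin k) ℝ}
    (hN : ∀ i b, MemLp (fun γ => N γ i b) 2 ν) (V : Matrix (Fin d) (Fin k) ℝ)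
    (C : Matrix (Fin d) (Fin n) ℝ) (s : ℝ) (a : Fin d) (b : Fin k) :
    MemLp (fun γ => (V + s • (C * N γ)) a b) 2 ν := by
  simp_rw [add_smul_mul_apply]
  exact MemLp.add (f := fun _ => V a b) (g := fun γ => ∑ i, s * C a i * N γ i b)
    (memLp_const (V a b)) (memLp_finsetSum _ fun i _ => (hN i b).const_mul (s * C a i))

theorem integral_add_smul_mul_apply_mul {N : Γ → Matrix (Fin n) (Fin k) ℝ} {v : ℝ}
    (hN : ∀ i b, MemLp (fun γ => N γ i b) 2 ν) (hmean : ∀ i b, ∫ γ, N γ i b ∂ν = 0)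
    (hcov : ∀ i j b e, ∫ γ, N γ i b * N γ j e ∂ν = if i = j then (if b = e then v else 0) else 0)
    (V : Matrix (Fin d) (Fin k) ℝ) (C : Matrix (Fin d) (Fin n) ℝ) (s : ℝ)
    (a c : Fin d) (b e : Fin k) :
    ∫ γ, (V + s • (C * N γ)) a b * (V + s • (C * N γ)) c e ∂ν =
      V a b * V c e + if b = e then s ^ 2 * v * (C * Cᵀ) a c else 0 := by
  simp_rw [add_smul_mul_apply]
  have hi : ∀ i b, Integrable (fun γ => N γ i b) ν := fun i b => (hN i b).integrable one_le_two
  have hii : ∀ i j b e, Integrable (fun γ => N γ i b * N γ j e) ν :=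
    fun i j b e => (hN i b).integrable_mul (hN j e)
  have hexp : ∀ γ, (V a b + ∑ i, s * C a i * N γ i b) * (V c e + ∑ i, s * C c i * N γ i e) =
      V a b * V c e + (∑ i, V a b * (s * C c i) * N γ i e) +
        (∑ i, V c e * (s * C a i) * N γ i b) +
        ∑ i, ∑ j, s * C a i * (s * C c j) * (N γ i b * N γ j e) := fun γ => by
    rw [add_mul, mul_add, mul_add, Finset.sum_mul_sum, Finset.mul_sum, Finset.sum_mul]
    rw [Finset.sum_congr rfl fun i _ => show V a b * (s * C c i * N γ i e) =
        V a b * (s * C c i) * N γ i e by ring,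
      Finset.sum_congr rfl fun i _ => show s * C a i * N γ i b * V c e =
        V c e * (s * C a i) * N γ i b by ring,
      Finset.sum_congr rfl fun i _ => Finset.sum_congr rfl fun j _ =>
        show s * C a i * N γ i b * (s * C c j * N γ j e) =
          s * C a i * (s * C c j) * (N γ i b * N γ j e) by ring]
    ring
  simp_rw [hexp]
  have i1 : Integrable (fun γ => ∑ i, V a b * (s * C c i) * N γ i e) ν :=
    integrable_finsetSum _ fun i _ => (hi i e).const_mul _
  have i2 : Integrable (fun γ => ∑ i, V c e * (s * C a i) * N γ i b) ν :=
    integrable_finsetSum _ fun i _ => (hi i b).const_mul _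
  have i3 : Integrable (fun γ => ∑ i, ∑ j, s * C a i * (s * C c j) * (N γ i b * N γ j e)) ν :=
    integrable_finsetSum _ fun i _ => integrable_finsetSum _ fun j _ => (hii i j b e).const_mul _
  rw [integral_add (((integrable_const _).fun_add i1).fun_add i2) i3,
    integral_add ((integrable_const _).fun_add i1) i2, integral_add (integrable_const _) i1,
    integral_finsetSum _ fun i _ => (hi i e).const_mul _,
    integral_finsetSum _ fun i _ => (hi i b).const_mul _,
    integral_sum_sum fun i j => (hii i j b e).const_mul _]
  simp_rw [integral_const_mul, hmean, hcov]
  simp only [integral_const, probReal_univ, one_smul, mul_zero, Finset.sum_const_zero, add_zero]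
  congr 1
  split_ifs with h
  · simp [mul_apply, Finset.mul_sum]
    exact Finset.sum_congr rfl fun i _ => by ring
  · simp

/-- Centred noise contributes to the mean of a quadratic form through its covariance only. -/
theorem integral_tensorForm_add_noise {N : Γ → Matrix (Fin n) (Fin k) ℝ} {v : ℝ}
    (hN : ∀ i b, MemLp (fun γ => N γ i b) 2 ν) (hmean : ∀ i b, ∫ γ, N γ i b ∂ν = 0)
    (hcov : ∀ i j b e, ∫ γ, N γ i b * N γ j e ∂ν = if i = j then (if b = e then v else 0) else 0)
    (T : Fin d → Fin d → Fin k → Fin k → ℝ)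
    (V : Matrix (Fin d) (Fin k) ℝ) (C : Matrix (Fin d) (Fin n) ℝ) (s : ℝ) :
    ∫ γ, tensorForm T (V + s • (C * N γ)) ∂ν =
      tensorForm T V + s ^ 2 * v * ∑ a, ∑ c, noiseMatrix T a c * (C * Cᵀ) a c := by
  have hw := fun a b => memLp_add_smul_mul_apply hN V C s a b
  rw [integral_tensorForm fun a c b e => (hw a b).integrable_mul (hw c e), tensorForm,
    frobSq_eq_sum]
  simp_rw [sq (V _ _)]
  have hmul := integral_add_smul_mul_apply_mul hN hmean hcov V C s
  simp_rw [hmul]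
  rw [sum_noiseMatrix_mul]
  simp only [if_true, mul_add, Finset.sum_add_distrib, mul_ite, mul_zero, Finset.sum_ite_eq,
    Finset.mem_univ, Finset.sum_const, Finset.card_univ, Fintype.card_fin, nsmul_eq_mul,
    ← Finset.mul_sum]
  have e1 : ∑ a, ∑ c, ∑ b, T a c b b * (s ^ 2 * v * (C * Cᵀ) a c) =
      s ^ 2 * v * ∑ a, ∑ c, ∑ b, T a c b b * (C * Cᵀ) a c := by
    simp only [Finset.mul_sum]
    exact Finset.sum_congr rfl fun a _ => Finset.sum_congr rfl fun c _ =>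
      Finset.sum_congr rfl fun b _ => by ring
  rw [e1, trace]
  simp only [diag_apply]
  ring

/-- The noise matrix of `n` independent copies of a centred noise vector with covariance `v • 1` has
uncorrelated centred entries of variance `v`. -/
theorem pi_noise_moments {μ : Measure (EuclideanSpace ℝ (Fin k))} [IsProbabilityMeasure μ] {v : ℝ}
    (hμ : MemLp id 2 μ) (hmean : ∀ b, ∫ y, y b ∂μ = 0)
    (hcov : ∀ b e, ∫ y, y b * y e ∂μ = if b = e then v else 0) :
    (∀ (i : Fin n) b, MemLp (fun y : Fin n → EuclideanSpace ℝ (Fin k) => rowStack y i b) 2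
      (Measure.pi fun _ => μ)) ∧
    (∀ (i : Fin n) b, ∫ y, rowStack y i b ∂(Measure.pi fun _ : Fin n => μ) = 0) ∧
    ∀ (i j : Fin n) b e, ∫ y, rowStack y i b * rowStack y j e ∂(Measure.pi fun _ : Fin n => μ) =
      if i = j then (if b = e then v else 0) else 0 := by
  have hev := fun i : Fin n => measurePreserving_eval (fun _ : Fin n => μ) i
  have hcoord : ∀ b : Fin k, Measurable fun y : EuclideanSpace ℝ (Fin k) => y b := fun b => by
    fun_prop
  have hL : ∀ b, MemLp (fun y : EuclideanSpace ℝ (Fin k) => y b) 2 μ := fun b => by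
    refine hμ.mono (hcoord b).aestronglyMeasurable (ae_of_all _ fun y => ?_)
    exact PiLp.norm_apply_le y b
  have hmem : ∀ (i : Fin n) b, MemLp (fun y : Fin n → EuclideanSpace ℝ (Fin k) => y i b) 2
      (Measure.pi fun _ => μ) := fun i b => (hL b).comp_measurePreserving (hev i)
  have hI : ∀ (i : Fin n) (f : EuclideanSpace ℝ (Fin k) → ℝ), Measurable f →
      ∫ y, f (y i) ∂(Measure.pi fun _ : Fin n => μ) = ∫ z, f z ∂μ := fun i f hf => by
    conv_rhs => rw [← (hev i).map_eq]
    rw [integral_map (hev i).measurable.aemeasurable hf.aestronglyMeasurable]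
  have hm : ∀ (i : Fin n) b, ∫ y, y i b ∂(Measure.pi fun _ : Fin n => μ) = 0 :=
    fun i b => (hI i (fun z => z b) (hcoord b)).trans (hmean b)
  refine ⟨hmem, hm, fun i j b e => ?_⟩
  simp only [rowStack, of_apply]
  by_cases hij : i = j
  · subst hij
    rw [if_pos rfl, ← hcov b e]
    exact hI i (fun z => z b * z e) ((hcoord b).mul (hcoord e))
  · rw [if_neg hij]
    have hind := (iIndepFun_pi (μ := fun _ : Fin n => μ) (X := fun _ y => y)
      fun _ => aemeasurable_id).indepFun hij
    have h2 := hind.comp (hcoord b) (hcoord e)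
    have h3 := h2.integral_fun_mul_eq_mul_integral (hmem i b).aestronglyMeasurable
      (hmem j e).aestronglyMeasurable
    simp only [Function.comp_def] at h3
    rw [h3, hm, zero_mul]

end Noise

/-! ### The law of the sample and the risk -/

section Sampling

open Matrix
open scoped ENNReal RealInnerProductSpace

variable {n d k : ℕ} {Ω : Type*} [MeasurableSpace Ω] {P : Measure Ω}

theorem measurable_linPred (W : Matrix (Fin d) (Fin k) ℝ) : Measurable (linPred W) :=
  (LinearMap.continuous_of_finiteDimensional (toEuclideanLin Wᵀ)).measurable

theorem linPred_apply (W : Matrix (Fin d) (Fin k) ℝ) (x : EuclideanSpace ℝ (Fin d)) (b : Fin k) :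
    linPred W x b = ∑ a, W a b * x a := by
  simp [linPred, toLpLin_apply, mulVec, dotProduct]

theorem posSemidef_sq_smul_one (σ : ℝ) : (σ ^ 2 • (1 : Matrix (Fin d) (Fin d) ℝ)).PosSemidef :=
  Matrix.PosSemidef.one.smul (sq_nonneg σ)

theorem map_inv_smul_multivariateGaussian {σ : ℝ} (hσ : σ ≠ 0) :
    (multivariateGaussian 0 (σ ^ 2 • (1 : Matrix (Fin d) (Fin d) ℝ))).map (fun x => σ⁻¹ • x) =
      stdGaussian (EuclideanSpace ℝ (Fin d)) := by
  apply Measure.ext_of_charFun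
  ext t
  rw [charFun_map_smul, charFun_multivariateGaussian (posSemidef_sq_smul_one σ),
    charFun_stdGaussian]
  congr 1
  have h : (σ⁻¹ • t).ofLp ⬝ᵥ (σ ^ 2 • (1 : Matrix (Fin d) (Fin d) ℝ)) *ᵥ (σ⁻¹ • t).ofLp =
      ‖t‖ ^ 2 := by
    rw [EuclideanSpace.real_norm_sq_eq, smul_mulVec, one_mulVec, dotProduct]
    refine Finset.sum_congr rfl fun i _ => ?_
    simp
    field_simp
  rw [h]
  simp [neg_div]

/-- The sample consists of a rescaled Gaussian design and of an independent i.i.d. noise. -/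
theorem hasLaw_design_noise [IsProbabilityMeasure P] {σX : ℝ} (hσX : σX ≠ 0)
    (Θ : Matrix (Fin d) (Fin k) ℝ) {X : Ω → EuclideanSpace ℝ (Fin d)} {ξ Y : Ω → EuclideanSpace ℝ (Fin k)}
    (hX : HasLaw X (multivariateGaussian 0 (σX ^ 2 • (1 : Matrix (Fin d) (Fin d) ℝ))) P)
    (hξ : AEMeasurable ξ P) (hXξ : IndepFun X ξ P)
    (hY : ∀ ω, Y ω = linPred Θ (X ω) + ξ ω)
    {Xs : Fin n → Ω → EuclideanSpace ℝ (Fin d)} {Ys : Fin n → Ω → EuclideanSpace ℝ (Fin k)}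
    (h_ident : ∀ i, IdentDistrib (fun ω => (Xs i ω, Ys i ω)) (fun ω => (X ω, Y ω)) P P)
    (h_indep : iIndepFun (fun (i : Fin n) ω => (Xs i ω, Ys i ω)) P) :
    HasLaw (fun ω => (fun i => σX⁻¹ • Xs i ω, fun i => Ys i ω - linPred Θ (Xs i ω)))
      ((gaussianDesign n d).prod (Measure.pi fun _ : Fin n => P.map ξ)) P := by
  have : IsProbabilityMeasure (P.map ξ) := Measure.isProbabilityMeasure_map hξ
  set g : EuclideanSpace ℝ (Fin d) × EuclideanSpace ℝ (Fin k) →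
      EuclideanSpace ℝ (Fin d) × EuclideanSpace ℝ (Fin k) :=
    fun z => (σX⁻¹ • z.1, z.2 - linPred Θ z.1) with hg
  have hgm : Measurable g := (measurable_fst.const_smul σX⁻¹).prodMk
    (measurable_snd.sub ((measurable_linPred Θ).comp measurable_fst))
  have hlaw1 : HasLaw (fun ω => (σX⁻¹ • X ω, ξ ω))
      ((stdGaussian (EuclideanSpace ℝ (Fin d))).prod (P.map ξ)) P := by
    have h1 : HasLaw (fun ω => σX⁻¹ • X ω) (stdGaussian (EuclideanSpace ℝ (Fin d))) P := by
      refine ⟨(measurable_const_smul σX⁻¹).comp_aemeasurable hX.aemeasurable, ?_⟩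
      rw [← map_inv_smul_multivariateGaussian hσX, ← hX.map_eq,
        AEMeasurable.map_map_of_aemeasurable (by fun_prop) hX.aemeasurable]
      rfl
    exact (indepFun_iff_hasLaw_prodMk_prod h1 ⟨hξ, rfl⟩).1
      (hXξ.comp (measurable_const_smul σX⁻¹) measurable_id)
  have hlaw : ∀ i, HasLaw (fun ω => g (Xs i ω, Ys i ω))
      ((stdGaussian (EuclideanSpace ℝ (Fin d))).prod (P.map ξ)) P := fun i => by
    have h2 := (h_ident i).comp hgm
    refine ⟨h2.aemeasurable_fst, ?_⟩
    have h3 : g ∘ (fun ω => (X ω, Y ω)) = fun ω => (σX⁻¹ • X ω, ξ ω) := by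
      ext1 ω
      simp [hg, hY]
    rw [h3] at h2
    exact h2.map_eq.trans hlaw1.map_eq
  have hpi : HasLaw (fun ω i => g (Xs i ω, Ys i ω)) (Measure.pi fun _ : Fin n =>
      (stdGaussian (EuclideanSpace ℝ (Fin d))).prod (P.map ξ)) P :=
    (h_indep.comp (fun _ => g) fun _ => hgm).hasLaw_pi hlaw
  exact (measurePreserving_arrowProdEquivProdArrow (EuclideanSpace ℝ (Fin d))
    (EuclideanSpace ℝ (Fin k)) (Fin n) (fun _ => stdGaussian (EuclideanSpace ℝ (Fin d)))
    (fun _ => P.map ξ)).comp_hasLaw hpi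

theorem memLp_of_hasLaw_gaussian {σ : ℝ} {X : Ω → EuclideanSpace ℝ (Fin d)}
    (hX : HasLaw X (multivariateGaussian 0 (σ ^ 2 • (1 : Matrix (Fin d) (Fin d) ℝ))) P)
    (a : Fin d) : MemLp (fun ω => X ω a) 2 P := by
  have h1 : MemLp (id : EuclideanSpace ℝ (Fin d) → _) 2 (P.map X) := by
    rw [hX.map_eq]; exact IsGaussian.memLp_two_id
  have h2 := h1.comp_of_map hX.aemeasurable
  refine h2.mono (Measurable.comp_aemeasurable (by fun_prop : Measurable
    fun x : EuclideanSpace ℝ (Fin d) => x a) hX.aemeasurable).aestronglyMeasurable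
      (ae_of_all _ fun ω => ?_)
  exact PiLp.norm_apply_le (X ω) a

theorem integral_gaussian_apply {σ : ℝ} {X : Ω → EuclideanSpace ℝ (Fin d)}
    (hX : HasLaw X (multivariateGaussian 0 (σ ^ 2 • (1 : Matrix (Fin d) (Fin d) ℝ))) P)
    (a : Fin d) : ∫ ω, X ω a ∂P = 0 := by
  have h1 := hX.integral_comp (f := fun x : EuclideanSpace ℝ (Fin d) => x a)
    (Measurable.aestronglyMeasurable (by fun_prop))
  simp only [Function.comp_def] at h1
  rw [h1]
  have h2 := (EuclideanSpace.proj a : EuclideanSpace ℝ (Fin d) →L[ℝ] ℝ).integral_comp_id_comm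
    (μ := multivariateGaussian 0 (σ ^ 2 • (1 : Matrix (Fin d) (Fin d) ℝ)))
    IsGaussian.integrable_id
  simpa using h2

theorem integral_gaussian_apply_mul [IsProbabilityMeasure P] {σ : ℝ}
    {X : Ω → EuclideanSpace ℝ (Fin d)}
    (hX : HasLaw X (multivariateGaussian 0 (σ ^ 2 • (1 : Matrix (Fin d) (Fin d) ℝ))) P)
    (a c : Fin d) : ∫ ω, X ω a * X ω c ∂P = if a = c then σ ^ 2 else 0 := by
  have h1 := hX.covariance_fun_comp (f := fun x : EuclideanSpace ℝ (Fin d) => x a)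
    (g := fun x => x c) (Measurable.aemeasurable (by fun_prop))
    (Measurable.aemeasurable (by fun_prop))
  rw [covariance_eval_multivariateGaussian (posSemidef_sq_smul_one σ),
    covariance_eq_sub (memLp_of_hasLaw_gaussian hX a) (memLp_of_hasLaw_gaussian hX c),
    integral_gaussian_apply hX, zero_mul, sub_zero] at h1
  simpa [one_apply] using h1

/-- The risk of a linear predictor is its squared distance to the target plus the noise level. -/
theorem risk_linPred [IsProbabilityMeasure P] {σX σξ : ℝ} (Θ : Matrix (Fin d) (Fin k) ℝ)
    {X : Ω → EuclideanSpace ℝ (Fin d)} {ξ Y : Ω → EuclideanSpace ℝ (Fin k)}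
    (hX : HasLaw X (multivariateGaussian 0 (σX ^ 2 • (1 : Matrix (Fin d) (Fin d) ℝ))) P)
    (hξ : ∀ b, MemLp (fun ω => ξ ω b) 2 P) (hXξ : IndepFun X ξ P)
    (hξ_mean : ∀ b, ∫ ω, ξ ω b ∂P = 0)
    (hξ_cov : ∀ i j : Fin k, ∫ ω, ξ ω i * ξ ω j ∂P = if i = j then σξ ^ 2 else 0)
    (hY : ∀ ω, Y ω = linPred Θ (X ω) + ξ ω) (U : Matrix (Fin d) (Fin k) ℝ) :
    risk P X Y (linPred U) = σX ^ 2 * frobSq (U - Θ) + k * σξ ^ 2 := by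
  set D := U - Θ with hD
  have hXm := fun a => memLp_of_hasLaw_gaussian hX a
  have hL : ∀ b, MemLp (fun ω => linPred D (X ω) b) 2 P := fun b => by
    simp_rw [linPred_apply]
    exact memLp_finsetSum _ fun a _ => (hXm a).const_mul (D a b)
  have hLL : ∀ b, ∫ ω, linPred D (X ω) b * linPred D (X ω) b ∂P =
      σX ^ 2 * ∑ a, D a b ^ 2 := fun b => by
    simp_rw [linPred_apply, Finset.sum_mul_sum]
    have h1 : ∀ (ω : Ω) (a c : Fin d), D a b * X ω a * (D c b * X ω c) =
        D a b * D c b * (X ω a * X ω c) := fun ω a c => by ring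
    simp_rw [h1]
    have hXX : ∀ a c, Integrable (fun ω => X ω a * X ω c) P :=
      fun a c => (hXm a).integrable_mul (hXm c)
    rw [integral_sum_sum fun a c => (hXX a c).const_mul (D a b * D c b)]
    have h2 : ∀ a c, ∫ ω, D a b * D c b * (X ω a * X ω c) ∂P =
        D a b * D c b * if a = c then σX ^ 2 else 0 := fun a c => by
      rw [integral_const_mul, integral_gaussian_apply_mul hX]
    simp_rw [h2]
    simp [Finset.mul_sum]
    exact Finset.sum_congr rfl fun a _ => by ring
  have hLξ : ∀ b, ∫ ω, linPred D (X ω) b * ξ ω b ∂P = 0 := fun b => by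
    have hev : Measurable fun y : EuclideanSpace ℝ (Fin k) => y b := by fun_prop
    have h1 : IndepFun (fun ω => linPred D (X ω) b) (fun ω => ξ ω b) P :=
      hXξ.comp (hev.comp (measurable_linPred D)) hev
    rw [h1.integral_fun_mul_eq_mul_integral (hL b).aestronglyMeasurable
      (hξ b).aestronglyMeasurable, hξ_mean, mul_zero]
  have hpt : ∀ ω, ‖linPred U (X ω) - Y ω‖ ^ 2 = ∑ b, (linPred D (X ω) b * linPred D (X ω) b -
      2 * (linPred D (X ω) b * ξ ω b) + ξ ω b * ξ ω b) := fun ω => by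
    rw [EuclideanSpace.real_norm_sq_eq, hY]
    refine Finset.sum_congr rfl fun b _ => ?_
    have h1 : linPred D (X ω) b = linPred U (X ω) b - linPred Θ (X ω) b := by
      simp_rw [linPred_apply, ← Finset.sum_sub_distrib, hD, Matrix.sub_apply, sub_mul]
    rw [h1]
    simp only [PiLp.sub_apply, PiLp.add_apply]
    ring
  have hI1 : ∀ b, Integrable (fun ω => linPred D (X ω) b * linPred D (X ω) b) P :=
    fun b => (hL b).integrable_mul (hL b)
  have hI2 : ∀ b, Integrable (fun ω => 2 * (linPred D (X ω) b * ξ ω b)) P :=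
    fun b => ((hL b).integrable_mul (hξ b)).const_mul 2
  have hI3 : ∀ b, Integrable (fun ω => ξ ω b * ξ ω b) P :=
    fun b => (hξ b).integrable_mul (hξ b)
  rw [risk]
  simp_rw [hpt]
  have hI : ∀ b, Integrable (fun ω => linPred D (X ω) b * linPred D (X ω) b -
      2 * (linPred D (X ω) b * ξ ω b) + ξ ω b * ξ ω b) P :=
    fun b => ((hI1 b).sub (hI2 b)).add (hI3 b)
  rw [integral_finsetSum _ fun b _ => hI b]
  have hb : ∀ b, ∫ ω, (linPred D (X ω) b * linPred D (X ω) b -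
      2 * (linPred D (X ω) b * ξ ω b) + ξ ω b * ξ ω b) ∂P =
      σX ^ 2 * ∑ a, D a b ^ 2 + σξ ^ 2 := fun b => by
    have hI12 : Integrable (fun ω => linPred D (X ω) b * linPred D (X ω) b -
        2 * (linPred D (X ω) b * ξ ω b)) P := (hI1 b).sub (hI2 b)
    rw [integral_add hI12 (hI3 b), integral_sub (hI1 b) (hI2 b),
      integral_const_mul, hLL, hLξ, hξ_cov, if_pos rfl]
    ring
  simp_rw [hb]
  rw [Finset.sum_add_distrib, ← Finset.mul_sum, Finset.sum_comm, ← frobSq_eq_sum]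
  simp

end Sampling

/-! ### The mean of a quadratic form at the estimate -/

section EstimateMean

open Matrix
open scoped ENNReal

variable {n d k : ℕ}

/-- The least squares estimate in terms of the normalised design `x` and of the noise `y`. -/
noncomputable def estimate (Θ : Matrix (Fin d) (Fin k) ℝ) (s : ℝ)
    (z : (Fin n → EuclideanSpace ℝ (Fin d)) × (Fin n → EuclideanSpace ℝ (Fin k))) :
    Matrix (Fin d) (Fin k) ℝ :=
  rowProj (rowStack z.1) * Θ + s • (pinv (rowStack z.1) * rowStack z.2)

theorem leastSquares_eq_estimate {Θ : Matrix (Fin d) (Fin k) ℝ} {σ : ℝ} (hσ : σ ≠ 0)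
    (x : Fin n → EuclideanSpace ℝ (Fin d)) (y : Fin n → EuclideanSpace ℝ (Fin k))
    (h : FullRank (rowStack fun i => σ⁻¹ • x i)) :
    leastSquares (rowStack x) (rowStack y) =
      estimate Θ σ⁻¹ (fun i => σ⁻¹ • x i, fun i => y i - linPred Θ (x i)) := by
  have h1 : rowStack x = σ • rowStack fun i => σ⁻¹ • x i := by
    ext i j
    simp [rowStack, hσ]
  have h2 : rowStack y = rowStack x * Θ + rowStack fun i => y i - linPred Θ (x i) := by
    ext i j
    simp [rowStack, mul_apply, linPred_apply, mul_comm]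
  conv_lhs => rw [h2, h1]
  rw [leastSquares_smul h hσ, estimate, Matrix.mul_add, smul_add, rowProj]
  simp only [Matrix.smul_mul, Matrix.mul_smul, smul_smul, inv_mul_cancel₀ hσ, one_smul,
    Matrix.mul_assoc]

theorem measurable_tensorForm {α : Type*} [MeasurableSpace α] {w : α → Matrix (Fin d) (Fin k) ℝ}
    (hw : ∀ a b, Measurable fun x => w x a b) (T : Fin d → Fin d → Fin k → Fin k → ℝ) :
    Measurable fun x => tensorForm T (w x) := by
  unfold tensorForm
  simp_rw [frobSq_eq_sum]
  exact (Finset.measurable_sum _ fun a _ => Finset.measurable_sum _ fun b _ =>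
    (hw a b).pow_const 2).sub (Finset.measurable_sum _ fun a _ => Finset.measurable_sum _ fun c _ =>
      Finset.measurable_sum _ fun b _ => Finset.measurable_sum _ fun e _ =>
        ((hw a b).mul (hw c e)).const_mul _)

theorem measurable_estimate_apply (Θ : Matrix (Fin d) (Fin k) ℝ) (s : ℝ) (a : Fin d) (b : Fin k) :
    Measurable fun z : (Fin n → EuclideanSpace ℝ (Fin d)) × (Fin n → EuclideanSpace ℝ (Fin k)) =>
      estimate Θ s z a b := by
  simp only [estimate, Matrix.add_apply, Matrix.smul_apply, smul_eq_mul]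
  refine Measurable.add ?_ (Measurable.const_mul ?_ s)
  · exact measurable_matrix_mul_apply (f := fun z : (Fin n → EuclideanSpace ℝ (Fin d)) ×
      (Fin n → EuclideanSpace ℝ (Fin k)) => rowProj (rowStack z.1)) (g := fun _ => Θ)
      (fun i j => (measurable_rowProj_apply i j).comp measurable_fst)
      (fun i j => measurable_const) a b
  · exact measurable_matrix_mul_apply (f := fun z : (Fin n → EuclideanSpace ℝ (Fin d)) ×
      (Fin n → EuclideanSpace ℝ (Fin k)) => pinv (rowStack z.1)) (g := fun z => rowStack z.2)
      (fun i j => (measurable_pinv_apply i j).comp measurable_fst)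
      (fun i j => (measurable_rowStack_apply i j).comp measurable_snd) a b

theorem measurable_tensorForm_rowProj (T : Fin d → Fin d → Fin k → Fin k → ℝ)
    (Θ : Matrix (Fin d) (Fin k) ℝ) : Measurable fun x : Fin n → EuclideanSpace ℝ (Fin d) =>
      tensorForm T (rowProj (rowStack x) * Θ) :=
  measurable_tensorForm (fun a b => measurable_matrix_mul_apply (g := fun _ => Θ)
    measurable_rowProj_apply (fun _ _ => measurable_const) a b) T

/-- The mean over the noise for a fixed design. -/
theorem lintegral_noise_tensorForm_estimate {T : Fin d → Fin d → Fin k → Fin k → ℝ}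
    (hT : ∀ W, 0 ≤ tensorForm T W) {μ : Measure (EuclideanSpace ℝ (Fin k))}
    [IsProbabilityMeasure μ] {v : ℝ} (hv : 0 ≤ v)
    (hμ : MemLp id 2 μ) (hmean : ∀ b, ∫ y, y b ∂μ = 0)
    (hcov : ∀ b e, ∫ y, y b * y e ∂μ = if b = e then v else 0)
    (Θ : Matrix (Fin d) (Fin k) ℝ) (s : ℝ) (x : Fin n → EuclideanSpace ℝ (Fin d)) :
    ∫⁻ y, ENNReal.ofReal (tensorForm T (estimate Θ s (x, y))) ∂(Measure.pi fun _ => μ) =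
      ENNReal.ofReal (tensorForm T (rowProj (rowStack x) * Θ)) + ENNReal.ofReal (s ^ 2 * v) *
        ENNReal.ofReal (∑ a, ∑ c, noiseMatrix T a c * pinvGram (rowStack x) a c) := by
  obtain ⟨h1, h2, h3⟩ := pi_noise_moments (n := n) hμ hmean hcov
  have hw : ∀ a b, MemLp (fun y : Fin n → EuclideanSpace ℝ (Fin k) => estimate Θ s (x, y) a b) 2
      (Measure.pi fun _ => μ) := memLp_add_smul_mul_apply h1 (rowProj (rowStack x) * Θ)
    (pinv (rowStack x)) s
  have hint : Integrable (fun y => tensorForm T (estimate Θ s (x, y)))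
      (Measure.pi fun _ : Fin n => μ) :=
    integrable_tensorForm (w := fun y => estimate Θ s (x, y))
      (fun a c b e => (hw a b).integrable_mul (hw c e)) T
  have hval : ∫ y, tensorForm T (estimate Θ s (x, y)) ∂(Measure.pi fun _ : Fin n => μ) =
      tensorForm T (rowProj (rowStack x) * Θ) +
        s ^ 2 * v * ∑ a, ∑ c, noiseMatrix T a c * pinvGram (rowStack x) a c :=
    integral_tensorForm_add_noise h1 h2 h3 T (rowProj (rowStack x) * Θ) (pinv (rowStack x)) s
  have hpos : 0 ≤ ∑ a, ∑ c, noiseMatrix T a c * pinvGram (rowStack x) a c :=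
    sum_noiseMatrix_mul_nonneg hT (pinv (rowStack x))
  rw [← ofReal_integral_eq_lintegral_ofReal hint (ae_of_all _ fun y => hT _), hval,
    ENNReal.ofReal_add (hT _) (mul_nonneg (by positivity) hpos),
    ENNReal.ofReal_mul (by positivity)]

/-- The mean of a nonnegative quadratic form at the estimate splits, conditionally on the design,
into a bias and a variance; both are nonnegative, so the identity holds with infinite values too. -/
theorem lintegral_tensorForm_estimate {T : Fin d → Fin d → Fin k → Fin k → ℝ}
    (hT : ∀ W, 0 ≤ tensorForm T W) {μ : Measure (EuclideanSpace ℝ (Fin k))}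
    [IsProbabilityMeasure μ] {v : ℝ} (hv : 0 ≤ v)
    (hμ : MemLp id 2 μ) (hmean : ∀ b, ∫ y, y b ∂μ = 0)
    (hcov : ∀ b e, ∫ y, y b * y e ∂μ = if b = e then v else 0)
    (Θ : Matrix (Fin d) (Fin k) ℝ) (s : ℝ) :
    ∫⁻ z, ENNReal.ofReal (tensorForm T (estimate Θ s z))
        ∂(gaussianDesign n d).prod (Measure.pi fun _ => μ) =
      ENNReal.ofReal (∫ x, tensorForm T (rowProj (rowStack x) * Θ) ∂gaussianDesign n d) +
        ENNReal.ofReal (s ^ 2 * v) * (ENNReal.ofReal (noiseMatrix T).trace *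
          ((∫⁻ x, ENNReal.ofReal (pinvGram (rowStack x)).trace ∂gaussianDesign n d) / d)) := by
  have hmeas := (measurable_tensorForm (measurable_estimate_apply (n := n) Θ s) T).ennreal_ofReal
  have hint : Integrable (fun x : Fin n → EuclideanSpace ℝ (Fin d) =>
      tensorForm T (rowProj (rowStack x) * Θ)) (gaussianDesign n d) :=
    integrable_tensorForm (fun a c b e => integrable_rowProj_mul_mul Θ a c b e) T
  have hdiag : ∀ a, 0 ≤ noiseMatrix T a a := fun a => by
    rw [noiseMatrix_apply_self]
    exact Finset.sum_nonneg fun b _ => hT _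
  have hlin := lintegral_linear_pinvGram (n := n) (noiseMatrix T) hdiag
    fun A => sum_noiseMatrix_mul_nonneg hT (pinv A)
  rw [lintegral_prod _ hmeas.aemeasurable,
    lintegral_congr (lintegral_noise_tensorForm_estimate hT hv hμ hmean hcov Θ s),
    lintegral_add_left (measurable_tensorForm_rowProj T Θ).ennreal_ofReal,
    lintegral_const_mul' _ _ ENNReal.ofReal_ne_top, hlin,
    ← ofReal_integral_eq_lintegral_ofReal hint (ae_of_all _ fun y => hT _)]

end EstimateMean

/-! ### Predictors that are no worse -/

section Risk

open scoped ENNReal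

variable {d k : ℕ} {Ω : Type*} [MeasurableSpace Ω] {P : Measure Ω}
  {X : Ω → EuclideanSpace ℝ (Fin d)} {Y : Ω → EuclideanSpace ℝ (Fin k)}
  {f f' f'' : Ω → EuclideanSpace ℝ (Fin d) → EuclideanSpace ℝ (Fin k)}

theorem risk_nonneg (h : EuclideanSpace ℝ (Fin d) → EuclideanSpace ℝ (Fin k)) :
    0 ≤ risk P X Y h :=
  integral_nonneg fun _ => sq_nonneg _

theorem genGap_le_genGap_of_isNoWorse (h : IsNoWorse P X Y f'' f') :
    ∀ᵐ ω ∂P, genGap P X Y f f' ω ≤ genGap P X Y f f'' ω := by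
  filter_upwards [h.2.2] with ω hω
  exact sub_le_sub_left hω _

/-- A risk that lies between zero and an integrable risk is integrable. -/
theorem integrable_genGap_of_isNoWorse (hf : Integrable (fun ω => risk P X Y (f ω)) P)
    (hgap : ∀ ω, 0 ≤ genGap P X Y f f' ω) (h : IsNoWorse P X Y f'' f') :
    Integrable (genGap P X Y f f'') P := by
  refine hf.mono' (hf.aemeasurable.sub h.2.1).aestronglyMeasurable ?_
  filter_upwards [genGap_le_genGap_of_isNoWorse (f := f) h] with ω hω
  rw [Real.norm_eq_abs, abs_of_nonneg ((hgap ω).trans hω), genGap]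
  exact sub_le_self _ (risk_nonneg _)

theorem integral_genGap_le_of_isNoWorse (hf : Integrable (fun ω => risk P X Y (f ω)) P)
    (hgap : ∀ ω, 0 ≤ genGap P X Y f f' ω) (hint : Integrable (genGap P X Y f f') P)
    (h : IsNoWorse P X Y f'' f') :
    ∫ ω, genGap P X Y f f' ω ∂P ≤ ∫ ω, genGap P X Y f f'' ω ∂P :=
  integral_mono_ae hint (integrable_genGap_of_isNoWorse hf hgap h)
    (genGap_le_genGap_of_isNoWorse h)

theorem lintegral_genGap_eq_top_of_isNoWorse
    (htop : ∫⁻ ω, ENNReal.ofReal (genGap P X Y f f' ω) ∂P = ⊤) (h : IsNoWorse P X Y f'' f') :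
    ∫⁻ ω, ENNReal.ofReal (genGap P X Y f f'' ω) ∂P = ⊤ := by
  refine top_unique (htop ▸ lintegral_mono_ae ?_)
  filter_upwards [genGap_le_genGap_of_isNoWorse (f := f) h] with ω hω
  exact ENNReal.ofReal_le_ofReal hω

end Risk

/-! ### Bias and variance of the least squares estimate -/

section LeastSquaresMean

open Matrix
open scoped ENNReal

variable {n d k : ℕ} {Ω : Type*} [MeasurableSpace Ω] {P : Measure Ω}

/-- The design has full rank almost surely, which makes the estimate explicit. -/
theorem ae_leastSquares_eq_estimate {Θ : Matrix (Fin d) (Fin k) ℝ} {σ : ℝ} (hσ : σ ≠ 0)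
    {Xs : Fin n → Ω → EuclideanSpace ℝ (Fin d)} {Ys : Fin n → Ω → EuclideanSpace ℝ (Fin k)}
    {ν : Measure (Fin n → EuclideanSpace ℝ (Fin k))} [IsProbabilityMeasure ν]
    (h : HasLaw (fun ω => (fun i => σ⁻¹ • Xs i ω, fun i => Ys i ω - linPred Θ (Xs i ω)))
      ((gaussianDesign n d).prod ν) P) :
    ∀ᵐ ω ∂P, leastSquares (rowStack fun i => Xs i ω) (rowStack fun i => Ys i ω) =
      estimate Θ σ⁻¹ (fun i => σ⁻¹ • Xs i ω, fun i => Ys i ω - linPred Θ (Xs i ω)) := by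
  have h1 : ∀ᵐ z ∂(gaussianDesign n d).prod ν, FullRank (rowStack z.1) :=
    Measure.quasiMeasurePreserving_fst.ae (ae_fullRank_gaussianDesign n d)
  rw [← h.map_eq] at h1
  filter_upwards [ae_of_ae_map h.aemeasurable h1] with ω hω
  exact leastSquares_eq_estimate hσ _ _ hω

/-- The mean of a nonnegative quadratic form at an estimate with a known sample law. -/
theorem lintegral_tensorForm_of_ae_eq_estimate {T : Fin d → Fin d → Fin k → Fin k → ℝ}
    (hT : ∀ W, 0 ≤ tensorForm T W) {μ : Measure (EuclideanSpace ℝ (Fin k))}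
    [IsProbabilityMeasure μ] {v : ℝ} (hv : 0 ≤ v)
    (hμ : MemLp id 2 μ) (hmean : ∀ b, ∫ y, y b ∂μ = 0)
    (hcov : ∀ b e, ∫ y, y b * y e ∂μ = if b = e then v else 0)
    {Θ : Matrix (Fin d) (Fin k) ℝ} {s : ℝ}
    {Z : Ω → (Fin n → EuclideanSpace ℝ (Fin d)) × (Fin n → EuclideanSpace ℝ (Fin k))}
    (hZ : HasLaw Z ((gaussianDesign n d).prod (Measure.pi fun _ => μ)) P)
    {W : Ω → Matrix (Fin d) (Fin k) ℝ} (hW : ∀ᵐ ω ∂P, W ω = estimate Θ s (Z ω)) :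
    ∫⁻ ω, ENNReal.ofReal (tensorForm T (W ω)) ∂P =
      ENNReal.ofReal (∫ x, tensorForm T (rowProj (rowStack x) * Θ) ∂gaussianDesign n d) +
        ENNReal.ofReal (s ^ 2 * v) * (ENNReal.ofReal (noiseMatrix T).trace *
          ((∫⁻ x, ENNReal.ofReal (pinvGram (rowStack x)).trace ∂gaussianDesign n d) / d)) := by
  rw [← lintegral_tensorForm_estimate hT hv hμ hmean hcov Θ s,
    ← hZ.lintegral_comp (measurable_tensorForm (measurable_estimate_apply Θ s)
      T).ennreal_ofReal.aemeasurable]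
  refine lintegral_congr_ae ?_
  filter_upwards [hW] with ω hω
  rw [hω]

theorem aemeasurable_tensorForm_of_ae_eq_estimate (T : Fin d → Fin d → Fin k → Fin k → ℝ)
    {μ : Measure ((Fin n → EuclideanSpace ℝ (Fin d)) × (Fin n → EuclideanSpace ℝ (Fin k)))}
    {Θ : Matrix (Fin d) (Fin k) ℝ} {s : ℝ}
    {Z : Ω → (Fin n → EuclideanSpace ℝ (Fin d)) × (Fin n → EuclideanSpace ℝ (Fin k))}
    (hZ : HasLaw Z μ P)
    {W : Ω → Matrix (Fin d) (Fin k) ℝ} (hW : ∀ᵐ ω ∂P, W ω = estimate Θ s (Z ω))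
    (V : Matrix (Fin d) (Fin k) ℝ) :
    AEMeasurable (fun ω => tensorForm T (W ω - V)) P := by
  refine ((measurable_tensorForm (w := fun z => estimate Θ s z - V) (fun a b => ?_)
    T).comp_aemeasurable hZ.aemeasurable).congr ?_
  · exact (measurable_estimate_apply Θ s a b).sub_const _
  · filter_upwards [hW] with ω hω
    simp [hω]

theorem tensorForm_zero (W : Matrix (Fin d) (Fin k) ℝ) :
    tensorForm (0 : Fin d → Fin d → Fin k → Fin k → ℝ) W = frobSq W := by
  simp [tensorForm]

theorem frobSq_sub_le (V W : Matrix (Fin d) (Fin k) ℝ) :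
    frobSq (V - W) ≤ 2 * frobSq V + 2 * frobSq W := by
  simp_rw [frobSq_eq_sum, Finset.mul_sum, ← Finset.sum_add_distrib]
  refine Finset.sum_le_sum fun a _ => Finset.sum_le_sum fun b _ => ?_
  rw [Matrix.sub_apply]
  nlinarith [sq_nonneg (V a b + W a b)]

/-- The variance above the threshold. In dimension zero the quotient on the left is `0 / 0 = 0`
while the right side need not vanish, hence the hypothesis on `t`. -/
theorem lintegral_trace_pinvGram_div_of_lt (hnd : d + 1 < n) {t : ℝ} (ht : d = 0 → t = 0) :
    ENNReal.ofReal t *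
      ((∫⁻ x, ENNReal.ofReal (pinvGram (rowStack x)).trace ∂gaussianDesign n d) / d) =
      ENNReal.ofReal (t / ((n : ℝ) - d - 1)) := by
  rcases Nat.eq_zero_or_pos d with h0 | h0
  · simp [ht h0]
  · have hn : (0 : ℝ) < (n : ℝ) - d - 1 := by
      have : ((d + 1 : ℕ) : ℝ) < n := by exact_mod_cast hnd
      push_cast at this; linarith
    rw [lintegral_trace_pinvGram_of_le (by omega), if_pos hnd, mul_comm (d : ℝ≥0∞),
      ENNReal.mul_div_cancel_right (by exact_mod_cast h0.ne') (ENNReal.natCast_ne_top d),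
      ← ENNReal.ofReal_mul' (by positivity), mul_one_div]

/-- The variance below the threshold. -/
theorem lintegral_trace_pinvGram_div_of_gt (hnd : n + 1 < d) (t : ℝ) :
    ENNReal.ofReal t *
      ((∫⁻ x, ENNReal.ofReal (pinvGram (rowStack x)).trace ∂gaussianDesign n d) / d) =
      ENNReal.ofReal (n * t / (d * ((d : ℝ) - n - 1))) := by
  have hd : (0 : ℝ) < (d : ℝ) - n - 1 := by
    have : ((n + 1 : ℕ) : ℝ) < d := by exact_mod_cast hnd
    push_cast at this; linarith
  have hd0 : (0 : ℝ) < d := by exact_mod_cast (by omega : 0 < d)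
  rw [lintegral_trace_pinvGram_of_lt (by omega), if_pos hnd, ← ENNReal.ofReal_natCast n,
    ← ENNReal.ofReal_natCast d, ← ENNReal.ofReal_mul (by positivity),
    ← ENNReal.ofReal_div_of_pos hd0, ← ENNReal.ofReal_mul' (by positivity)]
  congr 1
  field_simp

/-- At the threshold a reciprocal chi-square variable with at most two degrees of freedom appears,
and the variance is infinite. -/
theorem lintegral_trace_pinvGram_div_eq_top (hdn : d ≤ n + 1) (hnd : n ≤ d + 1) (hd : d ≠ 0)
    (hn : n ≠ 0) :
    (∫⁻ x, ENNReal.ofReal (pinvGram (rowStack x)).trace ∂gaussianDesign n d) / (d : ℝ≥0∞) = ⊤ := by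
  have h : ∫⁻ x, ENNReal.ofReal (pinvGram (rowStack x)).trace ∂gaussianDesign n d = ⊤ := by
    rcases le_or_gt d n with h | h
    · rw [lintegral_trace_pinvGram_of_le h, if_neg (by omega),
        ENNReal.mul_top (by exact_mod_cast hd)]
    · rw [lintegral_trace_pinvGram_of_lt h, if_neg (by omega),
        ENNReal.mul_top (by exact_mod_cast hn)]
  rw [h, ENNReal.top_div_of_ne_top (ENNReal.natCast_ne_top d)]

/-- With at least as many examples as dimensions the design is almost surely injective, so there
is no bias. -/
theorem integral_tensorForm_rowProj_of_le (h : d ≤ n) (T : Fin d → Fin d → Fin k → Fin k → ℝ)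
    (Θ : Matrix (Fin d) (Fin k) ℝ) :
    ∫ x, tensorForm T (rowProj (rowStack x) * Θ) ∂gaussianDesign n d = tensorForm T Θ := by
  have h1 : ∀ᵐ x ∂gaussianDesign n d, tensorForm T (rowProj (rowStack x) * Θ) =
      tensorForm T Θ := by
    filter_upwards [ae_fullRank_gaussianDesign n d] with x hx
    rw [rowProj_eq_one hx h, Matrix.one_mul]
  have : IsProbabilityMeasure (gaussianDesign n d) := inferInstance
  rw [integral_congr_ae h1, integral_const, probReal_univ, one_smul]

end LeastSquaresMean

end EquivariantRegression

/-! ### The generalisation gap -/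

theorem mainTheorem3
    {G : Type*} [Group G] [TopologicalSpace G] [IsTopologicalGroup G] [CompactSpace G]
    [T2Space G] [SecondCountableTopology G] [MeasurableSpace G] [BorelSpace G]
    (lam : Measure G) [lam.IsHaarMeasure] [IsProbabilityMeasure lam]
    {d k n : ℕ}
    (φ : G →* Matrix.orthogonalGroup (Fin d) ℝ) (hφ : IsMeasurableRep φ)
    (ψ : G →* Matrix.orthogonalGroup (Fin k) ℝ) (hψ : IsMeasurableRep ψ)
    (Θ : Matrix (Fin d) (Fin k) ℝ) (hΘ : IsEquivariant φ ψ (linPred Θ))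
    (σX σξ : ℝ) (hσX : 0 < σX) (hσξ : 0 ≤ σξ)
    {Ω : Type*} [MeasurableSpace Ω] (P : Measure Ω) [IsProbabilityMeasure P]
    -- the test example `(X, Y)`, with `Y = Θᵀ X + ξ`
    (X : Ω → EuclideanSpace ℝ (Fin d)) (ξ Y : Ω → EuclideanSpace ℝ (Fin k))
    (hX : HasLaw X (multivariateGaussian 0 (σX ^ 2 • (1 : Matrix (Fin d) (Fin d) ℝ))) P)
    (hξ : MemLp ξ 2 P) (hXξ : IndepFun X ξ P)
    (hξ_mean : ∫ ω, ξ ω ∂P = 0)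
    (hξ_cov : ∀ i j : Fin k, ∫ ω, ξ ω i * ξ ω j ∂P = if i = j then σξ ^ 2 else 0)
    (hY : ∀ ω, Y ω = linPred Θ (X ω) + ξ ω)
    -- the training examples: i.i.d. copies of `(X, Y)`, independent of `(X, Y)`
    (Xs : Fin n → Ω → EuclideanSpace ℝ (Fin d)) (Ys : Fin n → Ω → EuclideanSpace ℝ (Fin k))
    (h_ident : ∀ i, IdentDistrib (fun ω => (Xs i ω, Ys i ω)) (fun ω => (X ω, Y ω)) P P)
    (h_indep : iIndepFun (fun (i : Fin n) ω => (Xs i ω, Ys i ω)) P)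
    (h_test : IndepFun (fun ω (i : Fin n) => (Xs i ω, Ys i ω)) (fun ω => (X ω, Y ω)) P)
    -- the minimum-norm least squares estimate
    (W : Ω → Matrix (Fin d) (Fin k) ℝ)
    (hW : ∀ ω, W ω = leastSquares (rowStack fun i => Xs i ω) (rowStack fun i => Ys i ω))
    -- `fW` is the predictor `f_W` and `fWbar` its equivariant version `f_{Ψ(W)}`
    (fW fWbar : Ω → EuclideanSpace ℝ (Fin d) → EuclideanSpace ℝ (Fin k))
    (hfW : ∀ ω, fW ω = linPred (W ω))
    (hfWbar : ∀ ω, fWbar ω = linPred (intertwine lam φ ψ (W ω))) :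
    -- more examples than dimensions
    (d + 1 < n →
      (Integrable (genGap P X Y fW fWbar) P ∧
        ∫ ω, genGap P X Y fW fWbar ω ∂P = σξ ^ 2 * (codim lam φ ψ / ((n : ℝ) - d - 1))) ∧
      ∀ f', IsNoWorse P X Y f' fWbar →
        Integrable (genGap P X Y fW f') P ∧
        ∫ ω, genGap P X Y fW f' ω ∂P ≥ σξ ^ 2 * (codim lam φ ψ / ((n : ℝ) - d - 1))) ∧
    -- the interpolation threshold
    (d ≤ n + 1 → n ≤ d + 1 → 0 < σξ → ¬ (∀ᵐ ω ∂P, IsEquivariant φ ψ (fW ω)) →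
      ((∀ᵐ ω ∂P, 0 ≤ genGap P X Y fW fWbar ω) ∧
        ∫⁻ ω, ENNReal.ofReal (genGap P X Y fW fWbar ω) ∂P = ⊤) ∧
      ∀ f', IsNoWorse P X Y f' fWbar →
        (∀ᵐ ω ∂P, 0 ≤ genGap P X Y fW f' ω) ∧
        ∫⁻ ω, ENNReal.ofReal (genGap P X Y fW f' ω) ∂P = ⊤) ∧
    -- fewer examples than dimensions
    (n + 1 < d →
      (0 ≤ biasTerm lam φ ψ Θ σX n ∧ 0 ≤ noiseTerm lam φ ψ σξ n) ∧
      (Integrable (genGap P X Y fW fWbar) P ∧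
        ∫ ω, genGap P X Y fW fWbar ω ∂P =
          biasTerm lam φ ψ Θ σX n + noiseTerm lam φ ψ σξ n) ∧
      ∀ f', IsNoWorse P X Y f' fWbar →
        Integrable (genGap P X Y fW f') P ∧
        ∫ ω, genGap P X Y fW f' ω ∂P ≥
          biasTerm lam φ ψ Θ σX n + noiseTerm lam φ ψ σξ n) := by
  -- the moments of the noise, coordinate by coordinate
  have hξm : AEMeasurable ξ P := hξ.aestronglyMeasurable.aemeasurable
  set μ : Measure (EuclideanSpace ℝ (Fin k)) := P.map ξ with hμdef
  have : IsProbabilityMeasure μ := Measure.isProbabilityMeasure_map hξm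
  have hμ : MemLp id 2 μ :=
    (memLp_map_measure_iff aestronglyMeasurable_id hξm).2 hξ
  have hξ1 : ∀ b, MemLp (fun ω => ξ ω b) 2 P := fun b =>
    (EuclideanSpace.proj b : EuclideanSpace ℝ (Fin k) →L[ℝ] ℝ).comp_memLp' hξ
  have hξ2 : ∀ b, ∫ ω, ξ ω b ∂P = 0 := fun b => by
    have h1 := (EuclideanSpace.proj b : EuclideanSpace ℝ (Fin k) →L[ℝ] ℝ).integral_comp_comm
      (hξ.integrable one_le_two)
    rw [hξ_mean, map_zero] at h1
    exact h1
  have hmean : ∀ b, ∫ y, y b ∂μ = 0 := fun b => by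
    rw [hμdef, integral_map hξm (Measurable.aestronglyMeasurable (by fun_prop))]
    exact hξ2 b
  have hcov : ∀ b e, ∫ y, y b * y e ∂μ = if b = e then σξ ^ 2 else 0 := fun b e => by
    rw [hμdef, integral_map hξm (Measurable.aestronglyMeasurable (by fun_prop))]
    exact hξ_cov b e
  -- the gap is a nonnegative quadratic form of the estimate
  set T := repTensor lam φ ψ with hTdef
  have hT : ∀ U, 0 ≤ tensorForm T U := tensorForm_repTensor_nonneg hφ hψ
  have hfix : ∀ g, repAct φ ψ g Θ = Θ := (isEquivariant_linPred_iff φ ψ Θ).1 hΘ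
  have hrisk := risk_linPred Θ hX hξ1 hXξ hξ2 hξ_cov hY
  have hgap : ∀ ω, genGap P X Y fW fWbar ω = σX ^ 2 * tensorForm T (W ω) := fun ω => by
    rw [genGap, hfW, hfWbar, hrisk, hrisk, hTdef,
      ← frobSq_sub_sub_frobSq_intertwine_sub hφ hψ hfix]
    ring
  have hgap0 : ∀ ω, 0 ≤ genGap P X Y fW fWbar ω := fun ω => by
    rw [hgap]; exact mul_nonneg (sq_nonneg _) (hT _)
  have htr : (noiseMatrix T).trace = codim lam φ ψ := by
    rw [trace_noiseMatrix, codim_eq_sum hφ hψ]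
  have hcodim : 0 ≤ codim lam φ ψ := by
    rw [codim_eq_sum_tensorForm hφ hψ]
    exact Finset.sum_nonneg fun a _ => Finset.sum_nonneg fun b _ => hT _
  have hcodim0 : d = 0 → codim lam φ ψ = 0 := fun h0 => by
    subst h0
    rw [codim_eq_sum hφ hψ]
    simp
  -- the law of the sample
  have hZ := hasLaw_design_noise hσX.ne' Θ hX hξm hXξ hY h_ident h_indep
  have hWe : ∀ᵐ ω ∂P, W ω = estimate Θ σX⁻¹
      (fun i => σX⁻¹ • Xs i ω, fun i => Ys i ω - linPred Θ (Xs i ω)) := by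
    simp_rw [hW]
    exact ae_leastSquares_eq_estimate hσX.ne' hZ
  have hσ2 : 0 ≤ σX ^ 2 := sq_nonneg _
  have hσσ : σX ^ 2 * (σX⁻¹ ^ 2 * σξ ^ 2) = σξ ^ 2 := by field_simp
  have hform := fun (S : Fin d → Fin d → Fin k → Fin k → ℝ) (hS : ∀ U, 0 ≤ tensorForm S U) =>
    lintegral_tensorForm_of_ae_eq_estimate hS (sq_nonneg σξ) hμ hmean hcov hZ hWe
  have hlint : ∫⁻ ω, ENNReal.ofReal (genGap P X Y fW fWbar ω) ∂P =
      ENNReal.ofReal (σX ^ 2 *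
        ∫ x, tensorForm T (rowProj (rowStack x) * Θ) ∂gaussianDesign n d) +
      ENNReal.ofReal (σξ ^ 2) * (ENNReal.ofReal (codim lam φ ψ) *
        ((∫⁻ x, ENNReal.ofReal (pinvGram (rowStack x)).trace ∂gaussianDesign n d) / d)) := by
    simp_rw [hgap, ENNReal.ofReal_mul hσ2]
    rw [lintegral_const_mul' _ _ ENNReal.ofReal_ne_top, hform T hT, mul_add, ← mul_assoc,
      ← ENNReal.ofReal_mul hσ2, ← ENNReal.ofReal_mul hσ2, hσσ, htr]
  have hgapm : AEMeasurable (genGap P X Y fW fWbar) P := by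
    have h1 := (aemeasurable_tensorForm_of_ae_eq_estimate T hZ hWe 0).const_mul (σX ^ 2)
    simp only [sub_zero] at h1
    exact h1.congr (ae_of_all _ fun ω => (hgap ω).symm)
  have hbias0 : 0 ≤ σX ^ 2 * ∫ x, tensorForm T (rowProj (rowStack x) * Θ) ∂gaussianDesign n d :=
    mul_nonneg hσ2 (integral_nonneg fun x => hT _)
  -- with the zero tensor the form is the squared norm, so the risk is integrable as well
  have hriskint : ((∫⁻ x, ENNReal.ofReal (pinvGram (rowStack x)).trace ∂gaussianDesign n d) /
      (d : ENNReal) ≠ ⊤) → Integrable (fun ω => risk P X Y (fW ω)) P := fun hfin => by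
    have hm0 := aemeasurable_tensorForm_of_ae_eq_estimate
      (0 : Fin d → Fin d → Fin k → Fin k → ℝ) hZ hWe
    have hI : Integrable (fun ω => frobSq (W ω)) P := by
      have h2 := hm0 0
      simp only [tensorForm_zero, sub_zero] at h2
      rw [← lintegral_ofReal_ne_top_iff_integrable h2.aestronglyMeasurable
        (ae_of_all _ fun ω => frobSq_nonneg _)]
      have h3 := hform 0 fun U => by rw [tensorForm_zero]; exact frobSq_nonneg U
      simp_rw [tensorForm_zero] at h3
      rw [h3]
      exact ENNReal.add_ne_top.2 ⟨ENNReal.ofReal_ne_top, ENNReal.mul_ne_top ENNReal.ofReal_ne_top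
        (ENNReal.mul_ne_top ENNReal.ofReal_ne_top hfin)⟩
    have hI2 : Integrable (fun ω => frobSq (W ω - Θ)) P := by
      have h2 := hm0 Θ
      simp only [tensorForm_zero] at h2
      refine ((hI.const_mul 2).add (integrable_const (2 * frobSq Θ))).mono'
        h2.aestronglyMeasurable (ae_of_all _ fun ω => ?_)
      rw [Real.norm_eq_abs, abs_of_nonneg (frobSq_nonneg _)]
      exact frobSq_sub_le _ _
    simp_rw [hfW, hrisk]
    exact (hI2.const_mul _).add (integrable_const _)
  -- a finite mean gives integrability, and passes to predictors that are no worse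
  have hconcl : ∀ c : ℝ, 0 ≤ c → (∫⁻ x, ENNReal.ofReal (pinvGram (rowStack x)).trace
      ∂gaussianDesign n d) / (d : ENNReal) ≠ ⊤ →
      ∫⁻ ω, ENNReal.ofReal (genGap P X Y fW fWbar ω) ∂P = ENNReal.ofReal c →
      (Integrable (genGap P X Y fW fWbar) P ∧ ∫ ω, genGap P X Y fW fWbar ω ∂P = c) ∧
      ∀ f', IsNoWorse P X Y f' fWbar →
        Integrable (genGap P X Y fW f') P ∧ ∫ ω, genGap P X Y fW f' ω ∂P ≥ c := by
    intro c hc hfin hval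
    have hI : Integrable (genGap P X Y fW fWbar) P := by
      rw [← lintegral_ofReal_ne_top_iff_integrable hgapm.aestronglyMeasurable
        (ae_of_all _ hgap0), hval]
      exact ENNReal.ofReal_ne_top
    have hIv : ∫ ω, genGap P X Y fW fWbar ω ∂P = c := by
      rw [integral_eq_lintegral_of_nonneg_ae (ae_of_all _ hgap0) hgapm.aestronglyMeasurable, hval,
        ENNReal.toReal_ofReal hc]
    refine ⟨⟨hI, hIv⟩, fun f' hf' =>
      ⟨integrable_genGap_of_isNoWorse (hriskint hfin) hgap0 hf', ?_⟩⟩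
    rw [ge_iff_le, ← hIv]
    exact integral_genGap_le_of_isNoWorse (hriskint hfin) hgap0 hI hf'
  refine ⟨fun hnd => ?_, fun hdn hnd hσξ0 hne => ?_, fun hnd => ?_⟩
  · have hn : (0 : ℝ) < (n : ℝ) - d - 1 := by
      have : ((d + 1 : ℕ) : ℝ) < n := by exact_mod_cast hnd
      push_cast at this; linarith
    -- the bias vanishes, since the target is recovered exactly without noise
    refine hconcl _ (by positivity) ?_ ?_
    · rcases Nat.eq_zero_or_pos d with h0 | h0
      · rw [lintegral_trace_pinvGram_of_le (by omega)]
        simp [h0]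
      · have h1 := lintegral_trace_pinvGram_div_of_lt hnd (t := 1) (by omega)
        rw [ENNReal.ofReal_one, one_mul] at h1
        rw [h1]
        exact ENNReal.ofReal_ne_top
    · rw [hlint, integral_tensorForm_rowProj_of_le (by omega),
        tensorForm_eq_zero_of_fixed hφ hψ hfix, mul_zero, ENNReal.ofReal_zero, zero_add,
        lintegral_trace_pinvGram_div_of_lt hnd hcodim0, ← ENNReal.ofReal_mul (sq_nonneg _)]
  · -- if the defect vanishes, the group acts trivially and every linear predictor is equivariant
    have hc : codim lam φ ψ ≠ 0 := fun h0 => hne <| ae_of_all _ fun ω => by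
      rw [hfW, isEquivariant_linPred_iff]
      exact fun g => repAct_eq_self_of_codim_eq_zero hφ hψ h0 g (W ω)
    have hd0 : d ≠ 0 := fun h0 => hc (hcodim0 h0)
    -- without examples the estimate vanishes, and is equivariant
    have hn0 : n ≠ 0 := fun h0 => hne <| ae_of_all _ fun ω => by
      subst h0
      rw [hfW, isEquivariant_linPred_iff, hW, leastSquares_eq_zero_of_isEmpty]
      exact fun g => by simp [repAct]
    have htop : ∫⁻ ω, ENNReal.ofReal (genGap P X Y fW fWbar ω) ∂P = ⊤ := by
      have hcpos : 0 < codim lam φ ψ := hcodim.lt_of_ne' hc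
      rw [hlint, lintegral_trace_pinvGram_div_eq_top hdn hnd hd0 hn0,
        ENNReal.mul_top (ENNReal.ofReal_pos.2 hcpos).ne',
        ENNReal.mul_top (ENNReal.ofReal_pos.2 (by positivity)).ne', add_top]
    refine ⟨⟨ae_of_all _ hgap0, htop⟩, fun f' hf' =>
      ⟨?_, lintegral_genGap_eq_top_of_isNoWorse htop hf'⟩⟩
    filter_upwards [genGap_le_genGap_of_isNoWorse (f := fW) hf'] with ω hω
    exact (hgap0 ω).trans hω
  · have hd : (0 : ℝ) < (d : ℝ) - n - 1 := by
      have : ((n + 1 : ℕ) : ℝ) < d := by exact_mod_cast hnd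
      push_cast at this; linarith
    have hbias : σX ^ 2 * ∫ x, tensorForm T (rowProj (rowStack x) * Θ) ∂gaussianDesign n d =
        biasTerm lam φ ψ Θ σX n := by
      rw [integral_tensorForm_rowProj hnd T Θ (tensorForm_eq_zero_of_fixed hφ hψ hfix),
        biasTerm, trace_JMatrix_mul hφ hψ hfix, mul_assoc (σX ^ 2)]
    have hnoise : 0 ≤ noiseTerm lam φ ψ σξ n := by
      rw [noiseTerm]; positivity
    rw [hbias] at hbias0
    refine ⟨⟨hbias0, hnoise⟩, hconcl _ (add_nonneg hbias0 hnoise) ?_ ?_⟩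
    · have h1 := lintegral_trace_pinvGram_div_of_gt hnd 1
      rw [ENNReal.ofReal_one, one_mul] at h1
      rw [h1]
      exact ENNReal.ofReal_ne_top
    · rw [hlint, hbias, lintegral_trace_pinvGram_div_of_gt hnd, ← ENNReal.ofReal_mul (sq_nonneg _),
        ENNReal.ofReal_add hbias0 hnoise, noiseTerm]
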